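/- For every real $c>0$ there is a constant $B=B(c)>1$, depending only on $c$, such that the following holds. Let $\epsilon>0$ be real, let $d\ge 1$ and $n\ge 0$ be integers, and let $N,k$ be any integers with $N\ge B^{d}\epsilon^{-4-c}$ and $k\ge B d$. Let $X_1,\dots,X_N$ be independent random vectors in $\mathbb{R}^n$ such that for each $i$ the coordinates of $X_i$ form a $k$-independent family of standard Gaussians (each coordinate has law $\mathcal N(0,1)$, and any at most $k$ of the coordinates of $X_i$ are mutually independent), and let $X=\frac1{\sqrt N}\sum_{i=1}^N X_i$. Let $Y$ be a random vector in $\mathbb{R}^n$ whose coordinates are fully independent standard Gaussians. Then for every degree-$d$ polynomial threshold function $f$ on $\mathbb{R}^n$, that is, every $f(x)=\operatorname{sgn}(p(x))$ with $p$ a real polynomial in $n$ variables of total degree at most $d$ (and $\operatorname{sgn}(0)=0$), $$\bigl|\mathbb{E}[f(X)]-\mathbb{E}[f(Y)]\bigr|<\epsilon .$$ -/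

import Mathlib

open MeasureTheory ProbabilityTheory

/-- `f : ℝⁿ → ℝ` is a degree-`d` polynomial threshold function: `f = sgn ∘ p` for some real
polynomial `p` in `n` variables of (total) degree at most `d`. -/
def IsPTF {n : ℕ} (d : ℕ) (f : (Fin n → ℝ) → ℝ) : Prop :=
  ∃ p : MvPolynomial (Fin n) ℝ, p.totalDegree ≤ d ∧ ∀ x, f x = Real.sign (MvPolynomial.eval x p)

/-- The coordinates of the random vector `X` form a `k`-independent family of standard
Gaussians: each coordinate is a standard Gaussian, and any at most `k` of them are independent. -/
structure IsKIndepStdGaussian {Ω : Type*} [MeasurableSpace Ω] {n : ℕ} (k : ℕ)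
    (X : Ω → Fin n → ℝ) (μ : Measure Ω) : Prop where
  hasLaw : ∀ j, HasLaw (fun ω => X ω j) (gaussianReal 0 1) μ
  indep : ∀ s : Finset (Fin n), s.card ≤ k → iIndepFun (fun (j : s) ω => X ω j) μ

/-- The coordinates of the random vector `Y` form a fully independent family of standard
Gaussians. -/
structure IsIndepStdGaussian {Ω : Type*} [MeasurableSpace Ω] {n : ℕ}
    (Y : Ω → Fin n → ℝ) (μ : Measure Ω) : Prop where
  hasLaw : ∀ j, HasLaw (fun ω => Y ω j) (gaussianReal 0 1) μ
  indep : iIndepFun (fun j ω => Y ω j) μ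

/-! The argument is a Lindeberg replacement, applied to `sgn p · G` in place of `sgn p`. Here `G`
(`gradCutoff`) is a smooth function of the ratios `κ²|∇^{l+1}p|² / (|∇^l p|² + κ²|∇^{l+1}p|²)` for
`l < d`. It vanishes once one ratio reaches `1/2`, and it equals `1` when all of them are at most
`1/(4d)`. Where `G` is nonzero, `p` and its derivatives vary slowly at scale `κ`, which replaces the
smoothness that `sgn` lacks.

Three facts carry the proof.

Anticoncentration (`stdGauss_gradSq_small_le`, `integral_one_sub_gradCutoff_le`): under the Gaussian
law `G` differs from `1` only on a set of measure `O(d⁴κ)`. By rotation invariance it suffices to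
follow `p` along a circular arc through two Gaussian points. There `p` is a trigonometric
polynomial, whose logarithmic derivative is large only near the at most `2d` roots of an algebraic
polynomial. Random Gaussian combinations pass from scalars to derivative tensors.

Local comparison (`exists_local_bound`): for a polynomial `q` of degree `d` and scale `κ`, a law
with Gaussian moments up to degree `128d` changes `E[sgn q · G]` by at most `D^d/κ⁸`. Put `θ = 8/κ²`
and compare the norms of the mean derivative tensors of `q`. If each is at most `θ` times the
previous one (squared norms), hypercontractivity concentrates every `|∇^l q|²` and also `q`, so `sgn
q` is mostly constant and `G` is close to a polynomial, with an error of order eight in fluctuations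
of size `√θ`. If the decay fails, then at the last failing index the cutoff is zero outside an event
of probability `O_d(θ⁴)`. In both cases the approximant and the bound for the error are polynomials
of degree at most `128d`, so moments suffice and limited independence is enough.

Lindeberg (`abs_integral_sum_sub_stdGauss_le`): replacing one summand means comparing laws on `x ↦
p(R + ηx)` with `η = 1/√N`, which turns the scale `κ` into `κ/η`. The `N` replacements together cost
`N · D^d (η/κ)⁸ = D^d/(κ⁸N³)`. The same estimate with `1` in place of `sgn` shows that `G` is close
to `1` under the law of `X` as well, so the cutoff can be removed on both sides.

With `κ = ε/M^d` the anticoncentration error is below `ε`, and the replacement error is too as soon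
as `N ≥ B^d ε⁻³`. The exponent `4 + c` therefore leaves room. -/

/-! ### Gaussian moments, integration by parts, and moment matching. -/

section Gaussian

/-- The standard Gaussian measure on `σ → ℝ`. -/
noncomputable abbrev stdGauss (σ : Type*) [Fintype σ] : Measure (σ → ℝ) :=
  Measure.pi fun _ => gaussianReal 0 1

theorem integrable_pow_gaussianReal (m : ℕ) :
    Integrable (fun x : ℝ => x ^ m) (gaussianReal 0 1) := by
  have h := (memLp_id_gaussianReal (μ := 0) (v := 1) (m : NNReal)).integrable_norm_pow'
  refine h.mono (by fun_prop) (Filter.Eventually.of_forall fun x => by simp)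

/-- Recursion for the moments of the standard Gaussian. -/
theorem integral_pow_succ_gaussianReal (m : ℕ) :
    ∫ x : ℝ, x ^ (m + 1) ∂(gaussianReal 0 1) = m * ∫ x : ℝ, x ^ (m - 1) ∂(gaussianReal 0 1) := by
  have hint : ∀ j : ℕ, Integrable (fun x : ℝ => x ^ j * gaussianPDFReal 0 1 x) := by
    intro j
    have h := integrable_pow_gaussianReal j
    rw [gaussianReal_of_var_ne_zero _ one_ne_zero,
      integrable_withDensity_iff_integrable_smul' (measurable_gaussianPDF 0 1)
        (by simp [gaussianPDF_lt_top])] at h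
    refine h.congr (Filter.Eventually.of_forall fun x => ?_)
    simp [gaussianPDF, gaussianPDFReal_nonneg, mul_comm]
  have hd : ∀ x, HasDerivAt (gaussianPDFReal 0 1) (-(x * gaussianPDFReal 0 1 x)) x := by
    intro x
    have h1 : HasDerivAt (fun x : ℝ => -(x - 0) ^ 2 / (2 * ((1 : NNReal) : ℝ))) (-x) x := by
      have := ((((hasDerivAt_id x).sub_const 0).pow 2).neg).div_const (2 * ((1 : NNReal) : ℝ))
      convert! this using 1
      simp [neg_div]
    have := (h1.exp).const_mul (√(2 * Real.pi * ((1 : NNReal) : ℝ)))⁻¹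
    rw [gaussianPDFReal_def]
    convert! this using 1
    simp
    ring
  have key := integral_mul_deriv_eq_deriv_mul_of_integrable (A := ℝ)
    (u := fun x : ℝ => x ^ m) (u' := fun x => m * x ^ (m - 1)) (v := gaussianPDFReal 0 1)
    (v' := fun x => -(x * gaussianPDFReal 0 1 x))
    (fun x _ => hasDerivAt_pow m x) (fun x _ => hd x) ?_ ?_ (hint m)
  · simp only [integral_gaussianReal_eq_integral_smul (one_ne_zero), smul_eq_mul]
    rw [← integral_const_mul]
    have e1 : ∫ x : ℝ, x ^ m * -(x * gaussianPDFReal 0 1 x) =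
        - ∫ x : ℝ, gaussianPDFReal 0 1 x * x ^ (m + 1) := by
      rw [← integral_neg]; congr 1; ext x; ring
    rw [e1, neg_inj] at key
    rw [key]; congr 1; ext x; ring
  · refine (hint (m + 1)).neg.congr (Filter.Eventually.of_forall fun x => ?_)
    simp; ring
  · refine ((hint (m - 1)).const_mul (m : ℝ)).congr (Filter.Eventually.of_forall fun x => ?_)
    simp; ring

open MvPolynomial

theorem eval_monomial_eq_prod_support {σ : Type*} (x : σ → ℝ) (α : σ →₀ ℕ) (a : ℝ) :
    eval x (monomial α a) = a * ∏ j : α.support, x j ^ α j := by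
  rw [eval_monomial, Finsupp.prod, Finset.prod_coe_sort α.support (fun j => x j ^ α j)]

variable {σ : Type*} [Fintype σ]

/-- Moments of a family of standard Gaussians whose relevant coordinates are independent. -/
theorem integrable_and_integral_monomial {Ω : Type*} [MeasurableSpace Ω] {μ : Measure Ω}
    [IsProbabilityMeasure μ] {X : Ω → σ → ℝ}
    (hX : ∀ j, HasLaw (fun ω => X ω j) (gaussianReal 0 1) μ) (α : σ →₀ ℕ) (a : ℝ)
    (hind : iIndepFun (fun (j : α.support) ω => X ω j) μ) :
    Integrable (fun ω => eval (X ω) (monomial α a)) μ ∧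
      ∫ ω, eval (X ω) (monomial α a) ∂μ =
        a * ∏ j ∈ α.support, ∫ x, x ^ α j ∂(gaussianReal 0 1) := by
  simp only [eval_monomial_eq_prod_support]
  have hm : ∀ j : α.support, AEMeasurable (fun ω => X ω j) μ := fun j => (hX j).aemeasurable
  constructor
  · refine Integrable.const_mul ?_ a
    have h1 : Integrable (fun x : α.support → ℝ => ∏ j, x j ^ α j)
        (μ.map (fun ω (j : α.support) => X ω j)) := by
      rw [(iIndepFun_iff_map_fun_eq_pi_map hm).1 hind]
      simp only [(hX _).map_eq]
      exact Integrable.fintype_prod (f := fun (j : α.support) (x : ℝ) => x ^ α j)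
        fun j => integrable_pow_gaussianReal (α j)
    exact (integrable_map_measure h1.aestronglyMeasurable (aemeasurable_pi_iff.2 hm)).1 h1
  · rw [integral_const_mul, hind.integral_fun_prod_comp (f := fun (j : α.support) (x : ℝ) => x ^ α j) hm
      (fun j => by fun_prop)]
    congr 1
    rw [← Finset.prod_coe_sort α.support (fun j => ∫ x, x ^ α j ∂(gaussianReal 0 1))]
    refine Finset.prod_congr rfl fun j _ => ?_
    exact (hX j).integral_comp (f := fun x => x ^ α j) (by fun_prop)

theorem hasLaw_eval_stdGauss (j : σ) :
    HasLaw (fun x : σ → ℝ => x j) (gaussianReal 0 1) (stdGauss σ) :=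
  (measurePreserving_eval (fun _ : σ => gaussianReal 0 1) j).hasLaw

theorem iIndepFun_eval_stdGauss : iIndepFun (fun j (x : σ → ℝ) => x j) (stdGauss σ) :=
  iIndepFun_pi (X := fun _ x => x) fun _ => aemeasurable_id

theorem integrable_eval_stdGauss (q : MvPolynomial σ ℝ) :
    Integrable (fun x => eval x q) (stdGauss σ) := by
  induction q using MvPolynomial.induction_on' with
  | monomial α a =>
    exact (integrable_and_integral_monomial hasLaw_eval_stdGauss α a
      (iIndepFun_eval_stdGauss.precomp Subtype.val_injective)).1
  | add p q hp hq =>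
    simp only [map_add]
    exact hp.add hq

/-- The Gaussian expectation, as a linear functional on polynomials. -/
noncomputable def gaussE (σ : Type*) [Fintype σ] : MvPolynomial σ ℝ →ₗ[ℝ] ℝ where
  toFun q := ∫ x, eval x q ∂(stdGauss σ)
  map_add' p q := by
    simp only [map_add]
    exact integral_add (integrable_eval_stdGauss p) (integrable_eval_stdGauss q)
  map_smul' c q := by
    simp only [smul_eval, RingHom.id_apply, smul_eq_mul]
    exact integral_const_mul _ _

theorem gaussE_apply (q : MvPolynomial σ ℝ) : gaussE σ q = ∫ x, eval x q ∂(stdGauss σ) := rfl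

@[simp]
theorem gaussE_C (a : ℝ) : gaussE σ (C a) = a := by simp [gaussE_apply]

theorem gaussE_C_mul (a : ℝ) (q : MvPolynomial σ ℝ) : gaussE σ (C a * q) = a * gaussE σ q := by
  rw [C_mul', map_smul, smul_eq_mul]

theorem gaussE_monomial (α : σ →₀ ℕ) (a : ℝ) :
    gaussE σ (monomial α a) = a * ∏ j, ∫ x, x ^ α j ∂(gaussianReal 0 1) := by
  rw [gaussE_apply]
  have h : ∀ x : σ → ℝ, eval x (monomial α a) = a * ∏ j, x j ^ α j := fun x => by
    rw [eval_monomial, Finsupp.prod_fintype _ _ (by simp)]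
  simp only [h]
  rw [integral_const_mul, integral_fintype_prod_eq_prod (f := fun j (x : ℝ) => x ^ α j)]

/-- Gaussian integration by parts. -/
theorem gaussE_X_mul (i : σ) (q : MvPolynomial σ ℝ) :
    gaussE σ (X i * q) = gaussE σ (pderiv i q) := by
  classical
  induction q using MvPolynomial.induction_on' with
  | add p q hp hq => simp only [mul_add, map_add, hp, hq]
  | monomial α a =>
    rw [pderiv_monomial, X, monomial_mul, gaussE_monomial, gaussE_monomial, one_mul,
      ← Finset.mul_prod_erase _ _ (Finset.mem_univ i),
      ← Finset.mul_prod_erase (a := i) _ _ (Finset.mem_univ i)]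
    have e1 : ∏ j ∈ Finset.univ.erase i,
          ∫ x : ℝ, x ^ ((Finsupp.single i 1 + α : σ →₀ ℕ) j) ∂(gaussianReal 0 1)
        = ∏ j ∈ Finset.univ.erase i,
          ∫ x : ℝ, x ^ ((α - Finsupp.single i 1 : σ →₀ ℕ) j) ∂(gaussianReal 0 1) := by
      refine Finset.prod_congr rfl fun j hj => ?_
      have : i ≠ j := (Finset.ne_of_mem_erase hj).symm
      simp [Finsupp.single_eq_of_ne' this]
    rw [e1]
    have e2 := integral_pow_succ_gaussianReal (α i)
    simp only [Finsupp.coe_add, Pi.add_apply, Finsupp.single_eq_same, Finsupp.coe_tsub,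
      Pi.sub_apply, add_comm 1 (α i), e2]
    ring

theorem gaussE_nonneg {q : MvPolynomial σ ℝ} (hq : ∀ x, 0 ≤ eval x q) : 0 ≤ gaussE σ q :=
  integral_nonneg hq

theorem gaussE_mono {p q : MvPolynomial σ ℝ} (hq : ∀ x, eval x p ≤ eval x q) :
    gaussE σ p ≤ gaussE σ q :=
  integral_mono (integrable_eval_stdGauss p) (integrable_eval_stdGauss q) hq

theorem gaussE_sq_nonneg (q : MvPolynomial σ ℝ) : 0 ≤ gaussE σ (q ^ 2) :=
  gaussE_nonneg fun x => by simp only [map_pow]; positivity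

/-- Cauchy-Schwarz for the Gaussian expectation. -/
theorem gaussE_mul_sq_le (p q : MvPolynomial σ ℝ) :
    gaussE σ (p * q) ^ 2 ≤ gaussE σ (p ^ 2) * gaussE σ (q ^ 2) := by
  have h : ∀ t : ℝ, 0 ≤ gaussE σ (q ^ 2) * (t * t) + (2 * gaussE σ (p * q)) * t
      + gaussE σ (p ^ 2) := by
    intro t
    have h0 := gaussE_sq_nonneg (p + C t * q)
    have e : (p + C t * q) ^ 2 = p ^ 2 + C (2 * t) * (p * q) + C (t * t) * q ^ 2 := by
      simp only [map_mul]; rw [show (C 2 : MvPolynomial σ ℝ) = 2 from map_ofNat C 2]; ring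
    rw [e, map_add, map_add, gaussE_C_mul, gaussE_C_mul] at h0
    linarith
  have := discrim_le_zero h
  rw [discrim] at this
  nlinarith

/-- `ν` integrates polynomials of degree at most `k` like the standard Gaussian measure. -/
structure MatchesGaussian (k : ℕ) (ν : Measure (σ → ℝ)) : Prop where
  integrable : ∀ q : MvPolynomial σ ℝ, q.totalDegree ≤ k → Integrable (fun x => eval x q) ν
  integral_eq : ∀ q : MvPolynomial σ ℝ, q.totalDegree ≤ k → ∫ x, eval x q ∂ν = gaussE σ q

theorem matchesGaussian_stdGauss (k : ℕ) : MatchesGaussian k (stdGauss σ) :=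
  ⟨fun q _ => integrable_eval_stdGauss q, fun _ _ => rfl⟩

theorem IsKIndepStdGaussian.aemeasurable {Ω : Type*} [MeasurableSpace Ω] {μ : Measure Ω}
    {n k : ℕ} {X : Ω → Fin n → ℝ} (hX : IsKIndepStdGaussian k X μ) : AEMeasurable X μ :=
  aemeasurable_pi_iff.2 fun j => (hX.hasLaw j).aemeasurable

/-- A monomial of degree at most `k` involves at most `k` coordinates, so its expectation factors
exactly as under full independence. This is the only use of `k`-independence: afterwards only
`MatchesGaussian` matters. -/
theorem IsKIndepStdGaussian.matchesGaussian {Ω : Type*} [MeasurableSpace Ω] {μ : Measure Ω}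
    [IsProbabilityMeasure μ] {n k : ℕ} {X : Ω → Fin n → ℝ} (hX : IsKIndepStdGaussian k X μ) :
    MatchesGaussian k (μ.map X) := by
  have key : ∀ q : MvPolynomial (Fin n) ℝ, q.totalDegree ≤ k →
      Integrable (fun ω => eval (X ω) q) μ ∧ ∫ ω, eval (X ω) q ∂μ = gaussE (Fin n) q := by
    intro q hq
    have hmon : ∀ α ∈ q.support, Integrable (fun ω => eval (X ω) (monomial α (q.coeff α))) μ ∧
        ∫ ω, eval (X ω) (monomial α (q.coeff α)) ∂μ
          = gaussE (Fin n) (monomial α (q.coeff α)) := by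
      intro α hα
      have hc : α.support.card ≤ k := by
        refine le_trans ?_ ((le_totalDegree hα).trans hq)
        rw [Finsupp.sum, Finset.card_eq_sum_ones]
        exact Finset.sum_le_sum fun j hj => Nat.one_le_iff_ne_zero.2 (Finsupp.mem_support_iff.1 hj)
      have h1 := integrable_and_integral_monomial hX.hasLaw α (q.coeff α) (hX.indep _ hc)
      have h2 := integrable_and_integral_monomial hasLaw_eval_stdGauss α (q.coeff α)
        (iIndepFun_eval_stdGauss.precomp Subtype.val_injective)
      exact ⟨h1.1, h1.2.trans h2.2.symm⟩
    have hsum : ∀ x : Fin n → ℝ, eval x q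
        = ∑ α ∈ q.support, eval x (monomial α (q.coeff α)) := fun x => by
      conv_lhs => rw [q.as_sum, map_sum]
    constructor
    · simp only [hsum]
      exact integrable_finsetSum _ fun α hα => (hmon α hα).1
    · simp only [hsum]
      rw [integral_finsetSum _ fun α hα => (hmon α hα).1,
        Finset.sum_congr rfl fun α hα => (hmon α hα).2, ← map_sum, ← q.as_sum]
  have hm : ∀ q : MvPolynomial (Fin n) ℝ,
      AEStronglyMeasurable (fun x => eval x q) (μ.map X) := fun q =>
    (MvPolynomial.continuous_eval q).aestronglyMeasurable
  refine ⟨fun q hq => ?_, fun q hq => ?_⟩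
  · exact (integrable_map_measure (hm q) hX.aemeasurable).2 (key q hq).1
  · rw [integral_map hX.aemeasurable (hm q)]
    exact (key q hq).2

end Gaussian

/-! ### Wiener chaos: number operator, decomposition, Parseval. -/

section Chaos

open MvPolynomial

theorem pderiv_pderiv_comm {σ : Type*} (i j : σ) (q : MvPolynomial σ ℝ) :
    pderiv i (pderiv j q) = pderiv j (pderiv i q) := by
  classical
  induction q using MvPolynomial.induction_on with
  | C a => simp
  | add p q hp hq => simp only [map_add, hp, hq]
  | mul_X p k hp =>
    simp only [Derivation.leibniz, map_add, smul_eq_mul, pderiv_X, hp, Pi.single_apply]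
    split_ifs <;> simp <;> ring

theorem totalDegree_pderiv_le {σ : Type*} (i : σ) (q : MvPolynomial σ ℝ) :
    (pderiv i q).totalDegree ≤ q.totalDegree - 1 := by
  classical
  conv_lhs => rw [q.as_sum, map_sum]
  refine (totalDegree_finsetSum _ _).trans (Finset.sup_le fun α hα => ?_)
  rw [pderiv_monomial]
  rcases Nat.eq_zero_or_pos (α i) with h0 | h0
  · simp [h0]
  refine (totalDegree_monomial_le _ _).trans ?_
  have hle : Finsupp.single i 1 ≤ α := by
    simpa [Finsupp.single_le_iff, Nat.one_le_iff_ne_zero] using h0.ne'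
  have h1 : (α - Finsupp.single i 1).sum (fun _ e => e) + 1 = α.sum fun _ e => e := by
    conv_rhs => rw [← tsub_add_cancel_of_le hle]
    rw [Finsupp.sum_add_index' (by simp) (by simp)]
    simp
  have h2 := le_totalDegree hα
  change (α - Finsupp.single i 1).sum (fun _ e => e) ≤ _
  omega

theorem eq_C_of_totalDegree_le_zero {σ : Type*} {q : MvPolynomial σ ℝ} (h : q.totalDegree ≤ 0) :
    ∃ a, q = C a :=
  ⟨_, totalDegree_eq_zero_iff_eq_C.1 (Nat.le_zero.1 h)⟩

variable {σ : Type*} [Fintype σ]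

/-- The number operator `∑ i, (x i * ∂ i - ∂ i ^ 2)` on polynomials. -/
noncomputable def numOp (q : MvPolynomial σ ℝ) : MvPolynomial σ ℝ :=
  ∑ i, (X i * pderiv i q - pderiv i (pderiv i q))

theorem numOp_add (p q : MvPolynomial σ ℝ) : numOp (p + q) = numOp p + numOp q := by
  simp only [numOp, map_add, ← Finset.sum_add_distrib]
  exact Finset.sum_congr rfl fun i _ => by ring

theorem numOp_C_mul (a : ℝ) (q : MvPolynomial σ ℝ) : numOp (C a * q) = C a * numOp q := by
  simp only [numOp, pderiv_C_mul, Finset.mul_sum]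
  exact Finset.sum_congr rfl fun i _ => by ring

theorem numOp_zero : numOp (0 : MvPolynomial σ ℝ) = 0 := by simp [numOp]

theorem numOp_sum {ι : Type*} (s : Finset ι) (f : ι → MvPolynomial σ ℝ) :
    numOp (∑ k ∈ s, f k) = ∑ k ∈ s, numOp (f k) := by
  classical
  induction s using Finset.induction_on with
  | empty => simp [numOp_zero]
  | insert a s ha ih => rw [Finset.sum_insert ha, Finset.sum_insert ha, numOp_add, ih]

/-- The commutator of `∂_j` with the number operator is `∂_j`, so differentiation lowers eigenvalues
by one. -/
theorem pderiv_numOp (j : σ) (q : MvPolynomial σ ℝ) :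
    pderiv j (numOp q) = numOp (pderiv j q) + pderiv j q := by
  classical
  have h : ∀ i, pderiv j (X i * pderiv i q - pderiv i (pderiv i q)) =
      (X i * pderiv i (pderiv j q) - pderiv i (pderiv i (pderiv j q)))
        + if i = j then pderiv j q else 0 := by
    intro i
    rw [map_sub, Derivation.leibniz, pderiv_X, pderiv_pderiv_comm j i (pderiv i q),
      pderiv_pderiv_comm j i q, Pi.single_apply]
    split_ifs with h
    · subst h; simp; ring
    · simp
  rw [numOp, map_sum, Finset.sum_congr rfl fun i _ => h i, Finset.sum_add_distrib, numOp]
  simp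

theorem numOp_X_mul (j : σ) (q : MvPolynomial σ ℝ) :
    numOp (X j * q) = X j * numOp q + X j * q - 2 * pderiv j q := by
  classical
  have h : ∀ i, X i * pderiv i (X j * q) - pderiv i (pderiv i (X j * q)) =
      X j * (X i * pderiv i q - pderiv i (pderiv i q))
        + if i = j then X j * q - 2 * pderiv j q else 0 := by
    intro i
    simp only [Derivation.leibniz, map_add, smul_eq_mul, pderiv_X, Pi.single_apply]
    split_ifs with h h' h'
    · subst h; simp; ring
    · exact absurd h.symm h'
    · exact absurd h'.symm h
    · simp; ring
  rw [numOp, Finset.sum_congr rfl fun i _ => h i, Finset.sum_add_distrib, ← Finset.mul_sum,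
    ← numOp]
  simp
  ring

/-- The number operator is the generator of the Gaussian Dirichlet form. -/
theorem gaussE_mul_numOp (f g : MvPolynomial σ ℝ) :
    gaussE σ (f * numOp g) = ∑ i, gaussE σ (pderiv i f * pderiv i g) := by
  rw [numOp, Finset.mul_sum, map_sum]
  refine Finset.sum_congr rfl fun i _ => ?_
  have h := gaussE_X_mul i (f * pderiv i g)
  rw [Derivation.leibniz, smul_eq_mul, smul_eq_mul, map_add] at h
  rw [mul_sub, map_sub, show f * (X i * pderiv i g) = X i * (f * pderiv i g) by ring, h,
    mul_comm (pderiv i g)]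
  ring

/-- `f` is in the `k`-th Wiener chaos: it is an eigenvector of the number operator. -/
structure IsChaos (k : ℕ) (f : MvPolynomial σ ℝ) : Prop where
  degree_le : f.totalDegree ≤ k
  numOp_eq : numOp f = C (k : ℝ) * f

theorem IsChaos.zero (k : ℕ) : IsChaos k (0 : MvPolynomial σ ℝ) := ⟨by simp, by simp [numOp_zero]⟩

theorem IsChaos.add {k : ℕ} {f g : MvPolynomial σ ℝ} (hf : IsChaos k f) (hg : IsChaos k g) :
    IsChaos k (f + g) :=
  ⟨(totalDegree_add _ _).trans (max_le hf.1 hg.1), by rw [numOp_add, hf.2, hg.2]; ring⟩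

theorem IsChaos.C_mul {k : ℕ} {f : MvPolynomial σ ℝ} (hf : IsChaos k f) (a : ℝ) :
    IsChaos k (C a * f) :=
  ⟨by rw [C_mul']; exact (totalDegree_smul_le _ _).trans hf.1, by
    rw [numOp_C_mul, hf.2]; ring⟩

theorem isChaos_C (a : ℝ) : IsChaos 0 (C a : MvPolynomial σ ℝ) := ⟨by simp, by simp [numOp]⟩

theorem IsChaos.pderiv_eq_zero {f : MvPolynomial σ ℝ} (hf : IsChaos 0 f) (j : σ) :
    pderiv j f = 0 := by
  obtain ⟨a, rfl⟩ := eq_C_of_totalDegree_le_zero hf.1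
  simp

theorem IsChaos.numOp_pderiv {k : ℕ} {f : MvPolynomial σ ℝ} (hf : IsChaos k f) (j : σ) :
    numOp (pderiv j f) = C ((k : ℝ) - 1) * pderiv j f := by
  have h := pderiv_numOp j f
  rw [hf.2, pderiv_C_mul] at h
  rw [map_sub, sub_mul, h, map_one]
  ring

theorem IsChaos.pderiv {k : ℕ} {f : MvPolynomial σ ℝ} (hf : IsChaos (k + 1) f) (j : σ) :
    IsChaos k (pderiv j f) :=
  ⟨(totalDegree_pderiv_le j f).trans (by have := hf.1; omega), by
    rw [hf.numOp_pderiv]; push_cast; ring_nf⟩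

/-- `X_j - ∂_j` is the creation operator: the commutation rules for `X_j` and `∂_j` combine to raise
the eigenvalue by one. -/
theorem IsChaos.raise {k : ℕ} {f : MvPolynomial σ ℝ} (hf : IsChaos k f) (j : σ) :
    IsChaos (k + 1) (X j * f - MvPolynomial.pderiv j f) := by
  refine ⟨(totalDegree_sub _ _).trans (max_le ?_ ?_), ?_⟩
  · refine (totalDegree_mul _ _).trans ?_
    rw [totalDegree_X, add_comm]
    exact Nat.add_le_add_right hf.1 1
  · exact (totalDegree_pderiv_le j f).trans (by have := hf.1; omega)
  · have e : numOp (X j * f - MvPolynomial.pderiv j f)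
        = numOp (X j * f) + numOp (C (-1) * MvPolynomial.pderiv j f) := by
      rw [← numOp_add]; simp [sub_eq_add_neg]
    rw [e, numOp_C_mul, numOp_X_mul, hf.2, hf.numOp_pderiv]
    simp only [Nat.cast_add, Nat.cast_one, map_add, map_sub, map_one, map_neg]
    ring

/-- The number operator is symmetric, because its Dirichlet form is, so eigenvectors with distinct
eigenvalues are orthogonal. -/
theorem IsChaos.gaussE_mul_eq_zero {j k : ℕ} {f g : MvPolynomial σ ℝ} (hf : IsChaos j f)
    (hg : IsChaos k g) (hjk : j ≠ k) : gaussE σ (f * g) = 0 := by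
  have h1 := gaussE_mul_numOp f g
  have h2 := gaussE_mul_numOp g f
  rw [hg.2, show f * (C (k : ℝ) * g) = C (k : ℝ) * (f * g) by ring, gaussE_C_mul] at h1
  rw [hf.2, show g * (C (j : ℝ) * f) = C (j : ℝ) * (f * g) by ring, gaussE_C_mul] at h2
  have h3 : ((j : ℝ) - k) * gaussE σ (f * g) = 0 := by
    rw [sub_mul, h1, h2, sub_eq_zero]
    exact Finset.sum_congr rfl fun i _ => by rw [mul_comm]
  rcases mul_eq_zero.1 h3 with h | h
  · exact absurd (by exact_mod_cast sub_eq_zero.1 h) hjk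
  · exact h

theorem IsChaos.sum_gaussE_pderiv_sq {k : ℕ} {f : MvPolynomial σ ℝ} (hf : IsChaos k f) :
    ∑ i, gaussE σ (MvPolynomial.pderiv i f ^ 2) = k * gaussE σ (f ^ 2) := by
  have h := gaussE_mul_numOp f f
  rw [hf.2, show f * (C (k : ℝ) * f) = C (k : ℝ) * f ^ 2 by ring, gaussE_C_mul] at h
  rw [h]
  exact Finset.sum_congr rfl fun i _ => by rw [sq]

/-- `q = ∑ k ≤ d, f k` is the chaos decomposition of `q`. -/
structure ChaosDecomp (d : ℕ) (f : ℕ → MvPolynomial σ ℝ) (q : MvPolynomial σ ℝ) : Prop where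
  isChaos : ∀ k, IsChaos k (f k)
  eq_zero : ∀ k, d < k → f k = 0
  eq_sum : q = ∑ k ∈ Finset.range (d + 1), f k

theorem ChaosDecomp.mono {d e : ℕ} {f : ℕ → MvPolynomial σ ℝ} {q : MvPolynomial σ ℝ}
    (h : ChaosDecomp d f q) (hde : d ≤ e) : ChaosDecomp e f q :=
  ⟨h.1, fun k hk => h.2 k (hde.trans_lt hk), by
    rw [h.3]
    exact Finset.sum_subset (Finset.range_subset_range.2 (by omega)) fun k _ hk =>
      h.2 k (by rw [Finset.mem_range] at hk; omega)⟩

theorem ChaosDecomp.add {d : ℕ} {f g : ℕ → MvPolynomial σ ℝ} {p q : MvPolynomial σ ℝ}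
    (hp : ChaosDecomp d f p) (hq : ChaosDecomp d g q) :
    ChaosDecomp d (fun k => f k + g k) (p + q) :=
  ⟨fun k => (hp.1 k).add (hq.1 k), fun k hk => by rw [hp.2 k hk, hq.2 k hk, add_zero], by
    rw [hp.3, hq.3, Finset.sum_add_distrib]⟩

theorem IsChaos.exists_decomp {d k : ℕ} {f : MvPolynomial σ ℝ} (hf : IsChaos k f) (hk : k ≤ d) :
    ∃ g, ChaosDecomp d g f := by
  refine ⟨fun j => if j = k then f else 0, fun j => ?_, fun j hj => ?_, ?_⟩
  · split_ifs with h
    · exact h ▸ hf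
    · exact IsChaos.zero j
  · simp [show j ≠ k by omega]
  · simp [show k < d + 1 by omega]

theorem exists_decomp_sum {ι : Type*} {d : ℕ} (s : Finset ι) (p : ι → MvPolynomial σ ℝ)
    (h : ∀ i ∈ s, ∃ f, ChaosDecomp d f (p i)) : ∃ f, ChaosDecomp d f (∑ i ∈ s, p i) := by
  classical
  induction s using Finset.induction_on with
  | empty => simpa using (IsChaos.zero 0).exists_decomp (Nat.zero_le d)
  | insert a s ha ih =>
    rw [Finset.sum_insert ha]
    obtain ⟨f, hf⟩ := h a (Finset.mem_insert_self a s)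
    obtain ⟨g, hg⟩ := ih fun i hi => h i (Finset.mem_insert_of_mem hi)
    exact ⟨_, hf.add hg⟩

/-- Split `X_j f = (X_j f - ∂_j f) + ∂_j f`: on a chaos component the first term goes up one level
and the second goes down one. Building monomials one variable at a time then decomposes every
polynomial. -/
theorem ChaosDecomp.exists_X_mul {d : ℕ} {f : ℕ → MvPolynomial σ ℝ} {q : MvPolynomial σ ℝ}
    (h : ChaosDecomp d f q) (j : σ) : ∃ g, ChaosDecomp (d + 1) g (X j * q) := by
  rw [h.3, Finset.mul_sum]
  refine exists_decomp_sum _ _ fun k hk => ?_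
  have hk' : k < d + 1 := Finset.mem_range.1 hk
  obtain ⟨g, hg⟩ := ((h.1 k).raise j).exists_decomp (show k + 1 ≤ d + 1 by omega)
  have h2 : ∃ g, ChaosDecomp (d + 1) g (MvPolynomial.pderiv j (f k)) := by
    rcases k with _ | k
    · rw [(h.1 0).pderiv_eq_zero j]
      exact (IsChaos.zero 0).exists_decomp (Nat.zero_le _)
    · exact ((h.1 (k + 1)).pderiv j).exists_decomp (by omega)
  obtain ⟨g', hg'⟩ := h2
  have := hg.add hg'
  rw [sub_add_cancel] at this
  exact ⟨_, this⟩

theorem exists_decomp_monomial (m : ℕ) : ∀ (α : σ →₀ ℕ) (a : ℝ), α.sum (fun _ e => e) = m →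
    ∃ f, ChaosDecomp m f (monomial α a) := by
  classical
  induction m with
  | zero =>
    intro α a h
    have : α = 0 := by
      ext i
      by_contra hi
      have := (Finset.sum_eq_zero_iff.1 h) i (Finsupp.mem_support_iff.2 hi)
      exact hi this
    subst this
    exact (isChaos_C a).exists_decomp le_rfl
  | succ m ih =>
    intro α a h
    have hne : α ≠ 0 := by rintro rfl; simp at h
    obtain ⟨i, hi⟩ := Finsupp.ne_iff.1 hne
    have hle : Finsupp.single i 1 ≤ α := by
      simpa [Finsupp.single_le_iff, Nat.one_le_iff_ne_zero] using hi
    have h1 : (α - Finsupp.single i 1).sum (fun _ e => e) + 1 = α.sum fun _ e => e := by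
      conv_rhs => rw [← tsub_add_cancel_of_le hle]
      rw [Finsupp.sum_add_index' (by simp) (by simp)]
      simp
    obtain ⟨f, hf⟩ := ih (α - Finsupp.single i 1) a (by omega)
    have e : monomial α a = X i * monomial (α - Finsupp.single i 1) a := by
      rw [X, monomial_mul, one_mul, add_tsub_cancel_of_le hle]
    rw [e]
    exact hf.exists_X_mul i

/-- Every polynomial of degree at most `d` has a chaos decomposition. -/
theorem exists_chaosDecomp {d : ℕ} {q : MvPolynomial σ ℝ} (hq : q.totalDegree ≤ d) :
    ∃ f, ChaosDecomp d f q := by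
  rw [q.as_sum]
  refine exists_decomp_sum _ _ fun α hα => ?_
  obtain ⟨f, hf⟩ := exists_decomp_monomial _ α (q.coeff α) rfl
  exact ⟨f, hf.mono ((le_totalDegree hα).trans hq)⟩

theorem ChaosDecomp.pderiv {d : ℕ} {f : ℕ → MvPolynomial σ ℝ} {q : MvPolynomial σ ℝ}
    (h : ChaosDecomp (d + 1) f q) (i : σ) :
    ChaosDecomp d (fun k => MvPolynomial.pderiv i (f (k + 1))) (MvPolynomial.pderiv i q) :=
  ⟨fun k => (h.1 (k + 1)).pderiv i, fun k hk => by rw [h.2 (k + 1) (by omega), map_zero], by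
    rw [h.3, Finset.sum_range_succ', map_add, (h.1 0).pderiv_eq_zero, add_zero, map_sum]⟩

theorem ChaosDecomp.gaussE_sq {d : ℕ} {f : ℕ → MvPolynomial σ ℝ} {q : MvPolynomial σ ℝ}
    (h : ChaosDecomp d f q) : gaussE σ (q ^ 2) = ∑ k ∈ Finset.range (d + 1), gaussE σ (f k ^ 2) := by
  rw [h.3, sq, Finset.sum_mul_sum, map_sum]
  refine Finset.sum_congr rfl fun k hk => ?_
  rw [map_sum, Finset.sum_eq_single_of_mem k hk, sq]
  intro j _ hj
  exact (h.1 k).gaussE_mul_eq_zero (h.1 j) hj.symm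

theorem ChaosDecomp.gaussE_eq {d : ℕ} {f : ℕ → MvPolynomial σ ℝ} {q : MvPolynomial σ ℝ}
    (h : ChaosDecomp d f q) : gaussE σ q = gaussE σ (f 0) := by
  rw [h.3, map_sum]
  refine Finset.sum_eq_single_of_mem 0 (by simp) fun k _ hk => ?_
  have := (h.1 k).gaussE_mul_eq_zero (isChaos_C 1) hk
  simpa using this

/-- The squared norm of the Gaussian expectation of the `k`-th derivative tensor. -/
noncomputable def meanDerivSq : ℕ → MvPolynomial σ ℝ → ℝ
  | 0, q => gaussE σ q ^ 2
  | k + 1, q => ∑ i, meanDerivSq k (pderiv i q)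

theorem meanDerivSq_nonneg (k : ℕ) (q : MvPolynomial σ ℝ) : 0 ≤ meanDerivSq k q := by
  induction k generalizing q with
  | zero => exact sq_nonneg _
  | succ k ih => exact Finset.sum_nonneg fun i _ => ih _

/-- Only the `k`-th component survives `k` derivatives followed by an expectation. Each derivative
contributes its eigenvalue through `sum_gaussE_pderiv_sq`, which accounts for `k!`. -/
theorem ChaosDecomp.meanDerivSq_eq {d k : ℕ} {f : ℕ → MvPolynomial σ ℝ} {q : MvPolynomial σ ℝ}
    (h : ChaosDecomp d f q) : meanDerivSq k q = k.factorial * gaussE σ (f k ^ 2) := by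
  induction k generalizing d f q with
  | zero =>
    rw [meanDerivSq, h.gaussE_eq]
    obtain ⟨a, ha⟩ := eq_C_of_totalDegree_le_zero (h.1 0).1
    rw [ha, ← C_pow, gaussE_C, gaussE_C]
    simp
  | succ k ih =>
    rw [meanDerivSq, Finset.sum_congr rfl fun i _ => ih ((h.mono (Nat.le_succ d)).pderiv i),
      ← Finset.mul_sum, (h.1 (k + 1)).sum_gaussE_pderiv_sq, Nat.factorial_succ]
    push_cast
    ring

/-- Parseval's identity for the Hermite expansion. -/
theorem gaussE_sq_eq_sum_meanDerivSq {d : ℕ} {q : MvPolynomial σ ℝ} (hq : q.totalDegree ≤ d) :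
    gaussE σ (q ^ 2) = ∑ k ∈ Finset.range (d + 1), meanDerivSq k q / k.factorial := by
  obtain ⟨f, hf⟩ := exists_chaosDecomp hq
  rw [hf.gaussE_sq]
  refine Finset.sum_congr rfl fun k _ => ?_
  rw [hf.meanDerivSq_eq, mul_div_cancel_left₀ _ (by positivity)]

end Chaos

/-! ### Hypercontractivity by a differential inequality along the Ornstein-Uhlenbeck flow. -/

section Hypercontractivity

open MvPolynomial

variable {σ : Type*} [Fintype σ]

/-- Treating `s` as the variable of a polynomial with polynomial coefficients makes differentiation
under the expectation purely algebraic. -/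
theorem hasDerivAt_gaussE_eval (R : Polynomial (MvPolynomial σ ℝ)) (s : ℝ) :
    HasDerivAt (fun s => gaussE σ (R.eval (C s))) (gaussE σ (R.derivative.eval (C s))) s := by
  induction R using Polynomial.induction_on' with
  | add p q hp hq =>
    simp only [Polynomial.eval_add, map_add]
    exact hp.add hq
  | monomial n p =>
    have e : ∀ (m : ℕ) (q : MvPolynomial σ ℝ) (s : ℝ),
        gaussE σ ((Polynomial.monomial m q).eval (C s)) = gaussE σ q * s ^ m := by
      intro m q s
      rw [Polynomial.eval_monomial, mul_comm, ← C_pow, gaussE_C_mul, mul_comm]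
    simp only [Polynomial.derivative_monomial, e]
    have h := (hasDerivAt_pow n s).const_mul (gaussE σ p)
    have e2 : gaussE σ (p * (n : MvPolynomial σ ℝ)) = n * gaussE σ p := by
      rw [mul_comm, ← gaussE_C_mul]; simp
    rw [e2]
    convert! h using 1
    ring

/-- A differential inequality `A' ≤ 2 √A W'` integrates to `√A ≤ W`. -/
theorem le_sq_of_deriv_le {A A' W W' : ℝ → ℝ} (hA : ∀ s, HasDerivAt A (A' s) s)
    (hW : ∀ s, HasDerivAt W (W' s) s) (hA0 : ∀ s, 0 ≤ A s)
    (h0 : A 0 ≤ W 0 ^ 2) (hW0 : 0 ≤ W 0)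
    (hle : ∀ s, 0 < s → s < 1 → A' s ≤ 2 * √(A s) * W' s) (hW' : ∀ s, 0 < s → 0 ≤ W' s) :
    A 1 ≤ W 1 ^ 2 := by
  -- The shift by `δ` avoids the zeros of `A`, where the square root is not differentiable.
  have key : ∀ δ : ℝ, 0 < δ → √(A 1) ≤ W 1 + √δ := by
    intro δ hδ
    have hd : ∀ s, HasDerivAt (fun s => √(A s + δ) - W s) (A' s / (2 * √(A s + δ)) - W' s) s :=
      fun s => (((hA s).add_const δ).sqrt (by have := hA0 s; positivity)).sub (hW s)
    have hanti : AntitoneOn (fun s => √(A s + δ) - W s) (Set.Icc 0 1) := by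
      refine antitoneOn_of_deriv_nonpos (convex_Icc 0 1)
        (fun s _ => (hd s).continuousAt.continuousWithinAt)
        (fun s _ => (hd s).differentiableAt.differentiableWithinAt) fun s hs => ?_
      rw [interior_Icc] at hs
      rw [(hd s).deriv, sub_nonpos]
      have hpos : 0 < √(A s + δ) := Real.sqrt_pos.2 (by have := hA0 s; positivity)
      rw [div_le_iff₀ (by positivity)]
      have h1 : √(A s) ≤ √(A s + δ) := Real.sqrt_le_sqrt (by linarith)
      have h2 := hle s hs.1 hs.2
      nlinarith [hW' s hs.1, mul_le_mul_of_nonneg_right h1 (hW' s hs.1)]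
    have h := hanti (by simp) (by simp) zero_le_one
    simp only at h
    have h1 : √(A 0 + δ) ≤ W 0 + √δ := by
      refine Real.sqrt_le_iff.2 ⟨by positivity, ?_⟩
      nlinarith [Real.sq_sqrt hδ.le, mul_nonneg hW0 (Real.sqrt_nonneg δ)]
    have h2 : √(A 1) ≤ √(A 1 + δ) := Real.sqrt_le_sqrt (by linarith)
    linarith
  have hle : √(A 1) ≤ W 1 := by
    refine le_of_forall_pos_le_add fun e he => ?_
    have := key (e ^ 2) (by positivity)
    rwa [Real.sqrt_sq he.le] at this
  calc A 1 = √(A 1) ^ 2 := (Real.sq_sqrt (hA0 1)).symm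
    _ ≤ W 1 ^ 2 := pow_le_pow_left₀ (Real.sqrt_nonneg _) hle 2

theorem ChaosDecomp.scale {d : ℕ} {f : ℕ → MvPolynomial σ ℝ} {q : MvPolynomial σ ℝ}
    (h : ChaosDecomp d f q) (s : ℝ) :
    ChaosDecomp d (fun k => C (s ^ k) * f k) (∑ k ∈ Finset.range (d + 1), C (s ^ k) * f k) :=
  ⟨fun k => (h.1 k).C_mul _, fun k hk => by rw [h.2 k hk, mul_zero], rfl⟩

theorem gaussE_pow_four_nonneg (q : MvPolynomial σ ℝ) : 0 ≤ gaussE σ (q ^ 4) :=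
  gaussE_nonneg fun x => by simp only [map_pow]; positivity

theorem gaussE_sq_mul_sq_le (p q : MvPolynomial σ ℝ) :
    gaussE σ (p ^ 2 * q ^ 2) ≤ √(gaussE σ (p ^ 4)) * √(gaussE σ (q ^ 4)) := by
  have h := gaussE_mul_sq_le (p ^ 2) (q ^ 2)
  rw [← pow_mul, ← pow_mul] at h
  rw [← Real.sqrt_mul (gaussE_pow_four_nonneg p)]
  exact Real.le_sqrt_of_sq_le h

/-- Hypercontractivity from `L²` to `L⁴` in terms of the chaos decomposition. -/
theorem ChaosDecomp.gaussE_pow_four_le {d : ℕ} {f : ℕ → MvPolynomial σ ℝ} {q : MvPolynomial σ ℝ}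
    (h : ChaosDecomp d f q) :
    gaussE σ (q ^ 4) ≤ (∑ k ∈ Finset.range (d + 1), 3 ^ k * gaussE σ (f k ^ 2)) ^ 2 := by
  induction d generalizing f q with
  | zero =>
    obtain ⟨a, ha⟩ := eq_C_of_totalDegree_le_zero (h.1 0).1
    have hq := h.3
    simp only [zero_add, Finset.range_one, Finset.sum_singleton, pow_zero, one_mul] at hq ⊢
    rw [hq, ha, ← C_pow, ← C_pow, gaussE_C, gaussE_C]
    exact le_of_eq (by ring)
  | succ d ih =>
    set e : ℕ → ℝ := fun k => gaussE σ (f k ^ 2) with he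
    have he0 : ∀ k, 0 ≤ e k := fun k => gaussE_sq_nonneg _
    -- `Q` evaluated at `s` is `q_s = ∑ s^k f_k`, and `s Q'(s)` is the number operator applied to
    -- `q_s`. With `A(s) = E q_s⁴`, integration by parts gives `s A' = 12 ∑ E[q_s² (∂_i q_s)²]`.
    -- Cauchy-Schwarz and the induction hypothesis for the `∂_i q_s`, whose degree is lower, bound
    -- this by `12 √A · s D`. Since `W(s) = ∑ 3^k s^{2k} E f_k²` has derivative `6D`, this says `A'
    -- ≤ 2 √A W'`.
    set Q : Polynomial (MvPolynomial σ ℝ) :=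
      ∑ k ∈ Finset.range (d + 2), Polynomial.monomial k (f k) with hQ
    set qs : ℝ → MvPolynomial σ ℝ := fun s => ∑ k ∈ Finset.range (d + 2), C (s ^ k) * f k with hqs
    have hQs : ∀ s, Q.eval (C s) = qs s := fun s => by
      simp only [hQ, hqs, Polynomial.eval_finsetSum, Polynomial.eval_monomial, C_pow, mul_comm]
    have hQ' : ∀ s, C s * Q.derivative.eval (C s) = numOp (qs s) := by
      intro s
      simp only [hQ, hqs, Polynomial.derivative_sum, Polynomial.eval_finsetSum,
        Polynomial.derivative_monomial, Polynomial.eval_monomial, numOp_sum, Finset.mul_sum]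
      refine Finset.sum_congr rfl fun k _ => ?_
      rw [numOp_C_mul, (h.1 k).2, map_natCast, C_pow]
      rcases k with _ | k
      · simp
      · simp only [Nat.add_sub_cancel, pow_succ]; ring
    have hdec : ∀ s, ChaosDecomp (d + 1) (fun k => C (s ^ k) * f k) (qs s) := fun s => h.scale s
    set D : ℝ → ℝ := fun s => ∑ k ∈ Finset.range (d + 1), 3 ^ k * s ^ (2 * k + 1) * (k + 1) * e (k + 1)
      with hD
    have hgrad : ∀ s, ∑ i, √(gaussE σ ((MvPolynomial.pderiv i (qs s)) ^ 4)) ≤ s * D s := by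
      intro s
      have h1 : ∀ i, √(gaussE σ ((MvPolynomial.pderiv i (qs s)) ^ 4)) ≤
          ∑ k ∈ Finset.range (d + 1), 3 ^ k * s ^ (2 * k + 2)
            * gaussE σ (MvPolynomial.pderiv i (f (k + 1)) ^ 2) := by
        intro i
        have h2 := ih ((hdec s).pderiv i)
        have h3 : ∀ k, gaussE σ (MvPolynomial.pderiv i (C (s ^ (k + 1)) * f (k + 1)) ^ 2) =
            s ^ (2 * k + 2) * gaussE σ (MvPolynomial.pderiv i (f (k + 1)) ^ 2) := by
          intro k
          rw [pderiv_C_mul, mul_pow, ← C_pow, gaussE_C_mul]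
          ring
        simp only [h3, ← mul_assoc] at h2
        refine Real.sqrt_le_iff.2 ⟨Finset.sum_nonneg fun k _ => ?_, h2⟩
        have : 0 ≤ s ^ (2 * k + 2) := by
          rw [show 2 * k + 2 = (k + 1) * 2 by ring, pow_mul]; positivity
        have := gaussE_sq_nonneg (MvPolynomial.pderiv i (f (k + 1)))
        positivity
      refine (Finset.sum_le_sum fun i _ => h1 i).trans (le_of_eq ?_)
      rw [Finset.sum_comm, hD, Finset.mul_sum]
      refine Finset.sum_congr rfl fun k _ => ?_
      rw [← Finset.mul_sum, (h.1 (k + 1)).sum_gaussE_pderiv_sq]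
      push_cast
      ring
    have hA : ∀ s, HasDerivAt (fun s => gaussE σ (qs s ^ 4))
        (gaussE σ ((Q ^ 4).derivative.eval (C s))) s := by
      intro s
      have := hasDerivAt_gaussE_eval (Q ^ 4) s
      simpa only [Polynomial.eval_pow, hQs] using this
    have hW : ∀ s, HasDerivAt (fun s => ∑ k ∈ Finset.range (d + 2), 3 ^ k * s ^ (2 * k) * e k)
        (6 * D s) s := by
      intro s
      have h1 : HasDerivAt (fun s => ∑ k ∈ Finset.range (d + 2), 3 ^ k * s ^ (2 * k) * e k)
          (∑ k ∈ Finset.range (d + 2), 3 ^ k * ((2 * k : ℕ) * s ^ (2 * k - 1)) * e k) s :=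
        HasDerivAt.fun_sum fun k _ => ((hasDerivAt_pow (2 * k) s).const_mul _).mul_const _
      convert! h1 using 1
      rw [Finset.sum_range_succ', hD, Finset.mul_sum]
      simp only [mul_zero, Nat.cast_zero, zero_mul, add_zero]
      refine Finset.sum_congr rfl fun k _ => ?_
      rw [show 2 * (k + 1) - 1 = 2 * k + 1 by omega]
      push_cast
      ring
    have key := le_sq_of_deriv_le hA hW (fun s => gaussE_pow_four_nonneg _) ?_ ?_ ?_ ?_
    · have e1 : qs 1 = q := by rw [h.3, hqs]; simp
      simpa [e1] using key
    · obtain ⟨a, ha⟩ := eq_C_of_totalDegree_le_zero (h.1 0).1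
      have e1 : qs 0 = C a := by
        rw [hqs]
        simp only [Finset.sum_range_succ' _ (d + 1)]
        simp [ha]
      have e2 : ∑ k ∈ Finset.range (d + 2), 3 ^ k * (0 : ℝ) ^ (2 * k) * e k = a ^ 2 := by
        rw [Finset.sum_range_succ']
        simp [he, ha, ← C_pow, -map_pow]
      rw [e1, e2, ← C_pow, gaussE_C]
      exact le_of_eq (by ring)
    · exact Finset.sum_nonneg fun k _ => by have := he0 k; positivity
    · intro s hs _
      have h1 : (Q ^ 4).derivative.eval (C s) = 4 * (qs s) ^ 3 * Q.derivative.eval (C s) := by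
        rw [Polynomial.derivative_pow]
        simp [hQs]
      have h2 : s * gaussE σ ((Q ^ 4).derivative.eval (C s))
          = 12 * ∑ i, gaussE σ (qs s ^ 2 * (MvPolynomial.pderiv i (qs s)) ^ 2) := by
        rw [h1, ← gaussE_C_mul, show C s * (4 * (qs s) ^ 3 * Q.derivative.eval (C s)) =
          (C 4 * (qs s) ^ 3) * (C s * Q.derivative.eval (C s)) by
            rw [show (C 4 : MvPolynomial σ ℝ) = 4 from map_ofNat C 4]; ring, hQ' s,
          gaussE_mul_numOp, Finset.mul_sum]
        refine Finset.sum_congr rfl fun i _ => ?_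
        rw [← gaussE_C_mul, pderiv_C_mul, pderiv_pow,
          show (C 4 : MvPolynomial σ ℝ) = 4 from map_ofNat C 4,
          show (C 12 : MvPolynomial σ ℝ) = 12 from map_ofNat C 12]
        congr 1
        push_cast
        ring
      have h3 : ∑ i, gaussE σ (qs s ^ 2 * (MvPolynomial.pderiv i (qs s)) ^ 2) ≤
          √(gaussE σ (qs s ^ 4)) * (s * D s) := by
        refine (Finset.sum_le_sum fun i _ => gaussE_sq_mul_sq_le _ _).trans ?_
        rw [← Finset.mul_sum]
        exact mul_le_mul_of_nonneg_left (hgrad s) (Real.sqrt_nonneg _)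
      refine le_of_mul_le_mul_left ?_ hs
      rw [h2]
      nlinarith
    · intro s hs
      have : 0 ≤ D s := Finset.sum_nonneg fun k _ => by have := he0 (k + 1); positivity
      positivity

/-- Hypercontractivity: the fourth moment of a polynomial of degree at most `d`. -/
theorem gaussE_pow_four_le {d : ℕ} {q : MvPolynomial σ ℝ} (hq : q.totalDegree ≤ d) :
    gaussE σ (q ^ 4) ≤ 9 ^ d * gaussE σ (q ^ 2) ^ 2 := by
  obtain ⟨f, hf⟩ := exists_chaosDecomp hq
  refine hf.gaussE_pow_four_le.trans ?_
  rw [show (9 : ℝ) ^ d * gaussE σ (q ^ 2) ^ 2 = (3 ^ d * gaussE σ (q ^ 2)) ^ 2 by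
    rw [mul_pow, ← pow_mul, mul_comm d 2, pow_mul]; norm_num, hf.gaussE_sq, Finset.mul_sum]
  refine pow_le_pow_left₀ (Finset.sum_nonneg fun k _ => ?_) (Finset.sum_le_sum fun k hk => ?_) 2
  · have := gaussE_sq_nonneg (f k); positivity
  · have h1 : k ≤ d := by have := Finset.mem_range.1 hk; omega
    exact mul_le_mul_of_nonneg_right (pow_le_pow_right₀ (by norm_num) h1) (gaussE_sq_nonneg _)

/-- Hypercontractivity for vector-valued polynomials. -/
theorem gaussE_sum_sq_sq_le {ι : Type*} {d : ℕ} (s : Finset ι) {t : ι → MvPolynomial σ ℝ}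
    (ht : ∀ a ∈ s, (t a).totalDegree ≤ d) :
    gaussE σ ((∑ a ∈ s, t a ^ 2) ^ 2) ≤ 9 ^ d * gaussE σ (∑ a ∈ s, t a ^ 2) ^ 2 := by
  have h1 : ∀ a ∈ s, √(gaussE σ (t a ^ 4)) ≤ 3 ^ d * gaussE σ (t a ^ 2) := fun a ha => by
    refine Real.sqrt_le_iff.2 ⟨by have := gaussE_sq_nonneg (t a); positivity, ?_⟩
    refine (gaussE_pow_four_le (ht a ha)).trans (le_of_eq ?_)
    rw [mul_pow, ← pow_mul, mul_comm d 2, pow_mul]; norm_num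
  have h2 : gaussE σ ((∑ a ∈ s, t a ^ 2) ^ 2) ≤ (∑ a ∈ s, √(gaussE σ (t a ^ 4))) ^ 2 := by
    rw [sq, sq, Finset.sum_mul_sum, Finset.sum_mul_sum, map_sum]
    refine Finset.sum_le_sum fun a _ => ?_
    rw [map_sum]
    exact Finset.sum_le_sum fun b _ => gaussE_sq_mul_sq_le _ _
  refine h2.trans ?_
  rw [show (9 : ℝ) ^ d * gaussE σ (∑ a ∈ s, t a ^ 2) ^ 2 = (3 ^ d * gaussE σ (∑ a ∈ s, t a ^ 2)) ^ 2 by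
    rw [mul_pow, ← pow_mul, mul_comm d 2, pow_mul]; norm_num, map_sum, Finset.mul_sum]
  exact pow_le_pow_left₀ (Finset.sum_nonneg fun _ _ => Real.sqrt_nonneg _) (Finset.sum_le_sum h1) 2

/-- Higher moments of polynomials, along powers of two. -/
theorem gaussE_pow_two_pow_le (r : ℕ) {d : ℕ} {q : MvPolynomial σ ℝ} (hq : q.totalDegree ≤ d) :
    gaussE σ (q ^ 2 ^ (r + 1)) ≤ 9 ^ (d * (r * 2 ^ r)) * gaussE σ (q ^ 2) ^ 2 ^ r := by
  induction r with
  | zero => simp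
  | succ r ih =>
    -- Each doubling of the exponent is the `L⁴` bound applied to the power `q^(2^r)`, whose degree
    -- is at most `2^r d`.
    have h1 : (q ^ 2 ^ r).totalDegree ≤ 2 ^ r * d :=
      (totalDegree_pow _ _).trans (Nat.mul_le_mul_left _ hq)
    have h2 := gaussE_pow_four_le h1
    rw [← pow_mul, ← pow_mul, show 2 ^ r * 4 = 2 ^ (r + 1 + 1) by ring,
      show 2 ^ r * 2 = 2 ^ (r + 1) by ring] at h2
    have h3 : 0 ≤ gaussE σ (q ^ 2 ^ (r + 1)) := gaussE_nonneg fun x => by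
      rw [map_pow, pow_succ, pow_mul']; positivity
    refine h2.trans ?_
    calc (9 : ℝ) ^ (2 ^ r * d) * gaussE σ (q ^ 2 ^ (r + 1)) ^ 2
        ≤ 9 ^ (2 ^ r * d) * (9 ^ (d * (r * 2 ^ r)) * gaussE σ (q ^ 2) ^ 2 ^ r) ^ 2 := by gcongr
      _ = 9 ^ (2 ^ r * d + d * (r * 2 ^ r) * 2) * gaussE σ (q ^ 2) ^ 2 ^ (r + 1) := by
        rw [mul_pow, ← pow_mul, ← pow_mul, ← mul_assoc, ← pow_add, pow_succ 2 r]
      _ ≤ _ := by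
        have := gaussE_sq_nonneg q
        gcongr
        · norm_num
        · rw [pow_succ]; nlinarith [Nat.zero_le (2 ^ r * d)]

end Hypercontractivity

/-! ### Logarithmic derivatives of trigonometric polynomials. -/

section TrigPolynomial

open MvPolynomial

theorem hasDerivAt_eval_curve {σ : Type*} [Fintype σ] (q : MvPolynomial σ ℝ) {c c' : ℝ → σ → ℝ}
    {s : ℝ} (hc : ∀ i, HasDerivAt (fun s => c s i) (c' s i) s) :
    HasDerivAt (fun s => eval (c s) q) (∑ i, c' s i * eval (c s) (pderiv i q)) s := by
  classical
  induction q using MvPolynomial.induction_on with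
  | C a => simpa using hasDerivAt_const s a
  | add p q hp hq =>
    simp only [map_add, mul_add, Finset.sum_add_distrib]
    exact hp.add hq
  | mul_X p j hp =>
    simp only [map_mul, eval_X]
    convert! hp.mul (hc j) using 1
    simp only [Derivation.leibniz, map_add, smul_eq_mul, map_mul, eval_X, mul_add,
      Finset.sum_add_distrib, pderiv_X, Finset.sum_mul, Pi.single_apply]
    rw [add_comm]
    congr 1
    · exact Finset.sum_congr rfl fun i _ => by ring
    · rw [Finset.sum_eq_single_of_mem j (Finset.mem_univ j)]
      · simp; ring
      · intro i _ hi; simp [hi.symm]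

/-- With `z = e^{iφ}`, both `z cos φ` and `z sin φ` are quadratic in `z`, so each linear form times
`z` is a quadratic `ℓ`. Monomials of lower degree are padded by powers of `z`, so that all of them
carry the factor `z^d`. -/
theorem exists_polynomial_eval_exp {σ : Type*} [Fintype σ] {d : ℕ} {q : MvPolynomial σ ℝ}
    (hq : q.totalDegree ≤ d) (a b : σ → ℝ) :
    ∃ Q : Polynomial ℂ, Q.natDegree ≤ 2 * d ∧ ∀ φ : ℝ,
      Q.eval (Complex.exp (φ * Complex.I)) = Complex.exp (φ * Complex.I) ^ d *
        (eval (fun i => Real.cos φ * a i + Real.sin φ * b i) q : ℝ) := by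
  set ℓ : σ → Polynomial ℂ := fun i =>
    Polynomial.C (((a i : ℂ) - Complex.I * b i) / 2) * Polynomial.X ^ 2
      + Polynomial.C (((a i : ℂ) + Complex.I * b i) / 2) with hℓ
  have hdeg : ∀ i, (ℓ i).natDegree ≤ 2 := fun i => by
    rw [hℓ]
    compute_degree
    exact Polynomial.natDegree_C_mul_X_pow_le _ _
  have hev : ∀ i (φ : ℝ), (ℓ i).eval (Complex.exp (φ * Complex.I)) = Complex.exp (φ * Complex.I) *
      ((Real.cos φ * a i + Real.sin φ * b i : ℝ) : ℂ) := by
    intro i φ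
    simp only [hℓ, Polynomial.eval_add, Polynomial.eval_mul, Polynomial.eval_C,
      Polynomial.eval_pow, Polynomial.eval_X, Complex.exp_mul_I]
    push_cast
    have h1 := Complex.cos_sq_add_sin_sq (φ : ℂ)
    have h2 : Complex.I ^ 2 = -1 := Complex.I_sq
    linear_combination (-(a i : ℂ) / 2 - Complex.I * b i / 2) * h1 +
      (a i / 2 * Complex.sin φ ^ 2 - b i * Complex.cos φ * Complex.sin φ
        - Complex.I * b i / 2 * Complex.sin φ ^ 2) * h2
  refine ⟨∑ α ∈ q.support, Polynomial.C ((q.coeff α : ℝ) : ℂ) *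
    (Polynomial.X ^ (d - α.sum fun _ e => e) * ∏ i ∈ α.support, ℓ i ^ α i), ?_, ?_⟩
  · refine Polynomial.natDegree_sum_le_of_forall_le _ _ fun α hα => ?_
    have h1 : (α.sum fun _ e => e) ≤ d := (le_totalDegree hα).trans hq
    refine (Polynomial.natDegree_C_mul_le _ _).trans (Polynomial.natDegree_mul_le.trans ?_)
    rw [Polynomial.natDegree_X_pow]
    have h2 : (∏ i ∈ α.support, ℓ i ^ α i).natDegree ≤ ∑ i ∈ α.support, α i * 2 := by
      refine (Polynomial.natDegree_prod_le _ _).trans (Finset.sum_le_sum fun i _ => ?_)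
      exact Polynomial.natDegree_pow_le.trans (Nat.mul_le_mul_left _ (hdeg i))
    rw [← Finset.sum_mul] at h2
    change _ ≤ (α.sum fun _ e => e) * 2 at h2
    omega
  · intro φ
    rw [eval_eq, Polynomial.eval_finsetSum]
    push_cast
    rw [Finset.mul_sum]
    refine Finset.sum_congr rfl fun α hα => ?_
    have h1 : (α.sum fun _ e => e) ≤ d := (le_totalDegree hα).trans hq
    simp only [Polynomial.eval_mul, Polynomial.eval_C, Polynomial.eval_pow, Polynomial.eval_X,
      Polynomial.eval_prod, hev, mul_pow, Finset.prod_mul_distrib]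
    rw [Finset.prod_pow_eq_pow_sum]
    have h3 : Complex.exp (φ * Complex.I) ^ (d - α.sum fun _ e => e) *
        Complex.exp (φ * Complex.I) ^ (∑ i ∈ α.support, α i) = Complex.exp (φ * Complex.I) ^ d := by
      rw [← pow_add]
      congr 1
      exact Nat.sub_add_cancel h1
    rw [← h3]
    push_cast
    ring

theorem abs_sub_le_two_mul_abs_sin_sub {x y : ℝ} (hx : x ∈ Set.Icc (0 : ℝ) 1)
    (hy : y ∈ Set.Icc (0 : ℝ) 1) : |x - y| ≤ 2 * |Real.sin x - Real.sin y| := by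
  have hmono : MonotoneOn (fun x => Real.sin x - x / 2) (Set.Icc 0 1) := by
    have hd : ∀ x, HasDerivAt (fun x => Real.sin x - x / 2) (Real.cos x - 1 / 2) x := fun x =>
      (Real.hasDerivAt_sin x).sub ((hasDerivAt_id x).div_const 2)
    refine monotoneOn_of_deriv_nonneg (convex_Icc 0 1)
      (fun x _ => (hd x).continuousAt.continuousWithinAt)
      (fun x _ => (hd x).differentiableAt.differentiableWithinAt) fun x hx => ?_
    rw [interior_Icc] at hx
    rw [(hd x).deriv]
    have := Real.one_sub_sq_div_two_le_cos (x := x)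
    nlinarith [hx.1, hx.2]
  have key : ∀ {u v : ℝ}, u ∈ Set.Icc (0 : ℝ) 1 → v ∈ Set.Icc (0 : ℝ) 1 → u ≤ v →
      |u - v| ≤ 2 * |Real.sin u - Real.sin v| := by
    intro u v hu hv huv
    have h := hmono hu hv huv
    simp only at h
    rw [abs_sub_comm u, abs_sub_comm (Real.sin u), abs_of_nonneg (sub_nonneg.2 huv)]
    have := le_abs_self (Real.sin v - Real.sin u)
    linarith
  rcases le_total x y with h | h
  · exact key hx hy h
  · rw [abs_sub_comm x, abs_sub_comm (Real.sin x)]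
    exact key hy hx h

/-- Two such angles give points of the circle within `2δ` of each other. On `[0, 1]` the sine
expands distances by at least `1/2`, so the set has diameter at most `4δ`. -/
theorem volume_exp_near_le (w : ℂ) (δ : ℝ) :
    volume {φ : ℝ | φ ∈ Set.Icc (0 : ℝ) 1 ∧ ‖Complex.exp (φ * Complex.I) - w‖ < δ}
      ≤ ENNReal.ofReal (4 * δ) := by
  refine (Real.volume_le_diam _).trans (Metric.ediam_le fun x hx y hy => ?_)
  rw [edist_dist, Real.dist_eq]
  refine ENNReal.ofReal_le_ofReal ((abs_sub_le_two_mul_abs_sin_sub hx.1 hy.1).trans ?_)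
  have h1 : |Real.sin x - Real.sin y| ≤ ‖Complex.exp (x * Complex.I) - Complex.exp (y * Complex.I)‖ := by
    have := Complex.abs_im_le_norm (Complex.exp (x * Complex.I) - Complex.exp (y * Complex.I))
    simpa [Complex.exp_ofReal_mul_I_im] using this
  have h2 : ‖Complex.exp (x * Complex.I) - Complex.exp (y * Complex.I)‖ ≤
      ‖Complex.exp (x * Complex.I) - w‖ + ‖Complex.exp (y * Complex.I) - w‖ := by
    rw [← dist_eq_norm, ← dist_eq_norm, ← dist_eq_norm]
    exact dist_triangle_right _ _ _
  linarith [hx.2, hy.2]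

/-- The logarithmic derivative of a trigonometric polynomial is rarely large. -/
theorem volume_log_deriv_large_le {d : ℕ} (hd : 0 < d) {Q : Polynomial ℂ}
    (hQ : Q.natDegree ≤ 2 * d) {r r' : ℝ → ℝ} (hr : ∀ φ, HasDerivAt r (r' φ) φ)
    (hQr : ∀ φ : ℝ, Q.eval (Complex.exp (φ * Complex.I)) = Complex.exp (φ * Complex.I) ^ d * (r φ : ℝ))
    {ε : ℝ} (hε : 0 < ε) :
    volume {φ : ℝ | φ ∈ Set.Icc (0 : ℝ) 1 ∧ |r φ| < ε * |r' φ|}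
      ≤ ENNReal.ofReal (24 * d ^ 2 * ε) := by
  have hd1 : (1 : ℝ) ≤ d := by exact_mod_cast hd
  -- This is the radius of the discs removed around the roots of `Q`: outside them the logarithmic
  -- derivative of `r` is at most `2d/δ + d ≤ 3d/δ = 1/ε`, provided `δ ≤ 1`.
  set δ : ℝ := 3 * d * ε with hδ
  have hδ0 : 0 < δ := by positivity
  -- For `δ > 1` the claimed bound `24d²ε = 8dδ` already exceeds the length of the interval.
  rcases lt_or_ge 1 δ with h1 | h1
  · calc volume {φ : ℝ | φ ∈ Set.Icc (0 : ℝ) 1 ∧ |r φ| < ε * |r' φ|}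
        ≤ volume (Set.Icc (0 : ℝ) 1) := measure_mono fun φ h => h.1
      _ ≤ ENNReal.ofReal (24 * d ^ 2 * ε) := by
        rw [Real.volume_Icc]
        refine ENNReal.ofReal_le_ofReal ?_
        nlinarith [mul_le_mul_of_nonneg_right hd1 hδ0.le]
  by_cases hQ0 : Q = 0
  · have hr0 : ∀ φ, r φ = 0 := by
      intro φ
      have := hQr φ
      rw [hQ0, Polynomial.eval_zero] at this
      have h2 := (mul_eq_zero.1 this.symm).resolve_left (pow_ne_zero _ (Complex.exp_ne_zero _))
      exact_mod_cast h2
    have hr'0 : ∀ φ, r' φ = 0 := by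
      intro φ
      have e : r = fun _ => 0 := funext hr0
      have := hr φ
      rw [e] at this
      exact this.unique (hasDerivAt_const φ 0)
    simp [hr0, hr'0]
  have hsub : {φ : ℝ | φ ∈ Set.Icc (0 : ℝ) 1 ∧ |r φ| < ε * |r' φ|} ⊆
      ⋃ w ∈ Q.roots.toFinset,
        {φ : ℝ | φ ∈ Set.Icc (0 : ℝ) 1 ∧ ‖Complex.exp (φ * Complex.I) - w‖ < δ} := by
    rintro φ ⟨hφ, hlt⟩
    simp only [Set.mem_iUnion, Multiset.mem_toFinset]
    set z := Complex.exp (φ * Complex.I) with hz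
    have hz0 : z ≠ 0 := Complex.exp_ne_zero _
    have hz1 : ‖z‖ = 1 := Complex.norm_exp_ofReal_mul_I φ
    by_cases hev : Q.eval z = 0
    · exact ⟨z, (Polynomial.mem_roots hQ0).2 hev, hφ, by simpa [hz] using hδ0⟩
    by_contra hno
    have hfar : ∀ w ∈ Q.roots, δ ≤ ‖z - w‖ := by
      intro w hw
      by_contra hlt'
      exact hno ⟨w, hw, hφ, not_le.1 hlt'⟩
    have hrne : (r φ : ℂ) ≠ 0 := by
      intro h0
      exact hev (by rw [hQr φ, h0, mul_zero])
    -- Differentiating `Q(e^{iφ}) = e^{idφ} r(φ)` in `φ` and dividing by its value expresses `r'/r`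
    -- through `Q'/Q = ∑ 1/(z - w)`, the sum over the roots.
    have hder : (Q.derivative.eval z) * (z * Complex.I) =
        d * Complex.I * z ^ d * r φ + z ^ d * r' φ := by
      have hE : HasDerivAt (fun s : ℝ => Complex.exp (s * Complex.I)) (z * Complex.I) φ := by
        have h3 : HasDerivAt (fun s : ℝ => (s : ℂ) * Complex.I) Complex.I φ := by
          simpa using (Complex.ofRealCLM.hasDerivAt (x := φ)).mul_const Complex.I
        exact h3.cexp
      have hl : HasDerivAt (fun s : ℝ => Q.eval (Complex.exp (s * Complex.I)))
          (Q.derivative.eval z * (z * Complex.I)) φ :=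
        HasDerivAt.comp (h₂ := fun w => Q.eval w) φ (Q.hasDerivAt z) hE
      have hrr : HasDerivAt (fun s : ℝ => Complex.exp (s * Complex.I) ^ d * (r s : ℂ))
          (d * z ^ (d - 1) * (z * Complex.I) * r φ + z ^ d * r' φ) φ :=
        (hE.pow d).mul (hr φ).ofReal_comp
      have e : (fun s : ℝ => Q.eval (Complex.exp (s * Complex.I))) =
          fun s : ℝ => Complex.exp (s * Complex.I) ^ d * (r s : ℂ) := funext hQr
      rw [e] at hl
      rw [hl.unique hrr]
      have : z ^ d = z ^ (d - 1) * z := by rw [← pow_succ, Nat.sub_add_cancel hd]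
      rw [this]
      ring
    have hlog := (IsAlgClosed.splits Q).eval_derivative_eq_eval_mul_sum hev
    set S : ℂ := (Q.roots.map fun w => 1 / (z - w)).sum with hS
    have hSle : ‖S‖ ≤ 2 * d * (1 / δ) := by
      refine (norm_multiset_sum_le _).trans ?_
      rw [Multiset.map_map]
      have h4 := Multiset.sum_le_card_nsmul (Q.roots.map (norm ∘ fun w => 1 / (z - w))) (1 / δ) ?_
      · refine h4.trans ?_
        rw [Multiset.card_map, nsmul_eq_mul]
        have : (Multiset.card Q.roots : ℝ) ≤ 2 * d := by
          exact_mod_cast (Polynomial.card_roots' Q).trans hQ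
        gcongr
      · intro x hx
        obtain ⟨w, hw, rfl⟩ := Multiset.mem_map.1 hx
        simp only [Function.comp, norm_div, norm_one]
        exact one_div_le_one_div_of_le hδ0 (hfar w hw)
    have hr'eq : (r' φ : ℂ) = r φ * (Complex.I * (z * S - d)) := by
      rw [hlog, hQr φ] at hder
      refine mul_left_cancel₀ (pow_ne_zero d hz0) ?_
      rw [← hz] at hder
      linear_combination -hder
    have hnorm : |r' φ| ≤ |r φ| * (2 * d * (1 / δ) + d) := by
      have h5 : |r' φ| = |r φ| * ‖z * S - d‖ := by
        have := congrArg norm hr'eq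
        rw [norm_mul, norm_mul, Complex.norm_I, one_mul, Complex.norm_real, Complex.norm_real] at this
        exact this
      rw [h5]
      refine mul_le_mul_of_nonneg_left ?_ (abs_nonneg _)
      refine (norm_sub_le _ _).trans ?_
      rw [norm_mul, hz1, one_mul, Complex.norm_natCast]
      linarith
    have h6 : 2 * d * (1 / δ) + d ≤ 1 / ε := by
      have h7 : (d : ℝ) ≤ d * (1 / δ) := by
        have : 1 ≤ 1 / δ := by rw [le_div_iff₀ hδ0]; linarith
        nlinarith
      have h8 : 3 * d * (1 / δ) = 1 / ε := by rw [hδ]; field_simp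
      linarith
    have h9 : ε * |r' φ| ≤ |r φ| := by
      calc ε * |r' φ| ≤ ε * (|r φ| * (1 / ε)) := by gcongr; exact hnorm.trans (by gcongr)
        _ = |r φ| := by field_simp
    linarith
  refine (measure_mono hsub).trans ((measure_biUnion_finset_le _ _).trans ?_)
  refine (Finset.sum_le_sum fun w _ => volume_exp_near_le w δ).trans ?_
  rw [Finset.sum_const, nsmul_eq_mul, ← ENNReal.ofReal_natCast, ← ENNReal.ofReal_mul (by positivity)]
  refine ENNReal.ofReal_le_ofReal ?_
  have : (Q.roots.toFinset.card : ℝ) ≤ 2 * d := by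
    exact_mod_cast (Multiset.toFinset_card_le _).trans ((Polynomial.card_roots' Q).trans hQ)
  calc (Q.roots.toFinset.card : ℝ) * (4 * δ) ≤ 2 * d * (4 * δ) := by gcongr
    _ = 24 * d ^ 2 * ε := by rw [hδ]; ring

end TrigPolynomial

/-! ### Anticoncentration: derivatives rarely dominate lower ones. -/

section Anticoncentration

open MvPolynomial

instance isGaussian_stdGauss {σ : Type*} [Fintype σ] : IsGaussian (stdGauss σ) := by
  have h : HasGaussianLaw (fun (x : σ → ℝ) => (fun j => x j)) (stdGauss σ) :=
    iIndepFun.hasGaussianLaw (X := fun j (x : σ → ℝ) => x j)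
      (fun j => ⟨by rw [(hasLaw_eval_stdGauss j).map_eq]; infer_instance⟩) iIndepFun_eval_stdGauss
  have h2 := h.isGaussian_map
  have e : (fun (x : σ → ℝ) => (fun j => x j)) = id := rfl
  rwa [e, Measure.map_id] at h2

theorem map_rotation_stdGauss {σ : Type*} [Fintype σ] (θ : ℝ) :
    ((stdGauss σ).prod (stdGauss σ)).map (ContinuousLinearMap.rotation θ) =
      (stdGauss σ).prod (stdGauss σ) := by
  refine IsGaussian.map_rotation_eq_self ?_ θ
  ext j
  rw [← ContinuousLinearMap.proj_apply (R := ℝ) (φ := fun _ : σ => ℝ) j (∫ x, id x ∂stdGauss σ),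
    ← ContinuousLinearMap.integral_comp_comm _ IsGaussian.integrable_id]
  have := (hasLaw_eval_stdGauss j).integral_eq
  simpa using this

@[fun_prop]
theorem measurable_eval_comp {σ α : Type*} [Fintype σ] [MeasurableSpace α] (q : MvPolynomial σ ℝ)
    {f : α → σ → ℝ} (hf : Measurable f) : Measurable fun a => eval (f a) q :=
  (MvPolynomial.continuous_eval q).measurable.comp hf

/-- Scalar polynomials are rarely small compared to a random directional derivative. -/
theorem prod_stdGauss_small_le {σ : Type*} [Fintype σ] {d : ℕ} (hd : 0 < d)
    {q : MvPolynomial σ ℝ} (hq : q.totalDegree ≤ d) {ε : ℝ} (hε : 0 < ε) :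
    ((stdGauss σ).prod (stdGauss σ))
      {z | |eval z.1 q| < ε * |∑ i, z.2 i * eval z.1 (pderiv i q)|}
      ≤ ENNReal.ofReal (24 * d ^ 2 * ε) := by
  set μ := (stdGauss σ).prod (stdGauss σ) with hμ
  set S : Set ((σ → ℝ) × (σ → ℝ)) :=
    {z | |eval z.1 q| < ε * |∑ i, z.2 i * eval z.1 (pderiv i q)|} with hS
  have hSm : MeasurableSet S := measurableSet_lt (by fun_prop) (by fun_prop)
  set R : ℝ × ((σ → ℝ) × (σ → ℝ)) → (σ → ℝ) × (σ → ℝ) := fun u =>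
    ContinuousLinearMap.rotation u.1 u.2 with hR
  have hRm : Measurable R := by
    have : Continuous R := by
      simp only [hR, ContinuousLinearMap.rotation_apply]
      fun_prop
    exact this.measurable
  -- Averaging over rotation angles in `[0, 1]` leaves the measure of `S` unchanged. After Fubini
  -- the pair `(x, y)` is fixed and the angle varies; the derivative of `q(cos φ x + sin φ y)` in
  -- `φ` is exactly the directional derivative at the rotated point along the rotated second vector.
  have h1 : ((volume.restrict (Set.Icc (0 : ℝ) 1)).prod μ) (R ⁻¹' S) = μ S := by
    rw [Measure.prod_apply (hRm hSm)]
    have h2 : ∀ φ : ℝ, μ (Prod.mk φ ⁻¹' (R ⁻¹' S)) = μ S := by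
      intro φ
      conv_rhs => rw [hμ, ← map_rotation_stdGauss φ]
      rw [Measure.map_apply (ContinuousLinearMap.measurable _) hSm]
      rfl
    simp [h2]
  rw [← h1, Measure.prod_apply_symm (hRm hSm)]
  have h3 : ∀ z : (σ → ℝ) × (σ → ℝ), (volume.restrict (Set.Icc (0 : ℝ) 1))
      ((fun φ => (φ, z)) ⁻¹' (R ⁻¹' S)) ≤ ENNReal.ofReal (24 * d ^ 2 * ε) := by
    intro z
    rw [Measure.restrict_apply (measurable_prodMk_right (hRm hSm))]
    obtain ⟨Q, hQd, hQ⟩ := exists_polynomial_eval_exp hq z.1 z.2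
    have hr : ∀ φ, HasDerivAt
        (fun φ => eval (fun i => Real.cos φ * z.1 i + Real.sin φ * z.2 i) q)
        (∑ i, (-Real.sin φ * z.1 i + Real.cos φ * z.2 i) *
          eval (fun i => Real.cos φ * z.1 i + Real.sin φ * z.2 i) (pderiv i q)) φ := fun φ =>
      hasDerivAt_eval_curve q (c := fun φ i => Real.cos φ * z.1 i + Real.sin φ * z.2 i)
        (c' := fun φ i => -Real.sin φ * z.1 i + Real.cos φ * z.2 i) fun i =>
        ((Real.hasDerivAt_cos φ).mul_const _).add ((Real.hasDerivAt_sin φ).mul_const _)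
    refine (measure_mono ?_).trans (volume_log_deriv_large_le hd hQd hr hQ hε)
    rintro φ ⟨h, hφ⟩
    exact ⟨hφ, h⟩
  refine (lintegral_mono h3).trans ?_
  simp

theorem gaussE_linear_sq {ι : Type*} [Fintype ι] (a : ι → ℝ) :
    gaussE ι ((∑ i, C (a i) * X i) ^ 2) = ∑ i, a i ^ 2 := by
  classical
  have h1 : ∀ i (q : MvPolynomial ι ℝ), gaussE ι (C (a i) * X i * q) = a i * gaussE ι (pderiv i q) :=
    fun i q => by rw [mul_assoc, gaussE_C_mul, gaussE_X_mul]
  rw [sq, Finset.sum_mul, map_sum]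
  refine Finset.sum_congr rfl fun i _ => ?_
  rw [h1, map_sum]
  simp only [pderiv_C_mul, pderiv_X, Pi.single_apply, mul_ite, mul_one, mul_zero]
  simp [sq]

theorem totalDegree_linear_le {ι : Type*} [Fintype ι] (a : ι → ℝ) :
    (∑ i, C (a i) * X i : MvPolynomial ι ℝ).totalDegree ≤ 1 :=
  totalDegree_finsetSum_le fun i _ => by
    rw [C_mul']
    exact (totalDegree_smul_le _ _).trans (by simp)

theorem eval_linear {ι : Type*} [Fintype ι] (a x : ι → ℝ) :
    eval x (∑ i, C (a i) * X i) = ∑ i, a i * x i := by simp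

theorem ofReal_integral_le_lintegral {α : Type*} [MeasurableSpace α] {μ : Measure α} {f : α → ℝ}
    (hf : Integrable f μ) : ENNReal.ofReal (∫ x, f x ∂μ) ≤ ∫⁻ x, ENNReal.ofReal (f x) ∂μ := by
  have h1 : ∫ x, f x ∂μ ≤ ∫ x, max (f x) 0 ∂μ :=
    integral_mono hf hf.pos_part fun x => le_max_left _ _
  refine (ENNReal.ofReal_le_ofReal h1).trans ?_
  rw [ofReal_integral_eq_lintegral_ofReal hf.pos_part
    (Filter.Eventually.of_forall fun x => le_max_right _ _)]
  exact lintegral_mono fun x => by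
    rw [ENNReal.ofReal_max]; simp

/-- A Paley-Zygmund bound for a Gaussian bilinear form against a Gaussian linear form. -/
theorem lintegral_bilinear_large_ge {ι σ : Type*} [Fintype ι] [Fintype σ] (τ : ι → ℝ)
    (A : ι → σ → ℝ) {ε : ℝ} (hε : 0 < ε)
    (h : ∑ a, τ a ^ 2 < ε ^ 2 * ∑ a, ∑ i, A a i ^ 2) :
    ENNReal.ofReal (1 / 162) ≤ ∫⁻ y, stdGauss ι
      {g | |∑ a, g a * τ a| < 2 * ε * |∑ a, g a * ∑ i, y i * A a i|} ∂(stdGauss σ) := by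
  set T := ∑ a, ∑ i, A a i ^ 2 with hT
  have hτ0 : 0 ≤ ∑ a, τ a ^ 2 := Finset.sum_nonneg fun a _ => sq_nonneg _
  have hT0 : 0 < T := by
    by_contra hneg
    have := mul_nonpos_of_nonneg_of_nonpos (sq_nonneg ε) (not_lt.1 hneg)
    linarith
  set b : ι → MvPolynomial σ ℝ := fun a => ∑ i, C (A a i) * X i with hb
  set Sy : MvPolynomial σ ℝ := ∑ a, b a ^ 2 with hSy
  have hES : gaussE σ Sy = T := by
    rw [hSy, map_sum, hT]
    exact Finset.sum_congr rfl fun a _ => gaussE_linear_sq (A a)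
  have hES2 : gaussE σ (Sy ^ 2) ≤ 9 * T ^ 2 := by
    have := gaussE_sum_sq_sq_le (d := 1) Finset.univ (t := b) fun a _ => totalDegree_linear_le _
    rwa [← hSy, hES, pow_one] at this
  -- With `P = L²/(81T)`, the indicator of the event is at least `2P - P² - M²/(162ε²T)`, which is
  -- `K` below. Averaging over `g` with `E L⁴ ≤ 9 S²` gives at least `H`. Averaging over `y` with `E
  -- S² ≤ 9T²` leaves `2/81 - 1/81 - 1/162 = 1/162`; the number `81` comes from these two factors of
  -- nine.
  set H : MvPolynomial σ ℝ := C (2 / (81 * T)) * Sy - C (9 / (6561 * T ^ 2)) * Sy ^ 2 - C (1 / 162)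
    with hH
  have hEH : 1 / 162 ≤ gaussE σ H := by
    rw [hH, map_sub, map_sub, gaussE_C_mul, gaussE_C_mul, gaussE_C, hES]
    have h1 : 9 / (6561 * T ^ 2) * gaussE σ (Sy ^ 2) ≤ 9 / (6561 * T ^ 2) * (9 * T ^ 2) := by gcongr
    have h2 : 9 / (6561 * T ^ 2) * (9 * T ^ 2) = 1 / 81 := by field_simp; norm_num
    have h3 : 2 / (81 * T) * T = 2 / 81 := by field_simp
    linarith
  refine (ENNReal.ofReal_le_ofReal hEH).trans
    ((ofReal_integral_le_lintegral (integrable_eval_stdGauss H)).trans (lintegral_mono fun y => ?_))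
  set U : Set (ι → ℝ) :=
    {g | |∑ a, g a * τ a| < 2 * ε * |∑ a, g a * ∑ i, y i * A a i|} with hU
  have hUm : MeasurableSet U := measurableSet_lt (by fun_prop) (by fun_prop)
  set M : MvPolynomial ι ℝ := ∑ a, C (τ a) * X a with hM
  set L : MvPolynomial ι ℝ := ∑ a, C (eval y (b a)) * X a with hL
  have hL2 : gaussE ι (L ^ 2) = eval y Sy := by
    rw [hL, gaussE_linear_sq, hSy, map_sum]
    simp
  have hL4 : gaussE ι (L ^ 4) ≤ 9 * eval y Sy ^ 2 := by
    have := gaussE_pow_four_le (q := L) (totalDegree_linear_le _)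
    rwa [hL2, pow_one] at this
  have hM2 : gaussE ι (M ^ 2) ≤ ε ^ 2 * T := by rw [hM, gaussE_linear_sq]; exact h.le
  set K : MvPolynomial ι ℝ :=
    C (2 / (81 * T)) * L ^ 2 - C (1 / (6561 * T ^ 2)) * L ^ 4 - C (1 / (162 * (ε ^ 2 * T))) * M ^ 2
    with hK
  have hHK : eval y H ≤ gaussE ι K := by
    rw [hK, map_sub (gaussE ι), map_sub (gaussE ι), gaussE_C_mul, gaussE_C_mul, gaussE_C_mul, hL2, hH]
    simp only [map_sub, map_mul, eval_C, map_pow]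
    have h1 : 1 / (6561 * T ^ 2) * gaussE ι (L ^ 4) ≤ 1 / (6561 * T ^ 2) * (9 * eval y Sy ^ 2) := by
      gcongr
    have h2 : 1 / (162 * (ε ^ 2 * T)) * gaussE ι (M ^ 2) ≤
        1 / (162 * (ε ^ 2 * T)) * (ε ^ 2 * T) := by gcongr
    have h3 : 1 / (162 * (ε ^ 2 * T)) * (ε ^ 2 * T) = 1 / 162 := by field_simp
    have h4 : 1 / (6561 * T ^ 2) * (9 * eval y Sy ^ 2) = 9 / (6561 * T ^ 2) * eval y Sy ^ 2 := by ring
    linarith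
  have hKU : gaussE ι K ≤ ∫ g, U.indicator 1 g ∂(stdGauss ι) := by
    refine integral_mono (integrable_eval_stdGauss K)
      ((integrable_const (1 : ℝ)).indicator hUm) fun g => ?_
    have eM : eval g M = ∑ a, g a * τ a := by
      rw [hM, eval_linear]; exact Finset.sum_congr rfl fun a _ => mul_comm _ _
    have eL : eval g L = ∑ a, g a * ∑ i, y i * A a i := by
      rw [hL, eval_linear]
      refine Finset.sum_congr rfl fun a _ => ?_
      rw [hb, mul_comm]
      simp only [eval_linear]
      congr 1
      exact Finset.sum_congr rfl fun i _ => mul_comm _ _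
    have eK : eval g K = 2 * (eval g L ^ 2 / (81 * T)) - (eval g L ^ 2 / (81 * T)) ^ 2
        - eval g M ^ 2 / (162 * (ε ^ 2 * T)) := by
      rw [hK]
      simp only [map_sub, map_mul, eval_C, map_pow]
      field_simp
      ring
    simp only [eK]
    -- On `U` the bound is `2P - P² ≤ 1`. Off `U`, the factor `2` in the definition of the event
    -- makes `2P` at most the subtracted `M` term.
    by_cases hg : g ∈ U
    · rw [Set.indicator_of_mem hg, Pi.one_apply]
      have : 0 ≤ eval g M ^ 2 / (162 * (ε ^ 2 * T)) := by positivity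
      nlinarith [sq_nonneg (eval g L ^ 2 / (81 * T) - 1)]
    · rw [Set.indicator_of_notMem hg]
      have hg' : 2 * ε * |eval g L| ≤ |eval g M| := by
        rw [eM, eL]; exact not_lt.1 hg
      have h5 : (2 * ε) ^ 2 * eval g L ^ 2 ≤ eval g M ^ 2 := by
        rw [← sq_abs (eval g L), ← sq_abs (eval g M), ← mul_pow]
        exact pow_le_pow_left₀ (by positivity) hg' 2
      have h6 : 2 * (eval g L ^ 2 / (81 * T)) ≤ eval g M ^ 2 / (162 * (ε ^ 2 * T)) := by
        rw [le_div_iff₀ (by positivity)]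
        refine le_trans (le_of_eq ?_) h5
        field_simp
        ring
      nlinarith [sq_nonneg (eval g L ^ 2 / (81 * T))]
  rw [integral_indicator_one hUm] at hKU
  refine (ENNReal.ofReal_le_ofReal (hHK.trans hKU)).trans ?_
  rw [ofReal_measureReal]

/-- A vector-valued polynomial is rarely small compared to its derivative. -/
theorem stdGauss_sum_sq_small_le {ι σ : Type*} [Fintype ι] [Fintype σ] {d : ℕ} (hd : 0 < d)
    {t : ι → MvPolynomial σ ℝ} (ht : ∀ a, (t a).totalDegree ≤ d) {ε : ℝ} (hε : 0 < ε) :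
    stdGauss σ {x | ∑ a, eval x (t a) ^ 2 < ε ^ 2 * ∑ a, ∑ i, eval x (pderiv i (t a)) ^ 2}
      ≤ ENNReal.ofReal (7776 * d ^ 2 * ε) := by
  set Bd : Set (σ → ℝ) :=
    {x | ∑ a, eval x (t a) ^ 2 < ε ^ 2 * ∑ a, ∑ i, eval x (pderiv i (t a)) ^ 2} with hBd
  have hBm : MeasurableSet Bd := measurableSet_lt (by fun_prop) (by fun_prop)
  -- The measure of one event is estimated in two ways. For fixed `g` it is the scalar bound for `∑
  -- g_a t_a`; for fixed bad `x` it has probability at least `1/162` over `g` and the direction.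
  -- Comparing gives `162 · 24 · 2 = 7776`.
  set S : Set ((ι → ℝ) × ((σ → ℝ) × (σ → ℝ))) := {u | |∑ a, u.1 a * eval u.2.1 (t a)| <
    2 * ε * |∑ a, u.1 a * ∑ i, u.2.2 i * eval u.2.1 (pderiv i (t a))|} with hS
  have hSm : MeasurableSet S := measurableSet_lt (by fun_prop) (by fun_prop)
  set π2 := (stdGauss σ).prod (stdGauss σ) with hπ
  have hup : ((stdGauss ι).prod π2) S ≤ ENNReal.ofReal (24 * d ^ 2 * (2 * ε)) := by
    rw [Measure.prod_apply hSm]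
    have h1 : ∀ g : ι → ℝ, π2 (Prod.mk g ⁻¹' S) ≤ ENNReal.ofReal (24 * d ^ 2 * (2 * ε)) := by
      intro g
      have hdeg : (∑ a, C (g a) * t a).totalDegree ≤ d := totalDegree_finsetSum_le fun a _ => by
        rw [C_mul']
        exact (totalDegree_smul_le _ _).trans (ht a)
      refine (measure_mono ?_).trans (prod_stdGauss_small_le hd hdeg (by positivity : 0 < 2 * ε))
      intro z hz
      have e1 : ∑ i, z.2 i * eval z.1 (pderiv i (∑ a, C (g a) * t a)) =
          ∑ a, g a * ∑ i, z.2 i * eval z.1 (pderiv i (t a)) := by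
        simp only [map_sum, pderiv_C_mul, map_mul, eval_C, Finset.mul_sum]
        rw [Finset.sum_comm]
        exact Finset.sum_congr rfl fun a _ => Finset.sum_congr rfl fun i _ => by ring
      have e2 : eval z.1 (∑ a, C (g a) * t a) = ∑ a, g a * eval z.1 (t a) := by simp
      simp only [Set.mem_ofPred_eq, e1, e2]
      exact hz
    refine (lintegral_mono h1).trans ?_
    simp
  have hlow : ENNReal.ofReal (1 / 162) * stdGauss σ Bd ≤ ((stdGauss ι).prod π2) S := by
    rw [Measure.prod_apply_symm hSm, hπ, lintegral_prod]
    · calc ENNReal.ofReal (1 / 162) * stdGauss σ Bd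
          = ∫⁻ x, Bd.indicator (fun _ => ENNReal.ofReal (1 / 162)) x ∂(stdGauss σ) := by
            rw [lintegral_indicator_const hBm]
        _ ≤ _ := lintegral_mono fun x => ?_
      by_cases hx : x ∈ Bd
      · rw [Set.indicator_of_mem hx]
        exact lintegral_bilinear_large_ge (fun a => eval x (t a))
          (fun a i => eval x (pderiv i (t a))) hε hx
      · rw [Set.indicator_of_notMem hx]
        exact zero_le
    · exact (measurable_measure_prodMk_right hSm).aemeasurable
  have h := hlow.trans hup
  have h162 : ENNReal.ofReal 162 * ENNReal.ofReal (1 / 162) = 1 := by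
    rw [← ENNReal.ofReal_mul (by norm_num)]; norm_num
  calc stdGauss σ Bd = ENNReal.ofReal 162 * (ENNReal.ofReal (1 / 162) * stdGauss σ Bd) := by
        rw [← mul_assoc, h162, one_mul]
    _ ≤ ENNReal.ofReal 162 * ENNReal.ofReal (24 * d ^ 2 * (2 * ε)) := by gcongr
    _ = ENNReal.ofReal (7776 * d ^ 2 * ε) := by
      rw [← ENNReal.ofReal_mul (by norm_num)]; congr 1; ring

/-- The squared norm of the `k`-th derivative tensor of a polynomial. -/
noncomputable def gradSq {σ : Type*} [Fintype σ] : ℕ → MvPolynomial σ ℝ → MvPolynomial σ ℝ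
  | 0, q => q ^ 2
  | k + 1, q => ∑ i, gradSq k (pderiv i q)

/-- Families are what make the induction close: the `(k+1)`-st derivative tensor of a family over
`ι` is the `k`-th one of the family of its partial derivatives over `ι × σ`. The constant does not
depend on the size of the family. -/
theorem stdGauss_gradSq_family_small_le {σ : Type} [Fintype σ] {d : ℕ} (hd : 0 < d) {ε : ℝ}
    (hε : 0 < ε) (k : ℕ) : ∀ {ι : Type} [Fintype ι] {t : ι → MvPolynomial σ ℝ}
    (_ : ∀ a, (t a).totalDegree ≤ d),
    stdGauss σ {x | ∑ a, eval x (gradSq k (t a)) < ε ^ 2 * ∑ a, eval x (gradSq (k + 1) (t a))}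
      ≤ ENNReal.ofReal (7776 * d ^ 2 * ε) := by
  induction k with
  | zero =>
    intro ι _ t ht
    have := stdGauss_sum_sq_small_le hd ht hε
    simpa only [gradSq, map_pow, map_sum] using this
  | succ k ih =>
    intro ι _ t ht
    have := ih (ι := ι × σ) (t := fun u => pderiv u.2 (t u.1)) fun u =>
      (totalDegree_pderiv_le _ _).trans ((Nat.sub_le _ _).trans (ht u.1))
    simp only [Fintype.sum_prod_type] at this
    have e : ∀ x k, ∑ a, eval x (gradSq (k + 1) (t a))
        = ∑ a, ∑ i, eval x (gradSq k (pderiv i (t a))) := fun x k => by simp only [gradSq, map_sum]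
    simpa only [e] using this

theorem stdGauss_gradSq_small_le {σ : Type} [Fintype σ] {d : ℕ} (hd : 0 < d) {ε : ℝ}
    (hε : 0 < ε) (k : ℕ) {q : MvPolynomial σ ℝ} (hq : q.totalDegree ≤ d) :
    stdGauss σ {x | eval x (gradSq k q) < ε ^ 2 * eval x (gradSq (k + 1) q)}
      ≤ ENNReal.ofReal (7776 * d ^ 2 * ε) := by
  have := stdGauss_gradSq_family_small_le hd hε k (ι := Unit) (t := fun _ => q) fun _ => hq
  simpa using this

end Anticoncentration

/-! ### Concentration of derivative tensors around their means. -/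

section DerivativeMoments

open MvPolynomial

theorem totalDegree_pderiv_le_of_le {σ : Type*} {d : ℕ} {q : MvPolynomial σ ℝ} (hq : q.totalDegree ≤ d)
    (i : σ) : (pderiv i q).totalDegree ≤ d :=
  (totalDegree_pderiv_le i q).trans ((Nat.sub_le _ _).trans hq)

theorem totalDegree_sub_C_le {σ : Type*} {d : ℕ} {q : MvPolynomial σ ℝ} (hq : q.totalDegree ≤ d) (a : ℝ) :
    (q - C a).totalDegree ≤ d :=
  (totalDegree_sub _ _).trans (max_le hq (by simp))

variable {σ : Type*} [Fintype σ]

/-- The squared distance of the `k`-th derivative tensor of a polynomial to its Gaussian mean. -/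
noncomputable def devSq : ℕ → MvPolynomial σ ℝ → MvPolynomial σ ℝ
  | 0, q => (q - C (gaussE σ q)) ^ 2
  | k + 1, q => ∑ i, devSq k (pderiv i q)

theorem eval_gradSq_nonneg (k : ℕ) (q : MvPolynomial σ ℝ) (x : σ → ℝ) :
    0 ≤ eval x (gradSq k q) := by
  induction k generalizing q with
  | zero => simp only [gradSq, map_pow]; positivity
  | succ k ih => rw [gradSq, map_sum]; exact Finset.sum_nonneg fun i _ => ih _

theorem eval_devSq_nonneg (k : ℕ) (q : MvPolynomial σ ℝ) (x : σ → ℝ) :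
    0 ≤ eval x (devSq k q) := by
  induction k generalizing q with
  | zero => simp only [devSq, map_pow]; positivity
  | succ k ih => rw [devSq, map_sum]; exact Finset.sum_nonneg fun i _ => ih _

theorem totalDegree_gradSq_le {d : ℕ} (k : ℕ) {q : MvPolynomial σ ℝ} (hq : q.totalDegree ≤ d) :
    (gradSq k q).totalDegree ≤ 2 * d := by
  induction k generalizing q with
  | zero => exact (totalDegree_pow _ _).trans (Nat.mul_le_mul_left _ hq)
  | succ k ih => exact totalDegree_finsetSum_le fun i _ => ih (totalDegree_pderiv_le_of_le hq i)

theorem totalDegree_devSq_le {d : ℕ} (k : ℕ) {q : MvPolynomial σ ℝ} (hq : q.totalDegree ≤ d) :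
    (devSq k q).totalDegree ≤ 2 * d := by
  induction k generalizing q with
  | zero =>
    have h := totalDegree_sub_C_le hq (gaussE σ q)
    refine (totalDegree_pow (q - C (gaussE σ q)) 2).trans ?_
    omega
  | succ k ih => exact totalDegree_finsetSum_le fun i _ => ih (totalDegree_pderiv_le_of_le hq i)

theorem meanDerivSq_eq_zero {d k : ℕ} {q : MvPolynomial σ ℝ} (hq : q.totalDegree ≤ d)
    (hk : d < k) : meanDerivSq k q = 0 := by
  obtain ⟨f, hf⟩ := exists_chaosDecomp hq
  rw [hf.meanDerivSq_eq, hf.eq_zero k hk]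
  simp

theorem gaussE_gradSq {d : ℕ} (k : ℕ) {q : MvPolynomial σ ℝ} (hq : q.totalDegree ≤ d) :
    gaussE σ (gradSq k q) = ∑ j ∈ Finset.range (d + 1), meanDerivSq (k + j) q / j.factorial := by
  induction k generalizing q with
  | zero => simpa [gradSq] using gaussE_sq_eq_sum_meanDerivSq hq
  | succ k ih =>
    rw [gradSq, map_sum, Finset.sum_congr rfl fun i _ => ih (totalDegree_pderiv_le_of_le hq i),
      Finset.sum_comm]
    refine Finset.sum_congr rfl fun j _ => ?_
    rw [← Finset.sum_div, show k + 1 + j = k + j + 1 by ring]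
    rfl

theorem gaussE_devSq (k : ℕ) (q : MvPolynomial σ ℝ) :
    gaussE σ (devSq k q) = gaussE σ (gradSq k q) - meanDerivSq k q := by
  induction k generalizing q with
  | zero =>
    rw [devSq, gradSq, meanDerivSq, show (q - C (gaussE σ q)) ^ 2 =
      q ^ 2 - C (2 * gaussE σ q) * q + C (gaussE σ q ^ 2) by
        rw [C_mul, C_pow, show (C 2 : MvPolynomial σ ℝ) = 2 from map_ofNat C 2]; ring,
      map_add, map_sub, gaussE_C_mul, gaussE_C]
    ring
  | succ k ih =>
    rw [devSq, gradSq, meanDerivSq, map_sum, map_sum, ← Finset.sum_sub_distrib]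
    exact Finset.sum_congr rfl fun i _ => ih _

theorem gaussE_devSq_nonneg (k : ℕ) (q : MvPolynomial σ ℝ) : 0 ≤ gaussE σ (devSq k q) :=
  gaussE_nonneg (eval_devSq_nonneg k q)

/-- Removing the mean deletes the zeroth term of Parseval's identity. What remains are at most `d`
nonzero mean tensors of higher order, with weights `1/j!`. -/
theorem gaussE_devSq_le {d k : ℕ} {q : MvPolynomial σ ℝ} (hq : q.totalDegree ≤ d) {b : ℝ}
    (hb : ∀ j, k < j → meanDerivSq j q ≤ b) : gaussE σ (devSq k q) ≤ d * b := by
  rw [gaussE_devSq, gaussE_gradSq k hq, Finset.sum_range_succ']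
  simp only [add_zero, Nat.factorial_zero, Nat.cast_one, div_one, add_sub_cancel_right]
  refine (Finset.sum_le_card_nsmul _ _ b fun j _ => ?_).trans (by simp)
  refine (div_le_self (meanDerivSq_nonneg _ _) ?_).trans (hb _ (by omega))
  exact_mod_cast Nat.one_le_iff_ne_zero.2 (Nat.factorial_ne_zero _)

/-- For a tensor `a` with mean `m`, the left side is the square of `|a|² - |m|² - |a - m|² = 2⟨m, a
- m⟩`, and the bound is Cauchy-Schwarz. -/
theorem sq_gradSq_sub_le (k : ℕ) (q : MvPolynomial σ ℝ) (x : σ → ℝ) :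
    (eval x (gradSq k q) - meanDerivSq k q - eval x (devSq k q)) ^ 2
      ≤ (4 * meanDerivSq k q) * eval x (devSq k q) := by
  induction k generalizing q with
  | zero =>
    simp only [gradSq, devSq, meanDerivSq, map_pow, map_sub, eval_C]
    exact le_of_eq (by ring)
  | succ k ih =>
    simp only [gradSq, devSq, meanDerivSq, map_sum]
    rw [Finset.mul_sum _ _ (4 : ℝ), ← Finset.sum_sub_distrib, ← Finset.sum_sub_distrib]
    refine Finset.sum_sq_le_sum_mul_sum_of_sq_le_mul _
      (fun i _ => by have := meanDerivSq_nonneg k (pderiv i q); positivity)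
      (fun i _ => eval_devSq_nonneg k _ x) fun i _ => ih _

theorem eval_gradSq_le (k : ℕ) (q : MvPolynomial σ ℝ) (x : σ → ℝ) :
    eval x (gradSq k q) ≤ 2 * meanDerivSq k q + 2 * eval x (devSq k q) := by
  have h1 := sq_gradSq_sub_le k q x
  have h2 := meanDerivSq_nonneg k q
  have h3 := eval_devSq_nonneg k q x
  have h4 := abs_le_of_sq_le_sq' (h1.trans
    (by nlinarith [sq_nonneg (meanDerivSq k q - eval x (devSq k q))] :
      _ ≤ (meanDerivSq k q + eval x (devSq k q)) ^ 2)) (by positivity)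
  linarith [h4.2]

theorem sq_gradSq_sub_mean_le (k : ℕ) (q : MvPolynomial σ ℝ) (x : σ → ℝ) :
    (eval x (gradSq k q) - meanDerivSq k q) ^ 2
      ≤ 8 * meanDerivSq k q * eval x (devSq k q) + 2 * eval x (devSq k q) ^ 2 := by
  have h1 := sq_gradSq_sub_le k q x
  nlinarith [sq_nonneg (eval x (gradSq k q) - meanDerivSq k q - 2 * eval x (devSq k q))]

/-- Hypercontractivity controls each entry of the tensor, and Cauchy-Schwarz on the cross terms adds
the `L²` norms. Differentiation does not raise the degree, so the factor does not depend on `k`. -/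
theorem gaussE_devSq_sq_le {d : ℕ} (k : ℕ) {q : MvPolynomial σ ℝ} (hq : q.totalDegree ≤ d) :
    gaussE σ (devSq k q ^ 2) ≤ (3 ^ d * gaussE σ (devSq k q)) ^ 2 := by
  induction k generalizing q with
  | zero =>
    have h := gaussE_pow_four_le (totalDegree_sub_C_le hq (gaussE σ q))
    rw [devSq, ← pow_mul]
    refine h.trans (le_of_eq ?_)
    rw [mul_pow, ← pow_mul, mul_comm d 2, pow_mul]; norm_num
  | succ k ih =>
    rw [devSq, sq, Finset.sum_mul_sum, map_sum, map_sum, Finset.mul_sum, sq, Finset.sum_mul_sum]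
    refine Finset.sum_le_sum fun i _ => ?_
    rw [map_sum]
    refine Finset.sum_le_sum fun j _ => ?_
    have hi := ih (totalDegree_pderiv_le_of_le hq i)
    have hj := ih (totalDegree_pderiv_le_of_le hq j)
    have h0i := gaussE_devSq_nonneg k (pderiv i q)
    have h0j := gaussE_devSq_nonneg k (pderiv j q)
    refine (abs_le_of_sq_le_sq' ((gaussE_mul_sq_le _ _).trans ?_) (by positivity)).2
    rw [mul_pow]
    exact mul_le_mul hi hj (gaussE_sq_nonneg _) (by positivity)

theorem gaussE_devSq_pow_four_le {d : ℕ} (k : ℕ) {q : MvPolynomial σ ℝ} (hq : q.totalDegree ≤ d) :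
    gaussE σ (devSq k q ^ 4) ≤ 9 ^ (4 * d) * gaussE σ (devSq k q) ^ 4 := by
  refine (gaussE_pow_four_le (totalDegree_devSq_le k hq)).trans ?_
  have h := gaussE_devSq_sq_le k hq
  calc (9 : ℝ) ^ (2 * d) * gaussE σ (devSq k q ^ 2) ^ 2
      ≤ 9 ^ (2 * d) * ((3 ^ d * gaussE σ (devSq k q)) ^ 2) ^ 2 := by
        have := gaussE_sq_nonneg (devSq k q); gcongr
    _ = 9 ^ (4 * d) * gaussE σ (devSq k q) ^ 4 := by
      have : (3 : ℝ) ^ d * 3 ^ d = 9 ^ d := by rw [← mul_pow]; norm_num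
      rw [show 2 * d = d + d by ring, show 4 * d = d + d + d + d by ring]
      simp only [pow_add, ← this]
      ring

/-- The relative fluctuation of the squared norm of the `k`-th derivative. -/
noncomputable def relDev (k : ℕ) (q : MvPolynomial σ ℝ) : MvPolynomial σ ℝ :=
  C (meanDerivSq k q)⁻¹ * (gradSq k q - C (meanDerivSq k q))

theorem totalDegree_relDev_le {d : ℕ} (k : ℕ) {q : MvPolynomial σ ℝ} (hq : q.totalDegree ≤ d) :
    (relDev k q).totalDegree ≤ 2 * d := by
  rw [relDev, C_mul']
  have h := totalDegree_sub_C_le (totalDegree_gradSq_le k hq) (meanDerivSq k q)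
  exact (totalDegree_smul_le _ _).trans h

theorem natCast_le_nine_pow (d : ℕ) : (d : ℝ) ≤ 9 ^ d := by
  exact_mod_cast (Nat.lt_pow_self (by norm_num : 1 < 9)).le

theorem gaussE_relDev_sq_le {d k : ℕ} (hd : 0 < d) {q : MvPolynomial σ ℝ} (hq : q.totalDegree ≤ d)
    {θ : ℝ} (hθ : 0 ≤ θ) (hθd : d * θ ≤ 1)
    (hdecay : ∀ j, k < j → meanDerivSq j q ≤ θ * meanDerivSq k q) :
    gaussE σ (relDev k q ^ 2) ≤ 9 ^ (4 * d) * θ := by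
  set c := meanDerivSq k q with hc
  have hc0 : 0 ≤ c := meanDerivSq_nonneg k q
  -- When the mean vanishes, `0⁻¹ = 0` makes `relDev` the zero polynomial.
  rcases hc0.eq_or_lt with h0 | hcpos
  · rw [relDev, ← hc, ← h0]
    simp only [inv_zero, map_zero, zero_mul, ne_eq, OfNat.ofNat_ne_zero, not_false_eq_true, zero_pow]
    positivity
  set v := gaussE σ (devSq k q) with hv
  have hv0 : 0 ≤ v := gaussE_devSq_nonneg k q
  have hvle : v ≤ d * (θ * c) := gaussE_devSq_le hq hdecay
  have h1 : gaussE σ (relDev k q ^ 2) ≤ (c⁻¹) ^ 2 * (8 * c * v + 2 * (3 ^ d * v) ^ 2) := by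
    have h2 : gaussE σ (relDev k q ^ 2) ≤
        gaussE σ (C ((c⁻¹) ^ 2) * (C (8 * c) * devSq k q + C 2 * devSq k q ^ 2)) := by
      refine gaussE_mono fun x => ?_
      simp only [relDev, map_pow, map_mul, map_sub, eval_C, map_add, mul_pow, ← hc]
      exact mul_le_mul_of_nonneg_left (sq_gradSq_sub_mean_le k q x) (by positivity)
    rw [gaussE_C_mul, map_add, gaussE_C_mul, gaussE_C_mul] at h2
    refine h2.trans ?_
    have := gaussE_devSq_sq_le k hq
    gcongr
  have h9 : (3 : ℝ) ^ d * 3 ^ d = 9 ^ d := by rw [← mul_pow]; norm_num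
  have hd9 := natCast_le_nine_pow d
  have h91 : (1 : ℝ) ≤ 9 ^ d := one_le_pow₀ (by norm_num)
  have h99 : (9 : ℝ) ≤ 9 ^ d := le_self_pow₀ (by norm_num) hd.ne'
  set s : ℝ := d * θ with hs
  have hs0 : 0 ≤ s := by positivity
  have hvs : v ≤ s * c := hvle.trans (le_of_eq (by rw [hs]; ring))
  calc gaussE σ (relDev k q ^ 2) ≤ (c⁻¹) ^ 2 * (8 * c * v + 2 * (3 ^ d * v) ^ 2) := h1
    _ ≤ (c⁻¹) ^ 2 * (8 * c * (s * c) + 2 * (3 ^ d * (s * c)) ^ 2) := by gcongr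
    _ = 8 * s + 2 * 9 ^ d * (s * s) := by rw [← h9]; field_simp
    _ ≤ 8 * s + 2 * 9 ^ d * (1 * s) := by gcongr
    _ = (8 + 2 * 9 ^ d) * s := by ring
    _ ≤ 9 ^ d * 9 ^ d * 9 ^ d * s := by
      refine mul_le_mul_of_nonneg_right ?_ hs0
      nlinarith [mul_le_mul h99 h99 (by norm_num) (by positivity)]
    _ ≤ 9 ^ d * 9 ^ d * 9 ^ d * (9 ^ d * θ) := by rw [hs]; gcongr
    _ = 9 ^ (4 * d) * θ := by rw [show 4 * d = d + d + d + d by ring]; simp only [pow_add]; ring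

/-- The second moment is of order `θ`, so by hypercontractivity the eighth is of order `θ⁴` and the
sixty-fourth is even smaller. The eighth moment pays for Taylor remainders at small fluctuations,
the sixty-fourth for crude polynomial growth at large ones. -/
theorem gaussE_relDev_pow_le {d k : ℕ} (hd : 0 < d) {q : MvPolynomial σ ℝ}
    (hq : q.totalDegree ≤ d) {θ : ℝ} (hθ : 0 ≤ θ) (hθd : d * θ ≤ 1)
    (hdecay : ∀ j, k < j → meanDerivSq j q ≤ θ * meanDerivSq k q) :
    gaussE σ (relDev k q ^ 8) ≤ 9 ^ (448 * d) * θ ^ 4 ∧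
      gaussE σ (relDev k q ^ 64) ≤ 9 ^ (448 * d) * θ ^ 4 := by
  have h1 := gaussE_relDev_sq_le hd hq hθ hθd hdecay
  have h0 := gaussE_sq_nonneg (relDev k q)
  have hθ1 : θ ≤ 1 := by
    have : (1 : ℝ) ≤ d := by exact_mod_cast hd
    nlinarith
  have hdeg := totalDegree_relDev_le k hq
  constructor
  · have h2 := gaussE_pow_two_pow_le 2 hdeg
    norm_num at h2
    calc gaussE σ (relDev k q ^ 8) ≤ 9 ^ (2 * d * 8) * gaussE σ (relDev k q ^ 2) ^ 4 := h2
      _ ≤ 9 ^ (2 * d * 8) * (9 ^ (4 * d) * θ) ^ 4 := by gcongr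
      _ = 9 ^ (32 * d) * θ ^ 4 := by
        rw [mul_pow, ← pow_mul, ← mul_assoc, ← pow_add]; congr 2; ring
      _ ≤ 9 ^ (448 * d) * θ ^ 4 := by
        gcongr
        · norm_num
        · norm_num
  · have h2 := gaussE_pow_two_pow_le 5 hdeg
    norm_num at h2
    calc gaussE σ (relDev k q ^ 64) ≤ 9 ^ (2 * d * 160) * gaussE σ (relDev k q ^ 2) ^ 32 := h2
      _ ≤ 9 ^ (2 * d * 160) * (9 ^ (4 * d) * θ) ^ 32 := by gcongr
      _ = 9 ^ (448 * d) * θ ^ 32 := by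
        rw [mul_pow, ← pow_mul, ← mul_assoc, ← pow_add]; congr 2; ring
      _ ≤ 9 ^ (448 * d) * θ ^ 4 :=
        mul_le_mul_of_nonneg_left (pow_le_pow_of_le_one hθ hθ1 (by norm_num)) (by positivity)

end DerivativeMoments

/-! ### The smooth cutoff and its approximation by polynomials in the fluctuations. -/

section SmoothCutoff

/-- A smooth cutoff, equal to `1` on `(-∞, 1/4]` and to `0` on `[1/2, ∞)`. -/
noncomputable def smoothCutoff (x : ℝ) : ℝ := Real.smoothTransition (2 - 4 * x)

theorem smoothCutoff_nonneg (x : ℝ) : 0 ≤ smoothCutoff x := Real.smoothTransition.nonneg _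

theorem smoothCutoff_le_one (x : ℝ) : smoothCutoff x ≤ 1 := Real.smoothTransition.le_one _

theorem smoothCutoff_eq_one {x : ℝ} (h : x ≤ 1 / 4) : smoothCutoff x = 1 :=
  Real.smoothTransition.one_of_one_le (by linarith)

theorem smoothCutoff_eq_zero {x : ℝ} (h : 1 / 2 ≤ x) : smoothCutoff x = 0 :=
  Real.smoothTransition.zero_of_nonpos (by linarith)

theorem contDiff_smoothCutoff {n : ℕ∞} : ContDiff ℝ n smoothCutoff :=
  Real.smoothTransition.contDiff.comp (by fun_prop)

theorem exists_bound_iteratedDeriv_smoothCutoff (j : ℕ) :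
    ∃ K, ∀ x, |iteratedDeriv j smoothCutoff x| ≤ K := by
  have hcont : Continuous (iteratedDeriv j smoothCutoff) :=
    (contDiff_smoothCutoff (n := j)).continuous_iteratedDeriv j le_rfl
  obtain ⟨K, hK⟩ := (isCompact_Icc (a := (0 : ℝ)) (b := 1)).exists_bound_of_continuousOn
    hcont.continuousOn
  have hconst : ∀ (c x : ℝ), |c| ≤ 1 → smoothCutoff =ᶠ[nhds x] (fun _ => c) →
      |iteratedDeriv j smoothCutoff x| ≤ 1 := by
    intro c x hc h
    rw [h.iteratedDeriv_eq j, iteratedDeriv_const]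
    split_ifs
    · exact hc
    · simp
  refine ⟨max K 1, fun x => ?_⟩
  rcases lt_or_ge x 0 with h | h
  · refine (hconst 1 x (by simp) ?_).trans (le_max_right _ _)
    filter_upwards [Iio_mem_nhds h] with y hy
    exact smoothCutoff_eq_one (by have : y < 0 := hy; linarith)
  rcases lt_or_ge 1 x with h' | h'
  · refine (hconst 0 x (by simp) ?_).trans (le_max_right _ _)
    filter_upwards [Ioi_mem_nhds h'] with y hy
    exact smoothCutoff_eq_zero (by have : 1 < y := hy; linarith)
  · exact (hK x ⟨h, h'⟩).trans (le_max_left _ _)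

theorem smoothCutoff_taylor {n : ℕ} {K : ℝ} (hK : ∀ x, |iteratedDeriv (n + 1) smoothCutoff x| ≤ K)
    (a x : ℝ) : |smoothCutoff x - ∑ j ∈ Finset.range (n + 1),
      iteratedDeriv j smoothCutoff a / j.factorial * (x - a) ^ j| ≤ K * |x - a| ^ (n + 1) := by
  rcases eq_or_ne a x with rfl | hne
  · rw [Finset.sum_range_succ']
    simp
  have hcd : ContDiff ℝ (n + 1 : ℕ) smoothCutoff := contDiff_smoothCutoff (n := (n + 1 : ℕ))
  obtain ⟨y, -, hy⟩ := taylor_mean_remainder_lagrange_iteratedDeriv (n := n) hne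
    (hcd.contDiffOn (s := Set.uIcc a x))
  rw [taylor_within_apply] at hy
  have hsum : ∑ k ∈ Finset.range (n + 1), ((k.factorial : ℝ)⁻¹ * (x - a) ^ k) •
      iteratedDerivWithin k smoothCutoff (Set.uIcc a x) a =
      ∑ j ∈ Finset.range (n + 1), iteratedDeriv j smoothCutoff a / j.factorial * (x - a) ^ j := by
    refine Finset.sum_congr rfl fun k _ => ?_
    rw [iteratedDerivWithin_eq_iteratedDeriv (uniqueDiffOn_uIcc hne)
      (contDiff_smoothCutoff (n := (k : ℕ∞))).contDiffAt Set.left_mem_uIcc, smul_eq_mul]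
    ring
  rw [← hsum, hy, abs_div, abs_mul, abs_pow, Nat.abs_cast]
  have h1 : (1 : ℝ) ≤ (n + 1).factorial := by
    exact_mod_cast Nat.one_le_iff_ne_zero.2 (Nat.factorial_ne_zero _)
  refine (div_le_self (by positivity) h1).trans ?_
  exact mul_le_mul_of_nonneg_right (hK y) (by positivity)

/-- The constant is uniform in the base point because the cutoff is locally constant outside `[0,
1]`. -/
theorem exists_smoothCutoff_taylor_bound :
    ∃ K : ℝ, 1 ≤ K ∧ (∀ x y, |smoothCutoff x - smoothCutoff y| ≤ K * |x - y|) ∧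
      ∀ a, ∃ c : ℕ → ℝ, (∀ j ∈ Finset.range 8, |c j| ≤ K) ∧
        ∀ x, |smoothCutoff x - ∑ j ∈ Finset.range 8, c j * (x - a) ^ j| ≤ K * |x - a| ^ 8 := by
  choose b hb using exists_bound_iteratedDeriv_smoothCutoff
  set K : ℝ := 1 + ∑ j ∈ Finset.range 9, |b j| with hK
  have hbK : ∀ j ∈ Finset.range 9, |b j| ≤ K := fun j hj => by
    have := Finset.single_le_sum (f := fun j => |b j|) (fun i _ => abs_nonneg _) hj
    linarith
  have hdK : ∀ j ∈ Finset.range 9, ∀ x, |iteratedDeriv j smoothCutoff x| ≤ K := fun j hj x =>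
    (hb j x).trans ((le_abs_self _).trans (hbK j hj))
  refine ⟨K, ?_, fun x y => ?_, fun a => ⟨fun j => iteratedDeriv j smoothCutoff a / j.factorial,
    fun j hj => ?_, smoothCutoff_taylor (n := 7) (hdK 8 (by simp)) a⟩⟩
  · have : 0 ≤ ∑ j ∈ Finset.range 9, |b j| := Finset.sum_nonneg fun _ _ => abs_nonneg _
    linarith
  · have := smoothCutoff_taylor (n := 0) (hdK 1 (by simp)) y x
    simpa using this
  · rw [abs_div, Nat.abs_cast]
    have h1 : (1 : ℝ) ≤ j.factorial := by
      exact_mod_cast Nat.one_le_iff_ne_zero.2 (Nat.factorial_ne_zero _)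
    have hj' : j < 8 := Finset.mem_range.1 hj
    exact (div_le_self (abs_nonneg _) h1).trans (hdK j (Finset.mem_range.2 (by omega)) a)

/-- The expansion to seventh order of `α (1 + u') / (1 + v)` with `v = (1 - α) u + α u'`. -/
noncomputable def ratioApprox (α u u' : ℝ) : ℝ :=
  α * (1 + u') * ∑ j ∈ Finset.range 8, (-((1 - α) * u + α * u')) ^ j

theorem abs_convex_comb_le {α u u' m : ℝ} (hα0 : 0 ≤ α) (hα1 : α ≤ 1) (hu : |u| ≤ m)
    (hu' : |u'| ≤ m) : |(1 - α) * u + α * u'| ≤ m := by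
  rw [abs_le] at *
  constructor <;> nlinarith

/-- The truncated geometric series misses `1/(1 + v)` by `v⁸/(1 + v)`, and `m ≤ 1/2` keeps `1 + v`
away from zero. The second bound holds because at zero fluctuation the ratio is `α`. -/
theorem ratioApprox_bounds {α u u' m : ℝ} (hα0 : 0 ≤ α) (hα1 : α ≤ 1) (hu : |u| ≤ m)
    (hu' : |u'| ≤ m) (hm : m ≤ 1 / 2) :
    |α * (1 + u') / (1 + ((1 - α) * u + α * u')) - ratioApprox α u u'| ≤ 3 * m ^ 8 ∧
      |ratioApprox α u u' - α| ≤ 7 * m := by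
  set v := (1 - α) * u + α * u' with hv
  have hm0 : 0 ≤ m := (abs_nonneg _).trans hu
  have hvm : |v| ≤ m := abs_convex_comb_le hα0 hα1 hu hu'
  have hv2 := abs_le.1 hvm
  have hu2 := abs_le.1 hu'
  have hpos : 1 / 2 ≤ 1 + v := by linarith
  have hpos' : 0 < 1 + v := by linarith
  have hgeom : (∑ j ∈ Finset.range 8, (-v) ^ j) * (1 + v) = 1 - v ^ 8 := by
    simp only [Finset.sum_range_succ, Finset.sum_range_zero]
    ring
  have hA : |α * (1 + u')| ≤ 3 / 2 := by
    rw [abs_of_nonneg (by nlinarith)]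
    nlinarith
  have e1 : α * (1 + u') / (1 + v) - ratioApprox α u u' = α * (1 + u') * (v ^ 8 / (1 + v)) := by
    rw [ratioApprox, ← hv]
    have : ∑ j ∈ Finset.range 8, (-v) ^ j = (1 - v ^ 8) / (1 + v) := by
      rw [eq_div_iff hpos'.ne', hgeom]
    rw [this]
    field_simp
    ring
  have h1 : |α * (1 + u') / (1 + v) - ratioApprox α u u'| ≤ 3 * m ^ 8 := by
    rw [e1, abs_mul, abs_div, abs_pow, abs_of_pos hpos']
    calc |α * (1 + u')| * (|v| ^ 8 / (1 + v)) ≤ 3 / 2 * (m ^ 8 / (1 / 2)) := by gcongr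
      _ = 3 * m ^ 8 := by ring
  refine ⟨h1, ?_⟩
  have e2 : α * (1 + u') / (1 + v) - α = α * (u' - v) / (1 + v) := by field_simp; ring
  have h2 : |α * (1 + u') / (1 + v) - α| ≤ 4 * m := by
    rw [e2, abs_div, abs_mul, abs_of_pos hpos', abs_of_nonneg hα0]
    have h3 : |u' - v| ≤ 2 * m := (abs_sub _ _).trans (by linarith)
    calc α * |u' - v| / (1 + v) ≤ 1 * (2 * m) / (1 / 2) := by gcongr
      _ = 4 * m := by ring
  have h4 : m ^ 8 ≤ m := by
    have := pow_le_pow_of_le_one hm0 (by linarith) (show 1 ≤ 8 by norm_num)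
    simpa using this
  have h5 : |ratioApprox α u u' - α| ≤
      |α * (1 + u') / (1 + v) - ratioApprox α u u'| + |α * (1 + u') / (1 + v) - α| := by
    rw [abs_sub_comm (α * (1 + u') / (1 + v)) (ratioApprox α u u')]
    exact abs_sub_le _ _ _
  linarith

/-- For large fluctuations the series need not approximate the ratio; only its growth as a
polynomial of degree eight is used. -/
theorem ratioApprox_crude_bound {α u u' m : ℝ} (hα0 : 0 ≤ α) (hα1 : α ≤ 1) (hu : |u| ≤ m)
    (hu' : |u'| ≤ m) (hm : 1 ≤ m) : |ratioApprox α u u' - α| ≤ 17 * m ^ 8 := by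
  set v := (1 - α) * u + α * u' with hv
  have hvm : |v| ≤ m := abs_convex_comb_le hα0 hα1 hu hu'
  have h1 : |∑ j ∈ Finset.range 8, (-v) ^ j| ≤ 8 * m ^ 7 := by
    refine (Finset.abs_sum_le_sum_abs _ _).trans ?_
    refine (Finset.sum_le_card_nsmul _ _ (m ^ 7) fun j hj => ?_).trans (by simp)
    rw [abs_pow, abs_neg]
    have hj' : j ≤ 7 := by have := Finset.mem_range.1 hj; omega
    exact (pow_le_pow_left₀ (abs_nonneg _) hvm j).trans (pow_le_pow_right₀ hm hj')
  have h2 : |α * (1 + u')| ≤ 2 * m := by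
    rw [abs_mul, abs_of_nonneg hα0]
    have : |1 + u'| ≤ 2 * m := (abs_add_le _ _).trans (by rw [abs_one]; linarith)
    calc α * |1 + u'| ≤ 1 * (2 * m) := by gcongr
      _ = 2 * m := one_mul _
  have h3 : |ratioApprox α u u'| ≤ 16 * m ^ 8 := by
    rw [ratioApprox, ← hv, abs_mul]
    calc |α * (1 + u')| * |∑ j ∈ Finset.range 8, (-v) ^ j| ≤ 2 * m * (8 * m ^ 7) := by gcongr
      _ = 16 * m ^ 8 := by ring
  have h4 : (1 : ℝ) ≤ m ^ 8 := one_le_pow₀ hm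
  refine (abs_sub _ _).trans ?_
  rw [abs_of_nonneg hα0]
  linarith

/-- Polynomial approximation of a smooth function of ratios with small relative fluctuations. -/
theorem smoothCutoff_approx {K : ℝ} (hK1 : 1 ≤ K)
    (hlip : ∀ x y, |smoothCutoff x - smoothCutoff y| ≤ K * |x - y|) {d : ℕ} (hd : 0 < d)
    {α u : ℕ → ℝ} (hα : ∀ l, 0 ≤ α l ∧ α l ≤ 1) {c : ℕ → ℝ}
    (hc : ∀ j ∈ Finset.range 8, |c j| ≤ K)
    (htaylor : ∀ x, |smoothCutoff x - ∑ j ∈ Finset.range 8,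
      c j * (x - ∑ l ∈ Finset.range d, α l) ^ j| ≤ K * |x - ∑ l ∈ Finset.range d, α l| ^ 8)
    {r : ℝ} (hr : |r| ≤ 1)
    (hgood : (∀ l ∈ Finset.range (d + 1), |u l| ≤ 1 / 2) → r = smoothCutoff
      (∑ l ∈ Finset.range d, α l * (1 + u (l + 1)) / (1 + ((1 - α l) * u l + α l * u (l + 1))))) :
    |r - ∑ j ∈ Finset.range 8, c j * (∑ l ∈ Finset.range d, ratioApprox (α l) (u l) (u (l + 1))
        - ∑ l ∈ Finset.range d, α l) ^ j|
      ≤ 9 ^ 40 * K * d ^ 8 * ∑ l ∈ Finset.range (d + 1), (u l ^ 8 + u l ^ 64) := by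
  obtain ⟨l₀, hl₀, hmax⟩ := Finset.exists_max_image (Finset.range (d + 1)) (fun l => |u l|)
    ⟨0, by simp⟩
  set m := |u l₀| with hm
  have hm0 : 0 ≤ m := abs_nonneg _
  have hd1 : (1 : ℝ) ≤ d := by exact_mod_cast hd
  have hul : ∀ l ∈ Finset.range d, |u l| ≤ m ∧ |u (l + 1)| ≤ m := fun l hl => by
    have hl' := Finset.mem_range.1 hl
    exact ⟨hmax l (Finset.mem_range.2 (by omega)), hmax (l + 1) (Finset.mem_range.2 (by omega))⟩
  have hsum : m ^ 8 + m ^ 64 ≤ ∑ l ∈ Finset.range (d + 1), (u l ^ 8 + u l ^ 64) := by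
    have := Finset.single_le_sum (f := fun l => u l ^ 8 + u l ^ 64)
      (fun l _ => by positivity) hl₀
    refine le_trans (le_of_eq ?_) this
    simp only [hm]
    rw [(show Even 8 by decide).pow_abs, (show Even 64 by decide).pow_abs]
  refine le_trans ?_ (mul_le_mul_of_nonneg_left hsum (by positivity))
  set S₀ := ∑ l ∈ Finset.range d, α l with hS₀
  set S₁ := ∑ l ∈ Finset.range d, ratioApprox (α l) (u l) (u (l + 1)) with hS₁
  have hd8 : (d : ℝ) ≤ d ^ 8 := le_self_pow₀ hd1 (by norm_num)
  rcases le_or_gt m (1 / 2) with hsmall | hlarge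
  · rw [hgood fun l hl => (hmax l hl).trans hsmall]
    set S := ∑ l ∈ Finset.range d,
      α l * (1 + u (l + 1)) / (1 + ((1 - α l) * u l + α l * u (l + 1))) with hS
    have h1 : |S - S₁| ≤ d * (3 * m ^ 8) := by
      rw [hS, hS₁, ← Finset.sum_sub_distrib]
      refine (Finset.abs_sum_le_sum_abs _ _).trans
        ((Finset.sum_le_card_nsmul _ _ (3 * m ^ 8) fun l hl => ?_).trans (by simp))
      exact (ratioApprox_bounds (hα l).1 (hα l).2 (hul l hl).1 (hul l hl).2 hsmall).1
    have h2 : |S₁ - S₀| ≤ d * (7 * m) := by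
      rw [hS₀, hS₁, ← Finset.sum_sub_distrib]
      refine (Finset.abs_sum_le_sum_abs _ _).trans
        ((Finset.sum_le_card_nsmul _ _ (7 * m) fun l hl => ?_).trans (by simp))
      exact (ratioApprox_bounds (hα l).1 (hα l).2 (hul l hl).1 (hul l hl).2 hsmall).2
    have h3 := hlip S S₁
    have h4 := htaylor S₁
    calc |smoothCutoff S - ∑ j ∈ Finset.range 8, c j * (S₁ - S₀) ^ j|
        ≤ |smoothCutoff S - smoothCutoff S₁| +
          |smoothCutoff S₁ - ∑ j ∈ Finset.range 8, c j * (S₁ - S₀) ^ j| := abs_sub_le _ _ _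
      _ ≤ K * (d * (3 * m ^ 8)) + K * (d * (7 * m)) ^ 8 := by
        refine add_le_add (h3.trans (by gcongr)) (h4.trans (by gcongr))
      _ = (3 * d + 7 ^ 8 * d ^ 8) * (K * m ^ 8) := by ring
      _ ≤ (9 ^ 40 * d ^ 8) * (K * m ^ 8) := by
        refine mul_le_mul_of_nonneg_right ?_ (by positivity)
        have : (0 : ℝ) ≤ d ^ 8 := by positivity
        linarith
      _ ≤ (9 ^ 40 * d ^ 8) * (K * (m ^ 8 + m ^ 64)) := by
        gcongr
        have : 0 ≤ m ^ 64 := by positivity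
        linarith
      _ = _ := by ring
  -- Doubling turns `m > 1/2` into `M ≥ 1`, so that powers of `M` are monotone in the exponent. The
  -- polynomial has size at most a multiple of `(M⁸)⁷`, and `M⁶⁴` dominates it together with `|r| ≤
  -- 1`.
  · set M := 2 * m with hM
    have hM1 : 1 ≤ M := by linarith
    have h2 : |S₁ - S₀| ≤ d * (17 * M ^ 8) := by
      rw [hS₀, hS₁, ← Finset.sum_sub_distrib]
      refine (Finset.abs_sum_le_sum_abs _ _).trans
        ((Finset.sum_le_card_nsmul _ _ (17 * M ^ 8) fun l hl => ?_).trans (by simp))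
      exact ratioApprox_crude_bound (hα l).1 (hα l).2 ((hul l hl).1.trans (by linarith))
        ((hul l hl).2.trans (by linarith)) hM1
    have hbase : 1 ≤ d * (17 * M ^ 8) := by
      have : 1 ≤ M ^ 8 := one_le_pow₀ hM1
      nlinarith
    have h3 : |∑ j ∈ Finset.range 8, c j * (S₁ - S₀) ^ j| ≤ 8 * (K * (d * (17 * M ^ 8)) ^ 7) := by
      refine (Finset.abs_sum_le_sum_abs _ _).trans
        ((Finset.sum_le_card_nsmul _ _ (K * (d * (17 * M ^ 8)) ^ 7) fun j hj => ?_).trans (by simp))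
      rw [abs_mul, abs_pow]
      have hj' : j ≤ 7 := by have := Finset.mem_range.1 hj; omega
      exact mul_le_mul (hc j hj) ((pow_le_pow_left₀ (abs_nonneg _) h2 j).trans
        (pow_le_pow_right₀ hbase hj')) (by positivity) (by linarith)
    have hd78 : (d : ℝ) ^ 7 ≤ d ^ 8 := pow_le_pow_right₀ hd1 (by norm_num)
    have hMM : M ^ 56 ≤ M ^ 64 := pow_le_pow_right₀ hM1 (by norm_num)
    have hX : 1 ≤ d ^ 8 * (K * M ^ 64) := by
      have e1 : (1 : ℝ) ≤ d ^ 8 := one_le_pow₀ hd1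
      have e2 : (1 : ℝ) ≤ K * M ^ 64 := one_le_mul_of_one_le_of_one_le hK1 (one_le_pow₀ hM1)
      exact one_le_mul_of_one_le_of_one_le e1 e2
    calc |r - ∑ j ∈ Finset.range 8, c j * (S₁ - S₀) ^ j|
        ≤ |r| + |∑ j ∈ Finset.range 8, c j * (S₁ - S₀) ^ j| := abs_sub _ _
      _ ≤ d ^ 8 * (K * M ^ 64) + 8 * (K * (d * (17 * M ^ 8)) ^ 7) := by
        exact add_le_add (hr.trans hX) h3
      _ = d ^ 8 * (K * M ^ 64) + 8 * 17 ^ 7 * (d ^ 7 * (K * M ^ 56)) := by ring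
      _ ≤ d ^ 8 * (K * M ^ 64) + 8 * 17 ^ 7 * (d ^ 8 * (K * M ^ 64)) := by gcongr
      _ = (1 + 8 * 17 ^ 7) * 2 ^ 64 * (K * d ^ 8 * m ^ 64) := by rw [hM]; ring
      _ ≤ 9 ^ 40 * (K * d ^ 8 * (m ^ 8 + m ^ 64)) := by
        have h8 : 0 ≤ m ^ 8 := by positivity
        have : K * d ^ 8 * m ^ 64 ≤ K * d ^ 8 * (m ^ 8 + m ^ 64) := by
          gcongr; linarith
        refine mul_le_mul (by norm_num) this (by positivity) (by positivity)
      _ = _ := by ring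

end SmoothCutoff

/-! ### Comparing laws through polynomial approximation. -/

section LocalComparison

open MvPolynomial

variable {σ : Type*} [Fintype σ]

/-- The weight of the `(l + 1)`-st derivative of `q` at `x`, relative to the `l`-th one. -/
noncomputable def gradRatio (κ : ℝ) (q : MvPolynomial σ ℝ) (l : ℕ) (x : σ → ℝ) : ℝ :=
  κ ^ 2 * eval x (gradSq (l + 1) q) / (eval x (gradSq l q) + κ ^ 2 * eval x (gradSq (l + 1) q))

/-- A smooth cutoff to the points where the derivatives of `q` grow slowly with their order. -/
noncomputable def gradCutoff (d : ℕ) (κ : ℝ) (q : MvPolynomial σ ℝ) (x : σ → ℝ) : ℝ :=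
  smoothCutoff (∑ l ∈ Finset.range d, gradRatio κ q l x)

theorem gradRatio_nonneg (κ : ℝ) (q : MvPolynomial σ ℝ) (l : ℕ) (x : σ → ℝ) :
    0 ≤ gradRatio κ q l x := by
  have h1 := eval_gradSq_nonneg l q x
  have h2 := eval_gradSq_nonneg (l + 1) q x
  rw [gradRatio]
  positivity

theorem measurable_gradCutoff (d : ℕ) (κ : ℝ) (q : MvPolynomial σ ℝ) :
    Measurable (gradCutoff d κ q) := by
  have h : Measurable smoothCutoff := (contDiff_smoothCutoff (n := 0)).continuous.measurable
  refine h.comp (Finset.measurable_sum _ fun l _ => ?_)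
  unfold gradRatio
  have h1 := measurable_eval_comp (gradSq l q) (measurable_id (α := σ → ℝ))
  have h2 := measurable_eval_comp (gradSq (l + 1) q) (measurable_id (α := σ → ℝ))
  exact (h2.const_mul _).div (h1.add (h2.const_mul _))

theorem abs_gradCutoff_le_one (d : ℕ) (κ : ℝ) (q : MvPolynomial σ ℝ) (x : σ → ℝ) :
    |gradCutoff d κ q x| ≤ 1 := by
  rw [gradCutoff, abs_of_nonneg (smoothCutoff_nonneg _)]
  exact smoothCutoff_le_one _

theorem integrable_of_abs_le_one {α : Type*} [MeasurableSpace α] {μ : Measure α}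
    [IsFiniteMeasure μ] {F : α → ℝ} (hF : Measurable F) (hF1 : ∀ x, |F x| ≤ 1) : Integrable F μ :=
  Integrable.of_bound hF.aestronglyMeasurable 1 (Filter.Eventually.of_forall hF1)

/-- Both the approximant and its error bound are polynomials of degree at most `k`, so their
`ν`-integrals are Gaussian expectations. -/
theorem MatchesGaussian.abs_integral_sub_gaussE_le {k : ℕ} {ν : Measure (σ → ℝ)}
    [IsProbabilityMeasure ν] (hν : MatchesGaussian k ν) {F : (σ → ℝ) → ℝ} (hF : Measurable F)
    (hF1 : ∀ x, |F x| ≤ 1) {A R : MvPolynomial σ ℝ} (hA : A.totalDegree ≤ k)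
    (hR : R.totalDegree ≤ k) (hle : ∀ᵐ x ∂ν, |F x - eval x A| ≤ eval x R) :
    |∫ x, F x ∂ν - gaussE σ A| ≤ gaussE σ R := by
  have hFi : Integrable F ν := integrable_of_abs_le_one hF hF1
  rw [← hν.integral_eq A hA, ← hν.integral_eq R hR, ← integral_sub hFi (hν.integrable A hA)]
  refine abs_integral_le_integral_abs.trans ?_
  exact integral_mono_ae (hFi.sub (hν.integrable A hA)).abs (hν.integrable R hR) hle

/-- Two measures with matching moments agree on functions that are close to polynomials. -/
theorem MatchesGaussian.abs_integral_sub_le {k : ℕ} {ν : Measure (σ → ℝ)}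
    [IsProbabilityMeasure ν] (hν : MatchesGaussian k ν) {F : (σ → ℝ) → ℝ} (hF : Measurable F)
    (hF1 : ∀ x, |F x| ≤ 1) {A R : MvPolynomial σ ℝ} (hA : A.totalDegree ≤ k)
    (hR : R.totalDegree ≤ k)
    (hle : ∀ (ν' : Measure (σ → ℝ)), MatchesGaussian k ν' →
      ∀ᵐ x ∂ν', |F x - eval x A| ≤ eval x R) :
    |∫ x, F x ∂ν - ∫ x, F x ∂(stdGauss σ)| ≤ 2 * gaussE σ R := by
  have h1 := hν.abs_integral_sub_gaussE_le hF hF1 hA hR (hle ν hν)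
  have h2 := (matchesGaussian_stdGauss k).abs_integral_sub_gaussE_le hF hF1 hA hR
    (hle _ (matchesGaussian_stdGauss k))
  rw [abs_sub_comm] at h2
  calc |∫ x, F x ∂ν - ∫ x, F x ∂(stdGauss σ)|
      ≤ |∫ x, F x ∂ν - gaussE σ A| + |gaussE σ A - ∫ x, F x ∂(stdGauss σ)| := abs_sub_le _ _ _
    _ ≤ 2 * gaussE σ R := by linarith

/-- The properties of the constant `1` and of `Real.sign` used in the comparison: the function is
bounded by one and not changed by a small relative perturbation. -/
structure IsSignLike (s : ℝ → ℝ) : Prop where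
  measurable : Measurable s
  abs_le_one : ∀ t, |s t| ≤ 1
  mul_eq : ∀ a w, |w| ≤ 1 / 2 → s (a * (1 + w)) = s a

theorem isSignLike_one : IsSignLike fun _ => 1 := ⟨measurable_const, by simp, by simp⟩

theorem isSignLike_sign : IsSignLike Real.sign := by
  refine ⟨?_, fun t => ?_, fun a w hw => ?_⟩
  · unfold Real.sign
    exact Measurable.ite measurableSet_Iio measurable_const
      (Measurable.ite measurableSet_Ioi measurable_const measurable_const)
  · rcases Real.sign_apply_eq t with h | h | h <;> simp [h]
  · have hpos : 0 < 1 + w := by have := (abs_le.1 hw).1; linarith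
    rcases lt_trichotomy a 0 with h | h | h
    · rw [Real.sign_of_neg h, Real.sign_of_neg (mul_neg_of_neg_of_pos h hpos)]
    · simp [h]
    · rw [Real.sign_of_pos h, Real.sign_of_pos (mul_pos h hpos)]

/-- Dividing by `c + κ²c'` isolates the ratio `α` of the means and leaves the relative fluctuations
in the form that `ratioApprox` expands. -/
theorem gradRatio_eq_of_relDev {κ c c' u u' : ℝ} (hκ : 0 < κ) (hc : 0 ≤ c) (hc' : 0 ≤ c') :
    κ ^ 2 * (c' * (1 + u')) / (c * (1 + u) + κ ^ 2 * (c' * (1 + u'))) =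
      κ ^ 2 * c' / (c + κ ^ 2 * c') * (1 + u') /
        (1 + ((1 - κ ^ 2 * c' / (c + κ ^ 2 * c')) * u + κ ^ 2 * c' / (c + κ ^ 2 * c') * u')) := by
  rcases (show 0 ≤ c + κ ^ 2 * c' by positivity).eq_or_lt with h0 | hpos
  · have h1 : c' = 0 := by
      by_contra hne
      have : 0 < κ ^ 2 * c' := by positivity
      linarith
    simp [h1]
  have h1 : 1 + ((1 - κ ^ 2 * c' / (c + κ ^ 2 * c')) * u + κ ^ 2 * c' / (c + κ ^ 2 * c') * u')
      = (c * (1 + u) + κ ^ 2 * (c' * (1 + u'))) / (c + κ ^ 2 * c') := by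
    field_simp
    ring
  rw [h1]
  field_simp

theorem ratio_mem_unit_interval {κ c c' : ℝ} (hc : 0 ≤ c) (hc' : 0 ≤ c') :
    0 ≤ κ ^ 2 * c' / (c + κ ^ 2 * c') ∧ κ ^ 2 * c' / (c + κ ^ 2 * c') ≤ 1 := by
  have : 0 ≤ κ ^ 2 * c' := by positivity
  exact ⟨by positivity, div_le_one_of_le₀ (by linarith) (by positivity)⟩

/-- The polynomial version of `ratioApprox`. -/
noncomputable def ratioApproxPoly {σ : Type*} (α : ℝ) (u u' : MvPolynomial σ ℝ) : MvPolynomial σ ℝ :=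
  C α * (1 + u') * ∑ j ∈ Finset.range 8, (-(C (1 - α) * u + C α * u')) ^ j

theorem eval_ratioApproxPoly {σ : Type*} (α : ℝ) (u u' : MvPolynomial σ ℝ) (x : σ → ℝ) :
    eval x (ratioApproxPoly α u u') = ratioApprox α (eval x u) (eval x u') := by
  simp only [ratioApproxPoly, ratioApprox, map_mul, map_add, map_sum, map_pow, map_neg, eval_C,
    map_one]

theorem totalDegree_C_mul_le {σ : Type*} (a : ℝ) {e : ℕ} {q : MvPolynomial σ ℝ}
    (hq : q.totalDegree ≤ e) : (C a * q).totalDegree ≤ e := by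
  rw [C_mul']
  exact (totalDegree_smul_le _ _).trans hq

theorem totalDegree_add_le_of_le {σ : Type*} {e : ℕ} {p q : MvPolynomial σ ℝ}
    (hp : p.totalDegree ≤ e) (hq : q.totalDegree ≤ e) : (p + q).totalDegree ≤ e :=
  (totalDegree_add _ _).trans (max_le hp hq)

theorem totalDegree_pow_le_of_le {σ : Type*} {e m k : ℕ} {p : MvPolynomial σ ℝ}
    (hp : p.totalDegree ≤ e) (h : m * e ≤ k) : (p ^ m).totalDegree ≤ k :=
  (totalDegree_pow _ _).trans ((Nat.mul_le_mul_left _ hp).trans h)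

theorem totalDegree_ratioApproxPoly_le {σ : Type*} {α : ℝ} {u u' : MvPolynomial σ ℝ} {e : ℕ}
    (hu : u.totalDegree ≤ e) (hu' : u'.totalDegree ≤ e) :
    (ratioApproxPoly α u u').totalDegree ≤ 8 * e := by
  have h1 : (C α * (1 + u')).totalDegree ≤ e :=
    totalDegree_C_mul_le _ (totalDegree_add_le_of_le (by simp) hu')
  have h2 : (-(C (1 - α) * u + C α * u')).totalDegree ≤ e := by
    rw [totalDegree_neg]
    exact totalDegree_add_le_of_le (totalDegree_C_mul_le _ hu) (totalDegree_C_mul_le _ hu')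
  have h3 : (∑ j ∈ Finset.range 8, (-(C (1 - α) * u + C α * u')) ^ j).totalDegree ≤ 7 * e :=
    totalDegree_finsetSum_le fun j hj => totalDegree_pow_le_of_le h2
      (Nat.mul_le_mul_right _ (by have := Finset.mem_range.1 hj; omega))
  refine (totalDegree_mul _ _).trans ?_
  omega

theorem MatchesGaussian.ae_eq_zero {k : ℕ} {ν : Measure (σ → ℝ)} (hν : MatchesGaussian k ν)
    {q : MvPolynomial σ ℝ} (hq : q.totalDegree ≤ k) (hpos : ∀ x, 0 ≤ eval x q)
    (h0 : gaussE σ q = 0) : ∀ᵐ x ∂ν, eval x q = 0 :=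
  (integral_eq_zero_iff_of_nonneg hpos (hν.integrable q hq)).1 ((hν.integral_eq q hq).trans h0)

/-- If the mean is nonzero this is algebra. If it vanishes, decay kills all higher means, so the
nonnegative polynomial `gradSq l q` has Gaussian expectation zero and hence vanishes `ν`-almost
everywhere. -/
theorem MatchesGaussian.ae_gradSq_eq {d k l : ℕ} (hk : 2 * d ≤ k) {ν : Measure (σ → ℝ)}
    (hν : MatchesGaussian k ν) {q : MvPolynomial σ ℝ} (hq : q.totalDegree ≤ d) {θ : ℝ}
    (hdecay : ∀ j, l < j → meanDerivSq j q ≤ θ * meanDerivSq l q) :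
    ∀ᵐ x ∂ν, eval x (gradSq l q) = meanDerivSq l q * (1 + eval x (relDev l q)) := by
  by_cases hc : meanDerivSq l q = 0
  · have h1 := gaussE_devSq_le hq hdecay
    have h2 := gaussE_devSq l q
    have h3 := gaussE_devSq_nonneg l q
    rw [hc] at h1 h2
    have h4 : gaussE σ (gradSq l q) = 0 := by
      rw [mul_zero, mul_zero] at h1
      linarith
    filter_upwards [hν.ae_eq_zero ((totalDegree_gradSq_le l hq).trans hk)
      (eval_gradSq_nonneg l q) h4] with x hx
    rw [hx, hc, zero_mul]
  · refine Filter.Eventually.of_forall fun x => ?_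
    simp only [relDev, map_mul, map_sub, eval_C]
    field_simp
    ring

/-- The relative fluctuation of a polynomial. -/
noncomputable def relDevLin (q : MvPolynomial σ ℝ) : MvPolynomial σ ℝ :=
  C (gaussE σ q)⁻¹ * (q - C (gaussE σ q))

theorem totalDegree_relDevLin_le {d : ℕ} {q : MvPolynomial σ ℝ} (hq : q.totalDegree ≤ d) :
    (relDevLin q).totalDegree ≤ d := by
  have h := totalDegree_sub_C_le hq (gaussE σ q)
  exact totalDegree_C_mul_le _ h

theorem gaussE_relDevLin_pow_le {d : ℕ} {q : MvPolynomial σ ℝ}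
    (hq : q.totalDegree ≤ d) {θ : ℝ} (hθ : 0 ≤ θ)
    (hdecay : ∀ j, 0 < j → meanDerivSq j q ≤ θ * meanDerivSq 0 q) :
    gaussE σ (relDevLin q ^ 8) ≤ 9 ^ (448 * d) * θ ^ 4 := by
  have h1 : gaussE σ (relDevLin q ^ 2) ≤ 9 ^ d * θ := by
    have h2 := gaussE_devSq_le hq hdecay
    rw [devSq, meanDerivSq] at h2
    rw [relDevLin, mul_pow, ← C_pow, gaussE_C_mul]
    rcases eq_or_ne (gaussE σ q) 0 with h0 | h0
    · rw [h0]
      simp only [inv_zero, ne_eq, OfNat.ofNat_ne_zero, not_false_eq_true, zero_pow, zero_mul]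
      positivity
    · calc (gaussE σ q)⁻¹ ^ 2 * gaussE σ ((q - C (gaussE σ q)) ^ 2)
          ≤ (gaussE σ q)⁻¹ ^ 2 * (d * (θ * gaussE σ q ^ 2)) := by gcongr
        _ = d * θ := by field_simp
        _ ≤ 9 ^ d * θ := by
          have := natCast_le_nine_pow d
          gcongr
  have h3 := gaussE_pow_two_pow_le 2 (totalDegree_relDevLin_le hq)
  norm_num at h3
  have h0 := gaussE_sq_nonneg (relDevLin q)
  calc gaussE σ (relDevLin q ^ 8) ≤ 9 ^ (d * 8) * gaussE σ (relDevLin q ^ 2) ^ 4 := h3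
    _ ≤ 9 ^ (d * 8) * (9 ^ d * θ) ^ 4 := by gcongr
    _ = 9 ^ (12 * d) * θ ^ 4 := by
      rw [mul_pow, ← pow_mul, ← mul_assoc, ← pow_add]; congr 2; ring
    _ ≤ 9 ^ (448 * d) * θ ^ 4 := by
      gcongr
      · norm_num
      · norm_num

theorem MatchesGaussian.ae_eq_relDevLin {d k : ℕ} (hk : 2 * d ≤ k) {ν : Measure (σ → ℝ)}
    (hν : MatchesGaussian k ν) {q : MvPolynomial σ ℝ} (hq : q.totalDegree ≤ d) {θ : ℝ}
    (hdecay : ∀ j, 0 < j → meanDerivSq j q ≤ θ * meanDerivSq 0 q) :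
    ∀ᵐ x ∂ν, eval x q = gaussE σ q * (1 + eval x (relDevLin q)) := by
  by_cases hc : gaussE σ q = 0
  · filter_upwards [hν.ae_gradSq_eq hk hq hdecay] with x hx
    rw [gradSq, meanDerivSq, hc, map_pow] at hx
    rw [hc, zero_mul]
    simpa using hx
  · refine Filter.Eventually.of_forall fun x => ?_
    simp only [relDevLin, map_mul, map_sub, eval_C]
    field_simp
    ring

end LocalComparison

/-! ### The local comparison: decaying and growing mean derivatives. -/

section LocalBound

open MvPolynomial

variable {σ : Type*} [Fintype σ]

theorem meanDerivSq_le_of_decay {q : MvPolynomial σ ℝ} {θ : ℝ} (hθ1 : θ ≤ 1) {l : ℕ}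
    (h : ∀ j, l ≤ j → meanDerivSq (j + 1) q ≤ θ * meanDerivSq j q) :
    ∀ i j, l ≤ i → i < j → meanDerivSq j q ≤ θ * meanDerivSq i q := by
  intro i j hi hij
  induction j, hij using Nat.le_induction with
  | base => exact h i hi
  | succ j hj ih =>
    have h0 := meanDerivSq_nonneg i q
    calc meanDerivSq (j + 1) q ≤ θ * meanDerivSq j q := h j (by omega)
      _ ≤ 1 * meanDerivSq j q := mul_le_mul_of_nonneg_right hθ1 (meanDerivSq_nonneg j q)
      _ ≤ θ * meanDerivSq i q := by rw [one_mul]; exact ih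

theorem natCast_pow_eight_mul_le {d : ℕ} (hd : 0 < d) :
    (d : ℝ) ^ 8 * ((d + 1) * 2) ≤ 9 ^ (10 * d) := by
  have h1 := natCast_le_nine_pow d
  have h2 : (1 : ℝ) ≤ d := by exact_mod_cast hd
  have h99 : (9 : ℝ) ≤ 9 ^ d := le_self_pow₀ (by norm_num) hd.ne'
  calc (d : ℝ) ^ 8 * ((d + 1) * 2) ≤ (9 ^ d) ^ 8 * ((9 ^ d) * 9 ^ d) := by
        gcongr ?_ ^ 8 * ?_
        nlinarith
    _ = 9 ^ (10 * d) := by rw [← pow_mul, ← pow_add, ← pow_add]; congr 1; ring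

/-- The comparison when all derivatives are concentrated around their means. -/
theorem MatchesGaussian.abs_integral_sub_le_of_decay {K : ℝ} (hK1 : 1 ≤ K)
    (hlip : ∀ x y, |smoothCutoff x - smoothCutoff y| ≤ K * |x - y|)
    (htaylor : ∀ a, ∃ c : ℕ → ℝ, (∀ j ∈ Finset.range 8, |c j| ≤ K) ∧
      ∀ x, |smoothCutoff x - ∑ j ∈ Finset.range 8, c j * (x - a) ^ j| ≤ K * |x - a| ^ 8)
    {s : ℝ → ℝ} (hs : IsSignLike s) {d : ℕ} (hd : 0 < d) {ν : Measure (σ → ℝ)}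
    [IsProbabilityMeasure ν] (hν : MatchesGaussian (128 * d) ν) {q : MvPolynomial σ ℝ}
    (hq : q.totalDegree ≤ d) {κ : ℝ} (hκ : 0 < κ) {θ : ℝ} (hθ : 0 ≤ θ) (hθd : d * θ ≤ 1)
    (hdecay : ∀ j, meanDerivSq (j + 1) q ≤ θ * meanDerivSq j q) :
    |∫ x, s (eval x q) * gradCutoff d κ q x ∂ν
        - ∫ x, s (eval x q) * gradCutoff d κ q x ∂(stdGauss σ)|
      ≤ 9 ^ 44 * K * 9 ^ (458 * d) * θ ^ 4 := by
  have hd1 : (1 : ℝ) ≤ d := by exact_mod_cast hd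
  have hθ1 : θ ≤ 1 := by nlinarith
  have hdec : ∀ i j, i < j → meanDerivSq j q ≤ θ * meanDerivSq i q := fun i j =>
    meanDerivSq_le_of_decay hθ1 (l := 0) (fun j _ => hdecay j) i j (Nat.zero_le i)
  set m : ℕ → ℝ := fun l => meanDerivSq l q with hm
  have hm0 : ∀ l, 0 ≤ m l := fun l => meanDerivSq_nonneg l q
  set α : ℕ → ℝ := fun l => κ ^ 2 * m (l + 1) / (m l + κ ^ 2 * m (l + 1)) with hα
  have hα01 : ∀ l, 0 ≤ α l ∧ α l ≤ 1 := fun l => ratio_mem_unit_interval (hm0 l) (hm0 (l + 1))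
  obtain ⟨c, hc, hct⟩ := htaylor (∑ l ∈ Finset.range d, α l)
  set A : MvPolynomial σ ℝ := ∑ j ∈ Finset.range 8, C (c j) *
    (∑ l ∈ Finset.range d, ratioApproxPoly (α l) (relDev l q) (relDev (l + 1) q)
      - C (∑ l ∈ Finset.range d, α l)) ^ j with hA
  set R₁ : MvPolynomial σ ℝ := C (9 ^ 40 * K * d ^ 8) *
    ∑ l ∈ Finset.range (d + 1), (relDev l q ^ 8 + relDev l q ^ 64) with hR₁
  -- The approximant is `s(E q) · A`, which is right for the sign while the relative fluctuation `w`
  -- of `q` is at most `1/2`. Otherwise `512 w⁸ ≥ 2` covers the trivial bound for the difference.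
  set R : MvPolynomial σ ℝ := R₁ + C 512 * relDevLin q ^ 8 with hR
  have hAdeg : A.totalDegree ≤ 128 * d := by
    refine totalDegree_finsetSum_le fun j hj => totalDegree_C_mul_le _ ?_
    have h1 : (∑ l ∈ Finset.range d, ratioApproxPoly (α l) (relDev l q) (relDev (l + 1) q)).totalDegree
        ≤ 8 * (2 * d) := totalDegree_finsetSum_le fun l _ =>
      totalDegree_ratioApproxPoly_le (totalDegree_relDev_le l hq) (totalDegree_relDev_le (l + 1) hq)
    have h2 := totalDegree_sub_C_le h1 (∑ l ∈ Finset.range d, α l)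
    refine totalDegree_pow_le_of_le h2 ?_
    have : j ≤ 7 := by have := Finset.mem_range.1 hj; omega
    calc j * (8 * (2 * d)) ≤ 7 * (8 * (2 * d)) := Nat.mul_le_mul_right _ this
      _ ≤ 128 * d := by omega
  -- The term `relDev ^ 64`, of degree up to `64 · 2d`, dictates the moment order `128d`.
  have hRdeg : R.totalDegree ≤ 128 * d := by
    refine totalDegree_add_le_of_le (totalDegree_C_mul_le _ (totalDegree_finsetSum_le fun l _ => ?_))
      (totalDegree_C_mul_le _ (totalDegree_pow_le_of_le (totalDegree_relDevLin_le hq) (by omega)))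
    have h1 := totalDegree_relDev_le l hq
    exact totalDegree_add_le_of_le (totalDegree_pow_le_of_le h1 (by omega))
      (totalDegree_pow_le_of_le h1 (by omega))
  have hmeas : Measurable fun x => s (eval x q) * gradCutoff d κ q x :=
    (hs.measurable.comp (measurable_eval_comp q measurable_id)).mul (measurable_gradCutoff d κ q)
  have hbd : ∀ x, |s (eval x q) * gradCutoff d κ q x| ≤ 1 := fun x => by
    rw [abs_mul]
    exact mul_le_one₀ (hs.abs_le_one _) (abs_nonneg _) (abs_gradCutoff_le_one d κ q x)
  have hptw : ∀ ν' : Measure (σ → ℝ), MatchesGaussian (128 * d) ν' →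
      ∀ᵐ x ∂ν', |s (eval x q) * gradCutoff d κ q x - eval x (C (s (gaussE σ q)) * A)|
        ≤ eval x R := by
    intro ν' hν'
    have h1 : ∀ᵐ x ∂ν', ∀ l, eval x (gradSq l q) = m l * (1 + eval x (relDev l q)) :=
      ae_all_iff.2 fun l => hν'.ae_gradSq_eq (by omega) hq (hdec l)
    filter_upwards [h1, hν'.ae_eq_relDevLin (by omega) hq (hdec 0)] with x hx hx0
    have hG : |gradCutoff d κ q x - eval x A| ≤ eval x R₁ := by
      have h2 := smoothCutoff_approx hK1 hlip hd (u := fun l => eval x (relDev l q)) hα01 hc hct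
        (abs_gradCutoff_le_one d κ q x) (fun hu => ?_)
      · simpa only [hA, hR₁, map_sum, map_mul, map_pow, map_sub, map_add, eval_C,
          eval_ratioApproxPoly] using h2
      · rw [gradCutoff]
        congr 1
        refine Finset.sum_congr rfl fun l _ => ?_
        rw [gradRatio, hx l, hx (l + 1)]
        exact gradRatio_eq_of_relDev hκ (hm0 l) (hm0 (l + 1))
    have hR0 : 0 ≤ eval x R₁ := (abs_nonneg _).trans hG
    set w := eval x (relDevLin q) with hw
    have eR : eval x R = eval x R₁ + 512 * w ^ 8 := by
      rw [hR]; simp only [map_add, map_mul, map_pow, eval_C, hw]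
    rw [map_mul, eval_C, eR]
    have hs1 := hs.abs_le_one (gaussE σ q)
    by_cases hw2 : |w| ≤ 1 / 2
    · rw [hx0, hs.mul_eq _ _ hw2, ← mul_sub, abs_mul]
      have h3 : 0 ≤ 512 * w ^ 8 := by positivity
      calc |s (gaussE σ q)| * |gradCutoff d κ q x - eval x A| ≤ 1 * eval x R₁ := by gcongr
        _ ≤ eval x R₁ + 512 * w ^ 8 := by linarith
    · have hw3 : (1 / 2 : ℝ) ^ 8 ≤ w ^ 8 := by
        rw [← (show Even 8 by decide).pow_abs w]
        exact pow_le_pow_left₀ (by norm_num) (not_le.1 hw2).le 8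
      have h4 : |eval x A| ≤ 1 + eval x R₁ := by
        have h5 : |eval x A| ≤ |gradCutoff d κ q x| + |gradCutoff d κ q x - eval x A| := by
          have := abs_sub (gradCutoff d κ q x) (gradCutoff d κ q x - eval x A)
          rwa [sub_sub_cancel] at this
        linarith [abs_gradCutoff_le_one d κ q x]
      have h6 : |s (gaussE σ q) * eval x A| ≤ 1 + eval x R₁ := by
        rw [abs_mul]
        calc |s (gaussE σ q)| * |eval x A| ≤ 1 * (1 + eval x R₁) := by gcongr
          _ = 1 + eval x R₁ := one_mul _
      have h7 := abs_sub (s (eval x q) * gradCutoff d κ q x) (s (gaussE σ q) * eval x A)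
      have h8 := hbd x
      norm_num at hw3
      linarith
  have hfin := hν.abs_integral_sub_le hmeas hbd (totalDegree_C_mul_le (s (gaussE σ q)) hAdeg)
    hRdeg hptw
  refine hfin.trans ?_
  set E : ℝ := 9 ^ (448 * d) * θ ^ 4 with hE
  have hE0 : 0 ≤ E := by positivity
  have h1 : gaussE σ R₁ ≤ 9 ^ 40 * K * (9 ^ (10 * d) * E) := by
    rw [hR₁, gaussE_C_mul, map_sum]
    have h2 : ∑ l ∈ Finset.range (d + 1), gaussE σ (relDev l q ^ 8 + relDev l q ^ 64)
        ≤ (d + 1) * (2 * E) := by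
      refine (Finset.sum_le_card_nsmul _ _ (2 * E) fun l _ => ?_).trans (by simp)
      have h3 := gaussE_relDev_pow_le hd hq hθ hθd (hdec l)
      rw [map_add]
      linarith [h3.1, h3.2]
    calc 9 ^ 40 * K * d ^ 8 * ∑ l ∈ Finset.range (d + 1), gaussE σ (relDev l q ^ 8 + relDev l q ^ 64)
        ≤ 9 ^ 40 * K * d ^ 8 * ((d + 1) * (2 * E)) := by gcongr
      _ = 9 ^ 40 * K * ((d ^ 8 * ((d + 1) * 2)) * E) := by ring
      _ ≤ 9 ^ 40 * K * (9 ^ (10 * d) * E) := by gcongr; exact natCast_pow_eight_mul_le hd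
  have h2 : gaussE σ (relDevLin q ^ 8) ≤ E := gaussE_relDevLin_pow_le hq hθ (hdec 0)
  have h3 : (1 : ℝ) ≤ 9 ^ (10 * d) := one_le_pow₀ (by norm_num)
  rw [hR, map_add, gaussE_C_mul 512]
  have h4 : E ≤ K * (9 ^ (10 * d) * E) := by
    have h5 : 1 ≤ K * 9 ^ (10 * d) := one_le_mul_of_one_le_of_one_le hK1 h3
    nlinarith
  calc 2 * (gaussE σ R₁ + 512 * gaussE σ (relDevLin q ^ 8))
      ≤ 2 * (9 ^ 40 * K * (9 ^ (10 * d) * E) + 512 * (K * (9 ^ (10 * d) * E))) := by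
        linarith
    _ = (2 * (9 ^ 40 + 512)) * (K * (9 ^ (10 * d) * E)) := by ring
    _ ≤ 9 ^ 44 * (K * (9 ^ (10 * d) * E)) := by
      refine mul_le_mul_of_nonneg_right (by norm_num) (by positivity)
    _ = 9 ^ 44 * K * 9 ^ (458 * d) * θ ^ 4 := by
      rw [hE, show 458 * d = 10 * d + 448 * d by ring, pow_add]; ring

/-- The comparison when some derivative has a large mean relative to the previous one. -/
theorem MatchesGaussian.abs_integral_sub_le_of_growth
    {s : ℝ → ℝ} (hs : IsSignLike s) {d : ℕ} (hd : 0 < d) {ν : Measure (σ → ℝ)}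
    [IsProbabilityMeasure ν] (hν : MatchesGaussian (128 * d) ν) {q : MvPolynomial σ ℝ}
    (hq : q.totalDegree ≤ d) {κ : ℝ} (hκ : 0 < κ) (hθd : d * (8 / κ ^ 2) ≤ 1) {l : ℕ} (hl : l < d)
    (hgrowth : 8 / κ ^ 2 * meanDerivSq l q < meanDerivSq (l + 1) q)
    (hdecay : ∀ j, l + 1 ≤ j → meanDerivSq (j + 1) q ≤ 8 / κ ^ 2 * meanDerivSq j q) :
    |∫ x, s (eval x q) * gradCutoff d κ q x ∂ν
        - ∫ x, s (eval x q) * gradCutoff d κ q x ∂(stdGauss σ)|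
      ≤ 9 ^ 44 * 9 ^ (458 * d) * (8 / κ ^ 2) ^ 4 := by
  set θ := 8 / κ ^ 2 with hθdef
  have hθ : 0 < θ := by positivity
  have hd1 : (1 : ℝ) ≤ d := by exact_mod_cast hd
  have hθ1 : θ ≤ 1 := by nlinarith
  have hdec : ∀ i j, l + 1 ≤ i → i < j → meanDerivSq j q ≤ θ * meanDerivSq i q :=
    meanDerivSq_le_of_decay hθ1 hdecay
  set c' := meanDerivSq (l + 1) q with hc'
  have hc0 := meanDerivSq_nonneg l q
  have hc'0 : 0 < c' := lt_of_le_of_lt (by positivity) hgrowth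
  -- The approximant is zero. A nonzero cutoff requires either that `|∇^{l+1}q|²` drops below half
  -- its mean, so that the first term is at least `1`, or that `∇^l q` deviates far from its mean,
  -- so that the second is.
  set R : MvPolynomial σ ℝ := C (2 ^ 8) * relDev (l + 1) q ^ 8
    + C ((θ / c') ^ 4) * devSq l q ^ 4 with hR
  have hRdeg : R.totalDegree ≤ 128 * d :=
    totalDegree_add_le_of_le
      (totalDegree_C_mul_le _ (totalDegree_pow_le_of_le (totalDegree_relDev_le (l + 1) hq) (by omega)))
      (totalDegree_C_mul_le _ (totalDegree_pow_le_of_le (totalDegree_devSq_le l hq) (by omega)))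
  have hmeas : Measurable fun x => s (eval x q) * gradCutoff d κ q x :=
    (hs.measurable.comp (measurable_eval_comp q measurable_id)).mul (measurable_gradCutoff d κ q)
  have hbd : ∀ x, |s (eval x q) * gradCutoff d κ q x| ≤ 1 := fun x => by
    rw [abs_mul]
    exact mul_le_one₀ (hs.abs_le_one _) (abs_nonneg _) (abs_gradCutoff_le_one d κ q x)
  have hptw : ∀ x, |s (eval x q) * gradCutoff d κ q x - eval x (0 : MvPolynomial σ ℝ)|
      ≤ eval x R := by
    intro x
    rw [map_zero, sub_zero]
    have eR : eval x R = 2 ^ 8 * eval x (relDev (l + 1) q) ^ 8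
        + (θ / c') ^ 4 * eval x (devSq l q) ^ 4 := by
      rw [hR]; simp only [map_add, map_mul, map_pow, eval_C]
    have hD0 := eval_devSq_nonneg l q x
    have hp1 : 0 ≤ 2 ^ 8 * eval x (relDev (l + 1) q) ^ 8 := by positivity
    have hp2 : 0 ≤ (θ / c') ^ 4 * eval x (devSq l q) ^ 4 := by positivity
    by_cases hz : 1 / 2 ≤ gradRatio κ q l x
    · have h1 : gradCutoff d κ q x = 0 := by
        refine smoothCutoff_eq_zero (hz.trans ?_)
        exact Finset.single_le_sum (f := fun l => gradRatio κ q l x)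
          (fun i _ => gradRatio_nonneg κ q i x) (Finset.mem_range.2 hl)
      rw [h1, mul_zero, abs_zero, eR]
      positivity
    refine (hbd x).trans ?_
    rw [eR]
    set g := eval x (gradSq l q) with hg
    set g' := eval x (gradSq (l + 1) q) with hg'
    have hg0 : 0 ≤ g := eval_gradSq_nonneg l q x
    by_cases hsmall : g' < c' / 2
    · have hu : eval x (relDev (l + 1) q) = (g' - c') / c' := by
        simp only [relDev, map_mul, map_sub, eval_C, ← hc', ← hg']
        field_simp
      have hu2 : 1 / 2 ≤ |eval x (relDev (l + 1) q)| := by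
        rw [hu, abs_div, abs_of_pos hc'0, le_div_iff₀ hc'0, abs_of_neg (by linarith)]
        linarith
      have h8 : (1 / 2 : ℝ) ^ 8 ≤ eval x (relDev (l + 1) q) ^ 8 := by
        rw [← (show Even 8 by decide).pow_abs (eval x (relDev (l + 1) q))]
        exact pow_le_pow_left₀ (by norm_num) hu2 8
      norm_num at h8
      linarith
    -- Here `κ²c'/2 ≤ κ²g' < g ≤ 2 meanDerivSq + 2 devSq`, while growth gives `8 meanDerivSq <
    -- κ²c'`. The mean is absorbed, leaving `κ²c' ≤ 8 devSq`; the `8` in `θ = 8/κ²` is chosen for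
    -- this.
    · have hg'pos : 0 < g' := by linarith
      have hκg : 0 < κ ^ 2 * g' := by positivity
      have h1 : κ ^ 2 * g' < g := by
        have h2 : κ ^ 2 * g' / (g + κ ^ 2 * g') < 1 / 2 := not_le.1 hz
        rw [div_lt_iff₀ (by positivity)] at h2
        linarith
      have h3 := eval_gradSq_le l q x
      have hθκ : θ * κ ^ 2 = 8 := by rw [hθdef]; field_simp
      have h4 : κ ^ 2 * (c' / 2) ≤ κ ^ 2 * g' := by
        gcongr
        linarith
      have h5 : 8 * meanDerivSq l q < κ ^ 2 * c' := by
        have h6 : κ ^ 2 * (θ * meanDerivSq l q) < κ ^ 2 * c' := by gcongr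
        have h7 : κ ^ 2 * (θ * meanDerivSq l q) = 8 * meanDerivSq l q := by
          rw [← hθκ]; ring
        linarith
      have h8 : c' ≤ θ * eval x (devSq l q) := by
        have h9 : κ ^ 2 * c' ≤ 8 * eval x (devSq l q) := by linarith
        have h10 : κ ^ 2 * c' ≤ κ ^ 2 * (θ * eval x (devSq l q)) := by
          calc κ ^ 2 * c' ≤ 8 * eval x (devSq l q) := h9
            _ = κ ^ 2 * (θ * eval x (devSq l q)) := by rw [← hθκ]; ring
        exact le_of_mul_le_mul_left h10 (by positivity)
      have h11 : 1 ≤ θ / c' * eval x (devSq l q) := by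
        rw [div_mul_eq_mul_div, le_div_iff₀ hc'0]
        linarith
      have h12 : 1 ≤ (θ / c' * eval x (devSq l q)) ^ 4 := one_le_pow₀ h11
      rw [mul_pow] at h12
      linarith
  have hfin := hν.abs_integral_sub_le hmeas hbd (A := 0) (by simp) hRdeg
    fun ν' _ => Filter.Eventually.of_forall hptw
  refine hfin.trans ?_
  have h1 := (gaussE_relDev_pow_le hd hq hθ.le hθd (fun j => hdec (l + 1) j le_rfl)).1
  have hv : gaussE σ (devSq l q) ≤ d * c' := gaussE_devSq_le hq fun j hj => by
    rcases Nat.lt_or_ge (l + 1) j with h | h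
    · refine (hdec (l + 1) j le_rfl h).trans ?_
      nlinarith
    · rw [show j = l + 1 by omega]
  have hv0 := gaussE_devSq_nonneg l q
  have h2 : (θ / c') ^ 4 * gaussE σ (devSq l q ^ 4) ≤ 9 ^ (8 * d) * θ ^ 4 := by
    calc (θ / c') ^ 4 * gaussE σ (devSq l q ^ 4)
        ≤ (θ / c') ^ 4 * (9 ^ (4 * d) * (d * c') ^ 4) := by
          gcongr
          exact (gaussE_devSq_pow_four_le l hq).trans (by gcongr)
      _ = 9 ^ (4 * d) * d ^ 4 * θ ^ 4 := by field_simp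
      _ ≤ 9 ^ (4 * d) * (9 ^ d) ^ 4 * θ ^ 4 := by
        have := natCast_le_nine_pow d
        gcongr
      _ = 9 ^ (8 * d) * θ ^ 4 := by rw [← pow_mul, ← pow_add]; congr 2; ring
  have h3 : (9 : ℝ) ^ (8 * d) ≤ 9 ^ (458 * d) := pow_le_pow_right₀ (by norm_num) (by omega)
  have h4 : (9 : ℝ) ^ (448 * d) ≤ 9 ^ (458 * d) := pow_le_pow_right₀ (by norm_num) (by omega)
  rw [hR, map_add, gaussE_C_mul, gaussE_C_mul]
  calc 2 * (2 ^ 8 * gaussE σ (relDev (l + 1) q ^ 8) + (θ / c') ^ 4 * gaussE σ (devSq l q ^ 4))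
      ≤ 2 * (2 ^ 8 * (9 ^ (458 * d) * θ ^ 4) + 9 ^ (458 * d) * θ ^ 4) := by
        have e1 := h1.trans (mul_le_mul_of_nonneg_right h4 (by positivity : 0 ≤ θ ^ 4))
        have e2 := h2.trans (mul_le_mul_of_nonneg_right h3 (by positivity : 0 ≤ θ ^ 4))
        linarith
    _ = (2 * (2 ^ 8 + 1)) * (9 ^ (458 * d) * θ ^ 4) := by ring
    _ ≤ 9 ^ 44 * (9 ^ (458 * d) * θ ^ 4) :=
      mul_le_mul_of_nonneg_right (by norm_num) (by positivity)
    _ = _ := by ring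

/-- Measures that match the Gaussian moments up to order `128 d` agree, up to `O(κ ^ (-8))`, on
the truncated sign of a polynomial of degree `d`. -/
theorem exists_local_bound : ∃ D : ℝ, 1 ≤ D ∧ ∀ {σ : Type} [Fintype σ] {s : ℝ → ℝ}
    (_ : IsSignLike s) {d : ℕ} (_ : 0 < d) {ν : Measure (σ → ℝ)} [IsProbabilityMeasure ν]
    (_ : MatchesGaussian (128 * d) ν) {q : MvPolynomial σ ℝ} (_ : q.totalDegree ≤ d)
    {κ : ℝ} (_ : 0 < κ),
    |∫ x, s (eval x q) * gradCutoff d κ q x ∂ν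
        - ∫ x, s (eval x q) * gradCutoff d κ q x ∂(stdGauss σ)| ≤ D ^ d / κ ^ 8 := by
  obtain ⟨K, hK1, hlip, htaylor⟩ := exists_smoothCutoff_taylor_bound
  refine ⟨9 ^ 44 * K * 9 ^ 458 * 8 ^ 4, ?_, ?_⟩
  · have h1 : (1 : ℝ) ≤ 9 ^ 44 * K :=
      one_le_mul_of_one_le_of_one_le (one_le_pow₀ (by norm_num)) hK1
    exact one_le_mul_of_one_le_of_one_le
      (one_le_mul_of_one_le_of_one_le h1 (one_le_pow₀ (by norm_num))) (by norm_num)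
  intro σ _ s hs d hd ν _ hν q hq κ hκ
  have hd1 : (1 : ℝ) ≤ d := by exact_mod_cast hd
  set θ := 8 / κ ^ 2 with hθ
  have hθ0 : 0 < θ := by positivity
  have hDK : 9 ^ 44 * K * 9 ^ (458 * d) * 8 ^ 4 ≤ (9 ^ 44 * K * 9 ^ 458 * 8 ^ 4) ^ d := by
    have h1 : 9 ^ 44 * K * 8 ^ 4 ≤ (9 ^ 44 * K * 8 ^ 4) ^ d := by
      refine le_self_pow₀ ?_ hd.ne'
      have : (1 : ℝ) ≤ 9 ^ 44 * 8 ^ 4 := by norm_num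
      nlinarith
    calc 9 ^ 44 * K * 9 ^ (458 * d) * 8 ^ 4 = 9 ^ 44 * K * 8 ^ 4 * 9 ^ (458 * d) := by ring
      _ ≤ (9 ^ 44 * K * 8 ^ 4) ^ d * 9 ^ (458 * d) := by gcongr
      _ = (9 ^ 44 * K * 9 ^ 458 * 8 ^ 4) ^ d := by rw [pow_mul, ← mul_pow, mul_right_comm]
  have hfin : 9 ^ 44 * K * 9 ^ (458 * d) * θ ^ 4 ≤ (9 ^ 44 * K * 9 ^ 458 * 8 ^ 4) ^ d / κ ^ 8 := by
    rw [hθ, le_div_iff₀ (by positivity)]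
    refine le_trans (le_of_eq ?_) hDK
    field_simp
  by_cases hθd : d * θ ≤ 1
  · by_cases hdecay : ∀ j, meanDerivSq (j + 1) q ≤ θ * meanDerivSq j q
    · exact (hν.abs_integral_sub_le_of_decay hK1 hlip htaylor hs hd hq hκ hθ0.le hθd hdecay).trans hfin
    · have hex : ∃ j ≤ d, ¬ meanDerivSq (j + 1) q ≤ θ * meanDerivSq j q := by
        push Not at hdecay
        obtain ⟨j, hj⟩ := hdecay
        refine ⟨j, ?_, not_le.2 hj⟩
        by_contra hjd
        rw [meanDerivSq_eq_zero hq (by omega : d < j + 1)] at hj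
        have := meanDerivSq_nonneg j q
        have : 0 ≤ θ * meanDerivSq j q := by positivity
        linarith
      classical
      obtain ⟨j₀, hj₀, hj₀'⟩ := hex
      -- Taking the last failure of decay makes the means decay from `l + 1` on, which concentrates
      -- `∇^{l+1} q`. Derivatives of order above `d` vanish, so `l < d`.
      set l := Nat.findGreatest (fun j => ¬ meanDerivSq (j + 1) q ≤ θ * meanDerivSq j q) d with hl
      have hlspec : ¬ meanDerivSq (l + 1) q ≤ θ * meanDerivSq l q :=
        Nat.findGreatest_spec (P := fun j => ¬ meanDerivSq (j + 1) q ≤ θ * meanDerivSq j q) hj₀ hj₀'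
      have hzero : ∀ j, d ≤ j → meanDerivSq (j + 1) q ≤ θ * meanDerivSq j q := fun j hj => by
        rw [meanDerivSq_eq_zero hq (by omega : d < j + 1)]
        have := meanDerivSq_nonneg j q
        positivity
      have hld : l < d := by
        by_contra h
        exact hlspec (hzero l (not_lt.1 h))
      have hdec : ∀ j, l + 1 ≤ j → meanDerivSq (j + 1) q ≤ θ * meanDerivSq j q := by
        intro j hj
        rcases Nat.lt_or_ge d j with h | h
        · exact hzero j h.le
        · exact not_not.1 (Nat.findGreatest_is_greatest hj h)
      refine (hν.abs_integral_sub_le_of_growth hs hd hq hκ hθd hld (not_le.1 hlspec) hdec).trans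
        (le_trans ?_ hfin)
      refine mul_le_mul_of_nonneg_right ?_ (by positivity)
      refine mul_le_mul_of_nonneg_right ?_ (by positivity)
      nlinarith
  -- If `dθ > 1` the claimed bound exceeds the trivial bound `2`.
  · have hmeas : Measurable fun x => s (eval x q) * gradCutoff d κ q x :=
      (hs.measurable.comp (measurable_eval_comp q measurable_id)).mul (measurable_gradCutoff d κ q)
    have hbd : ∀ x, |s (eval x q) * gradCutoff d κ q x| ≤ 1 := fun x => by
      rw [abs_mul]
      exact mul_le_one₀ (hs.abs_le_one _) (abs_nonneg _) (abs_gradCutoff_le_one d κ q x)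
    have hone : ∀ (ν' : Measure (σ → ℝ)) [IsProbabilityMeasure ν'],
        |∫ x, s (eval x q) * gradCutoff d κ q x ∂ν'| ≤ 1 := fun ν' _ => by
      have := norm_integral_le_of_norm_le_const (μ := ν')
        (f := fun x => s (eval x q) * gradCutoff d κ q x) (Filter.Eventually.of_forall (fun x => hbd x))
      simpa using this
    refine le_trans ?_ hfin
    have h1 := abs_sub (∫ x, s (eval x q) * gradCutoff d κ q x ∂ν)
      (∫ x, s (eval x q) * gradCutoff d κ q x ∂(stdGauss σ))
    have h2 : 1 ≤ 9 ^ (4 * d) * θ ^ 4 := by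
      have h3 : 1 ≤ 9 ^ d * θ :=
        (not_le.1 hθd).le.trans (mul_le_mul_of_nonneg_right (natCast_le_nine_pow d) hθ0.le)
      calc (1 : ℝ) ≤ (9 ^ d * θ) ^ 4 := one_le_pow₀ h3
        _ = 9 ^ (4 * d) * θ ^ 4 := by rw [mul_pow, ← pow_mul, mul_comm d 4]
    have h4 : (9 : ℝ) ^ (4 * d) ≤ 9 ^ (458 * d) := pow_le_pow_right₀ (by norm_num) (by omega)
    have h5 : 1 ≤ 9 ^ (458 * d) * θ ^ 4 := h2.trans (by gcongr)
    have h6 : (2 : ℝ) ≤ 9 ^ 44 * K := by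
      have : (2 : ℝ) ≤ 9 ^ 44 := by norm_num
      nlinarith
    calc _ ≤ _ := h1
      _ ≤ 2 * 1 := by linarith [hone ν, hone (stdGauss σ)]
      _ ≤ 9 ^ 44 * K * (9 ^ (458 * d) * θ ^ 4) := by gcongr
      _ = _ := by ring

end LocalBound

/-! ### Affine substitutions and the scaling of the cutoff. -/

section AffineSubstitution

open MvPolynomial

variable {σ : Type*}

/-- The polynomial `x ↦ p (R + η x)`. -/
noncomputable def affineSubst (R : σ → ℝ) (η : ℝ) : MvPolynomial σ ℝ →ₐ[ℝ] MvPolynomial σ ℝ :=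
  aeval fun i => C (R i) + C η * X i

theorem eval_affineSubst (R : σ → ℝ) (η : ℝ) (p : MvPolynomial σ ℝ) (x : σ → ℝ) :
    eval x (affineSubst R η p) = eval (R + η • x) p := by
  induction p using MvPolynomial.induction_on with
  | C a => simp [affineSubst]
  | add p q hp hq => simp [hp, hq]
  | mul_X p i hp => rw [map_mul, map_mul, hp, map_mul]; simp [affineSubst]

theorem totalDegree_affineSubst_le (R : σ → ℝ) (η : ℝ) (p : MvPolynomial σ ℝ) :
    (affineSubst R η p).totalDegree ≤ p.totalDegree := by
  rw [affineSubst, aeval_def, eval₂_eq]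
  refine totalDegree_finsetSum_le fun α hα => ?_
  refine (totalDegree_mul _ _).trans ?_
  have h0 : ((algebraMap ℝ (MvPolynomial σ ℝ)) (p.coeff α)).totalDegree = 0 := totalDegree_C _
  rw [h0, zero_add]
  refine (totalDegree_finsetProd _ _).trans (le_trans ?_ (le_totalDegree hα))
  refine Finset.sum_le_sum fun i _ => (totalDegree_pow _ _).trans ?_
  have h1 : (C (R i) + C η * X i : MvPolynomial σ ℝ).totalDegree ≤ 1 := by
    refine (totalDegree_add _ _).trans (max_le (by simp) ((totalDegree_mul _ _).trans ?_))
    simp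
  calc α i * _ ≤ α i * 1 := Nat.mul_le_mul_left _ h1
    _ = α i := mul_one _

theorem pderiv_affineSubst (R : σ → ℝ) (η : ℝ) (p : MvPolynomial σ ℝ) (i : σ) :
    pderiv i (affineSubst R η p) = C η * affineSubst R η (pderiv i p) := by
  classical
  induction p using MvPolynomial.induction_on with
  | C a => simp [affineSubst]
  | add p q hp hq => simp [hp, hq, mul_add]
  | mul_X p j hp =>
    have hX : affineSubst R η (X j) = C (R j) + C η * X j := by simp [affineSubst]
    rw [map_mul, Derivation.leibniz, hp, Derivation.leibniz, map_add, smul_eq_mul, smul_eq_mul,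
      smul_eq_mul, smul_eq_mul, map_mul, map_mul, hX]
    by_cases hij : j = i
    · subst hij
      simp [Derivation.leibniz]
      ring
    · simp [Derivation.leibniz, pderiv_X_of_ne hij]
      ring

variable [Fintype σ]

theorem gradSq_C_mul (l : ℕ) (a : ℝ) (q : MvPolynomial σ ℝ) :
    gradSq l (C a * q) = C (a ^ 2) * gradSq l q := by
  induction l generalizing q with
  | zero => simp [gradSq, mul_pow]
  | succ l ih => simp only [gradSq, pderiv_C_mul, ih, Finset.mul_sum]

theorem eval_gradSq_affineSubst (R : σ → ℝ) (η : ℝ) (l : ℕ) (p : MvPolynomial σ ℝ) (x : σ → ℝ) :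
    eval x (gradSq l (affineSubst R η p)) = η ^ (2 * l) * eval (R + η • x) (gradSq l p) := by
  induction l generalizing p with
  | zero => simp [gradSq, eval_affineSubst]
  | succ l ih =>
    simp only [gradSq, pderiv_affineSubst, gradSq_C_mul, map_sum, map_mul, ih, Finset.mul_sum,
      eval_C]
    refine Finset.sum_congr rfl fun i _ => ?_
    ring

/-- The factor `η^{2l}` of the `l`-th squared derivative cancels in the ratio, and the remaining
`η²` is absorbed into `κ²`. The cutoff of the substituted polynomial is thus the original cutoff at
a rescaled `κ`. -/
theorem gradCutoff_affineSubst (d : ℕ) (κ : ℝ) (R : σ → ℝ) {η : ℝ} (hη : η ≠ 0)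
    (p : MvPolynomial σ ℝ) (x : σ → ℝ) :
    gradCutoff d κ (affineSubst R η p) x = gradCutoff d (κ * η) p (R + η • x) := by
  rw [gradCutoff, gradCutoff]
  congr 1
  refine Finset.sum_congr rfl fun l _ => ?_
  rw [gradRatio, gradRatio, eval_gradSq_affineSubst, eval_gradSq_affineSubst]
  have h := pow_ne_zero (2 * l) hη
  symm
  rw [← mul_div_mul_left _ _ h]
  congr 1 <;> ring

end AffineSubstitution

/-! ### The Lindeberg replacement argument. -/

section Lindeberg

variable {σ : Type*} [Fintype σ]

/-- Rotating by `arctan a` turns `x + a y` into `√(1 + a²)` times one Gaussian coordinate vector,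
merging the two Gaussians. -/
theorem integral_stdGauss_add (F : (σ → ℝ) → ℝ) (hF : Measurable F) (hF1 : ∀ x, |F x| ≤ 1)
    (R : σ → ℝ) (η a : ℝ) :
    ∫ x, ∫ y, F (R + η • x + (η * a) • y) ∂(stdGauss σ) ∂(stdGauss σ)
      = ∫ z, F (R + (η * √(1 + a ^ 2)) • z) ∂(stdGauss σ) := by
  have hs : √(1 + a ^ 2) ≠ 0 := by positivity
  have hm : Measurable fun z : σ → ℝ => F (R + (η * √(1 + a ^ 2)) • z) :=
    hF.comp (by fun_prop)
  have hm2 : Measurable fun z : (σ → ℝ) × (σ → ℝ) => F (R + η • z.1 + (η * a) • z.2) :=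
    hF.comp (by fun_prop)
  have hR : ∀ z : (σ → ℝ) × (σ → ℝ), R + η • z.1 + (η * a) • z.2
      = R + (η * √(1 + a ^ 2)) • (ContinuousLinearMap.rotation (Real.arctan a) z).1 := by
    intro z
    rw [ContinuousLinearMap.rotation_apply]
    ext i
    simp only [Pi.add_apply, Pi.smul_apply, smul_eq_mul, Real.cos_arctan, Real.sin_arctan]
    field_simp
    ring
  rw [← integral_prod (fun z : (σ → ℝ) × (σ → ℝ) => F (R + η • z.1 + (η * a) • z.2))
    (integrable_of_abs_le_one hm2 fun _ => hF1 _)]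
  simp only [hR]
  rw [← integral_map (φ := ContinuousLinearMap.rotation (Real.arctan a))
    (f := fun z : (σ → ℝ) × (σ → ℝ) => F (R + (η * √(1 + a ^ 2)) • z.1)) (by fun_prop)
    (hm.comp measurable_fst).aestronglyMeasurable, map_rotation_stdGauss,
    integral_fun_fst (fun z : σ → ℝ => F (R + (η * √(1 + a ^ 2)) • z))]
  simp

theorem abs_integral_sub_le_of_forall {α : Type*} [MeasurableSpace α] {P : Measure α}
    [IsProbabilityMeasure P] {u v : α → ℝ} (hu : Integrable u P) (hv : Integrable v P) {δ : ℝ}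
    (h : ∀ x, |u x - v x| ≤ δ) : |∫ x, u x ∂P - ∫ x, v x ∂P| ≤ δ := by
  rw [← integral_sub hu hv]
  simpa using norm_integral_le_of_norm_le_const (μ := P) (f := fun x => u x - v x)
    (Filter.Eventually.of_forall h)

/-- Replacing independent vectors by Gaussian ones, one at a time. -/
theorem abs_integral_sum_sub_stdGauss_le {Ω ι : Type*} [MeasurableSpace Ω] {μ : Measure Ω}
    [IsProbabilityMeasure μ] {X : ι → Ω → σ → ℝ} (hX : ∀ i, AEMeasurable (X i) μ)
    (hind : iIndepFun X μ) {F : (σ → ℝ) → ℝ} (hF : Measurable F) (hF1 : ∀ x, |F x| ≤ 1)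
    {η δ : ℝ} (hδ : ∀ i R, |∫ x, F (R + η • x) ∂(μ.map (X i))
      - ∫ x, F (R + η • x) ∂(stdGauss σ)| ≤ δ) (s : Finset ι) (R : σ → ℝ) :
    |∫ ω, F (R + η • (∑ i ∈ s, X i) ω) ∂μ - ∫ z, F (R + (η * √s.card) • z) ∂(stdGauss σ)|
      ≤ s.card * δ := by
  classical
  -- Conditionally on the partial sum, `X j` is replaced at cost `δ`, uniformly in the base point.
  -- The new Gaussian is then frozen and absorbed into `R`, which is why `R` is generalized, and the
  -- induction hypothesis handles the rest before the Gaussians are merged.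
  induction s using Finset.induction_on generalizing R with
  | empty => simp
  | insert j s hj ih =>
    set S : Ω → σ → ℝ := ∑ i ∈ s, X i with hS
    have hSm : AEMeasurable S μ := Finset.aemeasurable_sum s fun i _ => hX i
    have := Measure.isProbabilityMeasure_map hSm
    have := Measure.isProbabilityMeasure_map (hX j)
    have hSX : μ.map (fun ω => (S ω, X j ω)) = (μ.map S).prod (μ.map (X j)) :=
      (indepFun_iff_map_prod_eq_prod_map_map hSm (hX j)).1
        (hind.indepFun_finsetSum_of_notMem₀ hX hj)
    have hm : ∀ b : ℝ, Measurable fun z : (σ → ℝ) × (σ → ℝ) => F (R + η • z.1 + b • z.2) :=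
      fun b => hF.comp (by fun_prop)
    have hint : ∀ (b : ℝ) (P : Measure ((σ → ℝ) × (σ → ℝ))) [IsProbabilityMeasure P],
        Integrable (fun z => F (R + η • z.1 + b • z.2)) P :=
      fun b P _ => integrable_of_abs_le_one (hm b) fun _ => hF1 _
    have e1 : ∫ ω, F (R + η • (∑ i ∈ insert j s, X i) ω) ∂μ
        = ∫ y, ∫ x, F (R + η • y + η • x) ∂(μ.map (X j)) ∂(μ.map S) := by
      rw [← integral_prod (fun z : (σ → ℝ) × (σ → ℝ) => F (R + η • z.1 + η • z.2)) (hint _ _),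
        ← hSX, integral_map (hSm.prodMk (hX j)) (hm η).aestronglyMeasurable]
      refine integral_congr_ae (Filter.Eventually.of_forall fun ω => ?_)
      simp only [Finset.sum_insert hj, Pi.add_apply, hS, smul_add]
      congr 1
      abel
    have e2 : ∫ y, ∫ x, F (R + η • y + η • x) ∂(stdGauss σ) ∂(μ.map S)
        = ∫ x, ∫ ω, F (R + η • x + η • S ω) ∂μ ∂(stdGauss σ) := by
      rw [integral_integral_swap (f := fun y x : σ → ℝ => F (R + η • y + η • x)) (hint _ _)]
      refine integral_congr_ae (Filter.Eventually.of_forall fun x => ?_)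
      have : Measurable fun y : σ → ℝ => F (R + η • y + η • x) := hF.comp (by fun_prop)
      simp only
      rw [integral_map hSm this.aestronglyMeasurable]
      simp only [add_right_comm]
    have e3 : ∫ z, F (R + (η * √(insert j s).card) • z) ∂(stdGauss σ)
        = ∫ x, ∫ y, F (R + η • x + (η * √s.card) • y) ∂(stdGauss σ) ∂(stdGauss σ) := by
      rw [integral_stdGauss_add F hF hF1, Real.sq_sqrt (Nat.cast_nonneg _),
        Finset.card_insert_of_notMem hj, Nat.cast_add, Nat.cast_one, add_comm (1 : ℝ)]
    have h1 : |∫ y, ∫ x, F (R + η • y + η • x) ∂(μ.map (X j)) ∂(μ.map S)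
        - ∫ y, ∫ x, F (R + η • y + η • x) ∂(stdGauss σ) ∂(μ.map S)| ≤ δ :=
      abs_integral_sub_le_of_forall (hint _ ((μ.map S).prod (μ.map (X j)))).integral_prod_left
        (hint _ ((μ.map S).prod (stdGauss σ))).integral_prod_left fun y => hδ j (R + η • y)
    have e4 : ∀ x : σ → ℝ, ∫ ω, F (R + η • x + η • S ω) ∂μ
        = ∫ y, F (R + η • x + η • y) ∂(μ.map S) := fun x => by
      have : Measurable fun y : σ → ℝ => F (R + η • x + η • y) := hF.comp (by fun_prop)
      rw [integral_map hSm this.aestronglyMeasurable]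
    have h2 : |∫ x, ∫ ω, F (R + η • x + η • S ω) ∂μ ∂(stdGauss σ)
        - ∫ x, ∫ y, F (R + η • x + (η * √s.card) • y) ∂(stdGauss σ) ∂(stdGauss σ)|
        ≤ s.card * δ := by
      refine abs_integral_sub_le_of_forall ?_
        (hint _ ((stdGauss σ).prod (stdGauss σ))).integral_prod_left fun x => ih (R + η • x)
      simp only [e4]
      exact (hint _ ((stdGauss σ).prod (μ.map S))).integral_prod_left
    rw [e1, e3, Finset.card_insert_of_notMem hj, Nat.cast_add, Nat.cast_one]
    rw [e2] at h1
    calc _ ≤ _ := abs_sub_le _ _ _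
      _ ≤ δ + s.card * δ := add_le_add h1 h2
      _ = _ := by ring

end Lindeberg

/-! ### Removing the cutoff and choosing its scale. -/

section ThresholdComparison

open MvPolynomial

theorem gradCutoff_eq_one {σ : Type*} [Fintype σ] {d : ℕ} (hd : 0 < d) (κ : ℝ)
    (q : MvPolynomial σ ℝ) {x : σ → ℝ}
    (h : ∀ l < d, (2 * d * κ) ^ 2 * eval x (gradSq (l + 1) q) ≤ eval x (gradSq l q)) :
    gradCutoff d κ q x = 1 := by
  have hd1 : (1 : ℝ) ≤ d := by exact_mod_cast hd
  refine smoothCutoff_eq_one ?_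
  have hl : ∀ l ∈ Finset.range d, gradRatio κ q l x ≤ 1 / (4 * d) := by
    intro l hl
    have h0 := eval_gradSq_nonneg l q x
    have h1 := eval_gradSq_nonneg (l + 1) q x
    have h2 := h l (Finset.mem_range.1 hl)
    refine div_le_of_le_mul₀ (by positivity) (by positivity) ?_
    have h3 : 0 ≤ κ ^ 2 * eval x (gradSq (l + 1) q) := by positivity
    rw [one_div, inv_mul_eq_div, le_div_iff₀ (by positivity)]
    have h4 : (2 * d * κ) ^ 2 * eval x (gradSq (l + 1) q)
        = 4 * d * (κ ^ 2 * eval x (gradSq (l + 1) q)) * d := by ring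
    have h5 : 4 * d * (κ ^ 2 * eval x (gradSq (l + 1) q))
        ≤ 4 * d * (κ ^ 2 * eval x (gradSq (l + 1) q)) * d :=
      le_mul_of_one_le_right (by positivity) hd1
    linarith
  refine (Finset.sum_le_sum hl).trans (le_of_eq ?_)
  rw [Finset.sum_const, Finset.card_range, nsmul_eq_mul]
  field_simp

/-- Union bound over the `d` derivative orders, each with anticoncentration at scale `2dκ`: `d ·
7776d² · 2dκ`. -/
theorem integral_one_sub_gradCutoff_le {σ : Type} [Fintype σ] {d : ℕ} (hd : 0 < d) {κ : ℝ}
    (hκ : 0 < κ) {q : MvPolynomial σ ℝ} (hq : q.totalDegree ≤ d) :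
    ∫ x, (1 - gradCutoff d κ q x) ∂(stdGauss σ) ≤ 15552 * d ^ 4 * κ := by
  have hd1 : (1 : ℝ) ≤ d := by exact_mod_cast hd
  let A : ℕ → Set (σ → ℝ) := fun l =>
    {x | eval x (gradSq l q) < (2 * d * κ) ^ 2 * eval x (gradSq (l + 1) q)}
  let U : Set (σ → ℝ) := ⋃ l ∈ Finset.range d, A l
  have hA : ∀ l, MeasurableSet (A l) := fun l =>
    measurableSet_lt (measurable_eval_comp _ measurable_id)
      ((measurable_eval_comp _ measurable_id).const_mul _)
  have hU : MeasurableSet U := Finset.measurableSet_biUnion _ fun l _ => hA l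
  have hle : ∀ x, 1 - gradCutoff d κ q x ≤ U.indicator (fun _ => (1 : ℝ)) x := by
    intro x
    by_cases hx : x ∈ U
    · rw [Set.indicator_of_mem hx]
      have := smoothCutoff_nonneg (∑ l ∈ Finset.range d, gradRatio κ q l x)
      rw [gradCutoff]
      linarith
    · rw [Set.indicator_of_notMem hx, gradCutoff_eq_one hd κ q, sub_self]
      intro l hl
      by_contra hlt
      exact hx (Set.mem_biUnion (Finset.mem_coe.2 (Finset.mem_range.2 hl)) (not_le.1 hlt))
  have hmU : stdGauss σ U ≤ ENNReal.ofReal (15552 * d ^ 4 * κ) := by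
    refine (measure_biUnion_finset_le _ _).trans ?_
    refine (Finset.sum_le_sum fun l _ =>
      stdGauss_gradSq_small_le hd (by positivity : 0 < 2 * d * κ) l hq).trans ?_
    rw [Finset.sum_const, Finset.card_range, nsmul_eq_mul, ← ENNReal.ofReal_natCast,
      ← ENNReal.ofReal_mul (Nat.cast_nonneg d)]
    refine ENNReal.ofReal_le_ofReal (le_of_eq ?_)
    ring
  calc ∫ x, (1 - gradCutoff d κ q x) ∂(stdGauss σ)
      ≤ ∫ x, U.indicator (fun _ => (1 : ℝ)) x ∂(stdGauss σ) :=
        integral_mono ((integrable_const _).sub (integrable_of_abs_le_one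
          (measurable_gradCutoff d κ q) (abs_gradCutoff_le_one d κ q)))
          ((integrable_const _).indicator hU) hle
    _ = (stdGauss σ).real U := by rw [integral_indicator hU]; simp
    _ ≤ 15552 * d ^ 4 * κ := ENNReal.toReal_le_of_le_ofReal (by positivity) hmU

theorem MatchesGaussian.mono {σ : Type*} [Fintype σ] {k l : ℕ} {ν : Measure (σ → ℝ)}
    (h : MatchesGaussian k ν) (hl : l ≤ k) : MatchesGaussian l ν :=
  ⟨fun q hq => h.integrable q (hq.trans hl), fun q hq => h.integral_eq q (hq.trans hl)⟩

theorem abs_integral_le_one {α : Type*} [MeasurableSpace α] {P : Measure α}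
    [IsProbabilityMeasure P] {f : α → ℝ} (hf : ∀ x, |f x| ≤ 1) : |∫ x, f x ∂P| ≤ 1 := by
  simpa using norm_integral_le_of_norm_le_const (μ := P) (f := f) (Filter.Eventually.of_forall hf)

/-- Comparison of two expectations of a sign through the expectations of its cut off version. -/
theorem abs_integral_sub_le_of_cutoff {α β : Type*} [MeasurableSpace α] [MeasurableSpace β]
    {P : Measure α} [IsProbabilityMeasure P] {Q : Measure β} [IsProbabilityMeasure Q]
    {f G : α → ℝ} {g H : β → ℝ} (hf : Integrable f P) (hG : Integrable G P)
    (hfG : Integrable (fun x => f x * G x) P) (hg : Integrable g Q) (hH : Integrable H Q)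
    (hgH : Integrable (fun x => g x * H x) Q)
    (hf1 : ∀ x, |f x| ≤ 1) (hg1 : ∀ x, |g x| ≤ 1) (hG1 : ∀ x, |G x| ≤ 1) (hH1 : ∀ x, |H x| ≤ 1)
    {a b : ℝ} (h1 : |∫ x, f x * G x ∂P - ∫ x, g x * H x ∂Q| ≤ a)
    (h2 : |∫ x, G x ∂P - ∫ x, H x ∂Q| ≤ a) (hb : ∫ x, (1 - H x) ∂Q ≤ b) :
    |∫ x, f x ∂P - ∫ x, g x ∂Q| ≤ 2 * a + 2 * b := by
  -- Inserting the cutoff costs `∫ (1 - G)`. Under `P` this is at most `a + b`, by transfer from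
  -- `Q`, so anticoncentration is needed only for the Gaussian side.
  have key : ∀ s t : ℝ, |s| ≤ 1 → |t| ≤ 1 → |s - s * t| ≤ 1 - t := by
    intro s t hs ht
    have h0 : 0 ≤ 1 - t := by linarith [(abs_le.1 ht).2]
    rw [← mul_one_sub, abs_mul, abs_of_nonneg h0]
    exact mul_le_of_le_one_left h0 hs
  have e1 : |∫ x, f x ∂P - ∫ x, f x * G x ∂P| ≤ ∫ x, (1 - G x) ∂P := by
    rw [← integral_sub hf hfG]
    exact abs_integral_le_integral_abs.trans (integral_mono (hf.sub hfG).abs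
      ((integrable_const _).sub hG) fun x => key _ _ (hf1 x) (hG1 x))
  have e2 : |∫ x, g x ∂Q - ∫ x, g x * H x ∂Q| ≤ ∫ x, (1 - H x) ∂Q := by
    rw [← integral_sub hg hgH]
    exact abs_integral_le_integral_abs.trans (integral_mono (hg.sub hgH).abs
      ((integrable_const _).sub hH) fun x => key _ _ (hg1 x) (hH1 x))
  have e3 : ∫ x, (1 - G x) ∂P = 1 - ∫ x, G x ∂P := by
    rw [integral_sub (integrable_const _) hG]; simp
  have e4 : ∫ x, (1 - H x) ∂Q = 1 - ∫ x, H x ∂Q := by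
    rw [integral_sub (integrable_const _) hH]; simp
  rw [abs_le] at *
  constructor <;> linarith

/-- A normalized sum of independent vectors that match the moments of a Gaussian vector is close
to the Gaussian vector for polynomial threshold functions. -/
theorem exists_threshold_bound : ∃ D : ℝ, 1 ≤ D ∧
    ∀ {Ω : Type*} [MeasurableSpace Ω] {μ : Measure Ω} [IsProbabilityMeasure μ]
      {σ : Type} [Fintype σ] {d N : ℕ} (_ : 0 < d) (_ : 0 < N) {X : Fin N → Ω → σ → ℝ}
      (_ : ∀ i, AEMeasurable (X i) μ) (_ : ∀ i, MatchesGaussian (128 * d) (μ.map (X i)))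
      (_ : iIndepFun X μ) {q : MvPolynomial σ ℝ} (_ : q.totalDegree ≤ d) {κ : ℝ} (_ : 0 < κ),
      |∫ ω, Real.sign (eval ((1 / √(N : ℝ)) • ∑ i, X i ω) q) ∂μ
        - ∫ x, Real.sign (eval x q) ∂(stdGauss σ)|
        ≤ 2 * (D ^ d / (κ ^ 8 * N ^ 3)) + 2 * (15552 * d ^ 4 * κ) := by
  obtain ⟨D, hD1, hD⟩ := exists_local_bound
  refine ⟨D, hD1, ?_⟩
  intro Ω _ μ _ σ _ d N hd hN X hX hM hind q hq κ hκ
  have hN0 : (0 : ℝ) < N := by exact_mod_cast hN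
  have hs0 : 0 < √(N : ℝ) := Real.sqrt_pos.2 hN0
  set η : ℝ := 1 / √(N : ℝ) with hη
  have hη0 : 0 < η := by positivity
  have hηN : η * √(N : ℝ) = 1 := by rw [hη]; field_simp
  have hsum : AEMeasurable (fun ω => η • ∑ i, X i ω) μ := by
    have := (Finset.aemeasurable_sum Finset.univ fun i _ => hX i).const_smul η
    simpa only [Finset.sum_apply, Finset.sum_fn, Pi.smul_def] using this
  have hcomp : ∀ {s : ℝ → ℝ}, IsSignLike s →
      Measurable (fun x : σ → ℝ => s (eval x q) * gradCutoff d κ q x) ∧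
      (∀ x, |s (eval x q) * gradCutoff d κ q x| ≤ 1) ∧
      |∫ ω, s (eval (η • ∑ i, X i ω) q) * gradCutoff d κ q (η • ∑ i, X i ω) ∂μ
        - ∫ x, s (eval x q) * gradCutoff d κ q x ∂(stdGauss σ)| ≤ D ^ d / (κ ^ 8 * N ^ 3) := by
    intro s hs
    have hmeas : Measurable fun x => s (eval x q) * gradCutoff d κ q x :=
      (hs.measurable.comp (measurable_eval_comp q measurable_id)).mul (measurable_gradCutoff d κ q)
    have hbd : ∀ x, |s (eval x q) * gradCutoff d κ q x| ≤ 1 := fun x => by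
      rw [abs_mul]
      exact mul_le_one₀ (hs.abs_le_one _) (abs_nonneg _) (abs_gradCutoff_le_one d κ q x)
    refine ⟨hmeas, hbd, ?_⟩
    have hloc : ∀ i R, |∫ x, s (eval (R + η • x) q) * gradCutoff d κ q (R + η • x) ∂(μ.map (X i))
        - ∫ x, s (eval (R + η • x) q) * gradCutoff d κ q (R + η • x) ∂(stdGauss σ)|
        ≤ D ^ d / (κ / η) ^ 8 := by
      intro i R
      have := Measure.isProbabilityMeasure_map (hX i)
      have := hD hs hd (hM i) ((totalDegree_affineSubst_le R η q).trans hq) (div_pos hκ hη0)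
      simpa only [eval_affineSubst, gradCutoff_affineSubst d (κ / η) R hη0.ne' q,
        div_mul_cancel₀ κ hη0.ne'] using this
    have h := abs_integral_sum_sub_stdGauss_le hX hind hmeas hbd hloc Finset.univ 0
    simp only [zero_add, Finset.card_univ, Fintype.card_fin, hηN, one_smul, Finset.sum_apply] at h
    -- `N` replacements, each costing `D^d (η/κ)⁸` with `η⁸ = N⁻⁴`.
    refine h.trans (le_of_eq ?_)
    have h8 : √(N : ℝ) ^ 8 = (N : ℝ) ^ 4 := by
      rw [show (8 : ℕ) = 2 * 4 from rfl, pow_mul, Real.sq_sqrt hN0.le]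
    rw [hη, div_div_eq_mul_div, div_one, mul_pow, h8]
    field_simp
  obtain ⟨m1, b1, h1⟩ := hcomp isSignLike_sign
  obtain ⟨-, -, h2⟩ := hcomp isSignLike_one
  simp only [one_mul] at h2
  have ms : Measurable fun x : σ → ℝ => Real.sign (eval x q) :=
    isSignLike_sign.measurable.comp (measurable_eval_comp q measurable_id)
  have mG := measurable_gradCutoff d κ q
  have hint : ∀ {F : (σ → ℝ) → ℝ}, Measurable F → (∀ x, |F x| ≤ 1) →
      Integrable (fun ω => F (η • ∑ i, X i ω)) μ := fun hF hF1 =>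
    Integrable.of_bound (hF.comp_aemeasurable hsum).aestronglyMeasurable 1
      (Filter.Eventually.of_forall fun _ => hF1 _)
  have bs : ∀ x : σ → ℝ, |Real.sign (eval x q)| ≤ 1 := fun _ => isSignLike_sign.abs_le_one _
  have bG := abs_gradCutoff_le_one d κ q
  exact abs_integral_sub_le_of_cutoff (f := fun ω => Real.sign (eval (η • ∑ i, X i ω) q))
    (G := fun ω => gradCutoff d κ q (η • ∑ i, X i ω)) (hint ms bs) (hint mG bG) (hint m1 b1)
    (integrable_of_abs_le_one ms bs) (integrable_of_abs_le_one mG bG)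
    (integrable_of_abs_le_one m1 b1) (fun _ => bs _) bs (fun _ => bG _) bG h1 h2
    (integral_one_sub_gradCutoff_le hd hκ hq)

theorem IsIndepStdGaussian.integral_comp {Ω : Type*} [MeasurableSpace Ω] {ν : Measure Ω}
    [IsProbabilityMeasure ν] {n : ℕ} {Y : Ω → Fin n → ℝ} (hY : IsIndepStdGaussian Y ν)
    {f : (Fin n → ℝ) → ℝ} (hf : Measurable f) :
    ∫ ω, f (Y ω) ∂ν = ∫ x, f x ∂(stdGauss (Fin n)) := by
  have hlaw : HasLaw Y (stdGauss (Fin n)) ν := hY.indep.hasLaw_pi hY.hasLaw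
  rw [← hlaw.map_eq, integral_map hlaw.aemeasurable hf.aestronglyMeasurable]

/-- The numerical choice of the cutoff scale. -/
theorem threshold_bound_lt {D M ε N : ℝ} {d : ℕ} (hd : 0 < d) (hD : 1 ≤ D)
    (hM : M = 131072 * 9 ^ 4) (hε : 0 < ε) (hN : 0 < N)
    (h : (5 * D * M ^ 8) ^ d ≤ N * ε ^ 3) :
    2 * (D ^ d / ((ε / M ^ d) ^ 8 * N ^ 3)) + 2 * (15552 * d ^ 4 * (ε / M ^ d)) < ε := by
  have hM1 : 1 ≤ M := by rw [hM]; norm_num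
  have hMd : 0 < M ^ d := by positivity
  -- `131072` exceeds `4 · 2 · 15552`, and the factor `9⁴` in `M` absorbs `d⁴` through `d ≤ 9^d`.
  have h1 : 2 * (15552 * d ^ 4 * (ε / M ^ d)) ≤ ε / 4 := by
    have e : 131072 * (d : ℝ) ^ 4 ≤ M ^ d := by
      calc 131072 * (d : ℝ) ^ 4 ≤ 131072 ^ d * (9 ^ d) ^ 4 := by
            gcongr
            · exact le_self_pow₀ (by norm_num) hd.ne'
            · exact natCast_le_nine_pow d
        _ = M ^ d := by rw [hM, mul_pow, ← pow_mul, ← pow_mul, mul_comm d 4]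
    rw [← mul_div_assoc, ← mul_div_assoc, div_le_div_iff₀ hMd (by norm_num)]
    have hd4 : (0 : ℝ) ≤ (d : ℝ) ^ 4 := by positivity
    nlinarith
  have h2 : 2 * (D ^ d / ((ε / M ^ d) ^ 8 * N ^ 3)) < ε / 2 := by
    have hA1 : 1 ≤ 5 * D * M ^ 8 := by
      have : 1 ≤ M ^ 8 := one_le_pow₀ hM1
      nlinarith
    -- After clearing denominators the claim is a bound on `(Nε³)³`. The `5` in the hypothesis
    -- supplies the strict factor `4`, and the cube has ample room.
    have hA : 4 * (D ^ d * (M ^ d) ^ 8) < (N * ε ^ 3) ^ 3 := by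
      have h5 : (5 : ℝ) ≤ 5 ^ d := le_self_pow₀ (by norm_num) hd.ne'
      have hpos : 0 < D ^ d * (M ^ d) ^ 8 := by positivity
      calc 4 * (D ^ d * (M ^ d) ^ 8) < 5 ^ d * (D ^ d * (M ^ d) ^ 8) := by
            gcongr; linarith
        _ = (5 * D * M ^ 8) ^ d := by ring
        _ ≤ ((5 * D * M ^ 8) ^ d) ^ 3 := le_self_pow₀ (one_le_pow₀ hA1) (by norm_num)
        _ ≤ (N * ε ^ 3) ^ 3 := by gcongr
    have e : 2 * (D ^ d / ((ε / M ^ d) ^ 8 * N ^ 3))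
        = 2 * (D ^ d * (M ^ d) ^ 8) * ε / (N * ε ^ 3) ^ 3 := by
      field_simp
    rw [e, div_lt_iff₀ (by positivity)]
    nlinarith
  linarith

end ThresholdComparison

theorem theorem1 (c : ℝ) (hc : 0 < c) :
    ∃ B : ℝ, 1 < B ∧
      ∀ (ε : ℝ) (d N k n : ℕ), 0 < ε → 0 < d →
        B ^ d * ε ^ (-4 - c) ≤ (N : ℝ) → B * (d : ℝ) ≤ (k : ℝ) →
        ∀ {Ω Ω' : Type*} [MeasurableSpace Ω] [MeasurableSpace Ω']
          (μ : Measure Ω) [IsProbabilityMeasure μ] (ν : Measure Ω') [IsProbabilityMeasure ν]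
          (X : Fin N → Ω → Fin n → ℝ) (Y : Ω' → Fin n → ℝ),
          (∀ i, IsKIndepStdGaussian k (X i) μ) → iIndepFun X μ →
          IsIndepStdGaussian Y ν →
          ∀ f : (Fin n → ℝ) → ℝ, IsPTF d f →
            |(∫ ω, f ((1 / √(N : ℝ)) • ∑ i, X i ω) ∂μ) - ∫ ω, f (Y ω) ∂ν| < ε := by
  obtain ⟨D, hD1, hD⟩ := exists_threshold_bound
  set M : ℝ := 131072 * 9 ^ 4 with hM
  have hM1 : 128 ≤ M := by rw [hM]; norm_num
  have hMA : 128 ≤ 5 * D * M ^ 8 := by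
    have : M ≤ M ^ 8 := le_self_pow₀ (by linarith) (by norm_num)
    nlinarith
  have h2c : 1 ≤ (2 : ℝ) ^ (1 + c) := Real.one_le_rpow (by norm_num) (by linarith)
  have hB : 128 ≤ 5 * D * M ^ 8 * 2 ^ (1 + c) := by nlinarith
  -- The factor `2^(1+c)` pays for replacing `ε^(-4-c)` by `ε⁻³` when `ε ≤ 2`. Being at least `128`,
  -- the constant also provides the moments up to degree `128d`.
  refine ⟨5 * D * M ^ 8 * 2 ^ (1 + c), by linarith, ?_⟩
  intro ε d N k n hε hd hN hk Ω Ω' _ _ μ _ ν _ X Y hX hind hY f hf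
  obtain ⟨p, hp, hfp⟩ := hf
  have hN0 : (0 : ℝ) < N := lt_of_lt_of_le (by positivity) hN
  -- For `ε > 2` the bound is trivial, since both expectations lie in `[-1, 1]`.
  rcases lt_or_ge 2 ε with h2 | h2
  · have hf1 : ∀ x, |f x| ≤ 1 := fun x => by
      rw [hfp]
      exact isSignLike_sign.abs_le_one _
    have h3 := abs_integral_le_one (P := μ) fun ω => hf1 ((1 / √(N : ℝ)) • ∑ i, X i ω)
    have h4 := abs_integral_le_one (P := ν) fun ω => hf1 (Y ω)
    exact (abs_sub _ _).trans_lt (by linarith)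
  · have hk' : 128 * d ≤ k := by
      have : (128 : ℝ) * d ≤ k := (by gcongr : (128 : ℝ) * d ≤ _ * d).trans hk
      exact_mod_cast this
    have hNε : (5 * D * M ^ 8) ^ d ≤ N * ε ^ 3 := by
      have e1 : (2 : ℝ) ^ (1 + c) ≤ (2 ^ (1 + c)) ^ d := le_self_pow₀ h2c hd.ne'
      have e2 : ε ^ (1 + c) ≤ (2 : ℝ) ^ (1 + c) := Real.rpow_le_rpow hε.le h2 (by linarith)
      have e3 : ε ^ (-4 - c) * ε ^ (1 + c) * ε ^ 3 = 1 := by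
        rw [← Real.rpow_natCast ε 3, ← Real.rpow_add hε, ← Real.rpow_add hε]
        have : -4 - c + (1 + c) + ((3 : ℕ) : ℝ) = 0 := by push_cast; ring
        rw [this, Real.rpow_zero]
      calc (5 * D * M ^ 8) ^ d
          = (5 * D * M ^ 8) ^ d * (ε ^ (-4 - c) * ε ^ (1 + c) * ε ^ 3) := by rw [e3, mul_one]
        _ ≤ (5 * D * M ^ 8) ^ d * (ε ^ (-4 - c) * (2 ^ (1 + c)) ^ d * ε ^ 3) := by
            gcongr
            exact e2.trans e1
        _ = (5 * D * M ^ 8 * 2 ^ (1 + c)) ^ d * ε ^ (-4 - c) * ε ^ 3 := by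
            rw [mul_pow (5 * D * M ^ 8)]; ring
        _ ≤ N * ε ^ 3 := by gcongr
    have hmeas : Measurable fun x : Fin n → ℝ => Real.sign (MvPolynomial.eval x p) :=
      isSignLike_sign.measurable.comp (measurable_eval_comp p measurable_id)
    simp only [hfp]
    rw [hY.integral_comp hmeas]
    exact (hD hd (by exact_mod_cast hN0) (fun i => (hX i).aemeasurable)
      (fun i => (hX i).matchesGaussian.mono hk') hind hp (by positivity)).trans_lt
      (threshold_bound_lt hd hD1 hM hε hN0 hNε)
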